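/- \textbf{Setting.} Let $n\ge 1$ and let $M=\coprod_{\alpha=1}^n[a_\alpha,b_\alpha]$, $a_\alpha<b_\alpha$, carry a Riemannian metric $\eta_\alpha(x)\,dx^2$ with $\eta_\alpha>0$ smooth on $[a_\alpha,b_\alpha]$. Let $V$ be a real potential, continuous on each $[a_\alpha,b_\alpha]$. Functions on $M$ are tuples $\Phi=(\Phi_\alpha)$ of complex functions on the intervals. Put $$\langle\Psi,\Phi\rangle=\sum_\alpha\int_{a_\alpha}^{b_\alpha}\bar\Psi_\alpha\Phi_\alpha\sqrt{\eta_\alpha}\,dx,\qquad \langle\Psi',\Phi'\rangle=\sum_\alpha\int_{a_\alpha}^{b_\alpha}\bar\Psi'_\alpha\Phi'_\alpha\frac{dx}{\sqrt{\eta_\alpha}},\qquad \|\Phi\|_{1,2}^2=\langle\Phi,\Phi\rangle+\langle\Phi',\Phi'\rangle .$$ Let $\varphi\in\mathbb C^{2n}$ be the vector of values of $\Phi$ at the $2n$ endpoints (first the left ones, then the right ones), and $\dot\varphi\in\mathbb C^{2n}$ the vector of exterior unit normal derivatives, $-\eta_\alpha(a_\alpha)^{-1/2}\Phi_\alpha'(a_\alpha)$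 and $\eta_\alpha(b_\alpha)^{-1/2}\Phi_\alpha'(b_\alpha)$. Let $$Q(\Psi,\Phi)=\langle\Psi',\Phi'\rangle-\sum_{l=1}^{2n}\bar\psi_l\dot\varphi_l+\langle\Psi,V\Phi\rangle .$$ A unitary matrix $U\in U(2n)$ determines the self-adjoint extension of $-\Delta_\eta+V$ with boundary condition $$\varphi-i\dot\varphi=U(\varphi+i\dot\varphi).\qquad(*)$$ Let $\widetilde D_U$ be the set of $\Phi\in H^1(M)$ (continuous representatives) whose derivatives at the endpoints exist and which satisfy $(*)$. A \emph{weak eigenpair} is $(\Phi,\lambda)$ with $0\neq\Phi\in\widetilde D_U$, $\lambda\in\mathbb C$, and $Q(\Psi,\Phi)=\lambda\langle\Psi,\Phi\rangle$ for all $\Psi\in C^\infty(M)$ (smooth up to the boundary). \textbf{Scheme.} Let $L_\alpha=b_\alpha-a_\alpha$, $L=\sum_\alpha L_\alpha$, $r_\alpha=\lfloor L_\alpha N/L\rfloor+1$, $|r|=\sum_\alpha r_\alpha$, $h_\alpha=L_\alpha/(r_\alpha+1)$, with nodes $x_k^{(\alpha)}=a_\alpha+kh_\alpha$, $0\le k\le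 r_\alpha+1$. The bulk function $f_k^{(\alpha)}$, $2\le k\le r_\alpha-1$, is the piecewise linear function on this mesh that is $1$ at $x^{(\alpha)}_k$ and $0$ at all other nodes of $M$. For an endpoint $l$ of the interval $\alpha$ let $\hat h_l=h_\alpha\sqrt{\eta_\alpha(l)}$, where $\eta_\alpha(l)$ is the value of $\eta_\alpha$ at that endpoint, and let $$F=\mathrm{diag}(1-i/\hat h)-U\,\mathrm{diag}(1+i/\hat h),\qquad C=-i(I+U)\,\mathrm{diag}(1/\hat h).$$ Call $N$ \emph{admissible} if all $r_\alpha\ge2$ and $F$ is invertible. Then the boundary function $\beta^{(i)}$, $i=1,\dots,2n$, is the piecewise linear function whose value at the interior node adjacent to the endpoint $i$ is $1$, whose values at the $2n$ endpoints form the $i$-th column of $F^{-1}C$, and whose value at every other node is $0$. Let $S^N$ be the span of all bulk and boundary functions. A solution of the Ritz–Galerkin problem is $(\Phi_N,\lambda_N)$ with $0\ne\Phi_N\in S^N$ and $Q(\Psi_N,\Phi_N)=\lambda_N\langle\Psi_N,\Phi_N\rangle$ for all $\Psi_N\in S^N$. \textbf{Theorem.} Let $U\in U(2n)$. (1) All sufficiently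 large $N$ are admissible. For every admissible $N$: $S^N\subset\widetilde D_U$, $\dim S^N=|r|$, and $S^N$ has an $L^2$-orthonormal basis of solutions $(\Phi_N^k,\lambda_N^k)$, $0\le k<|r|$, of the Ritz–Galerkin problem with real $\lambda_N^0\le\lambda_N^1\le\cdots$. (2) There are real numbers $\lambda^0\le\lambda^1\le\cdots\to\infty$ and $L^2$-orthonormal functions $\Phi^0,\Phi^1,\dots$ such that every $(\Phi^k,\lambda^k)$ is a weak eigenpair and, for every weak eigenpair $(\Psi,\mu)$, $\Psi$ lies in the linear span of the $\Phi^k$ with $\lambda^k=\mu$. (3) For every choice of the bases in (1), as $N\to\infty$: (a) $\lambda_N^k\to\lambda^k$ for every $k$; (b) for every $k$ there are weak eigenpairs $(\Psi_N,\lambda^k)$ with $\langle\Psi_N,\Psi_N\rangle=1$ such that $\|\Phi_N^k-\Psi_N\|_{1,2}\to0$; (c) for every weak eigenpair $(\Psi,\lambda)$ there are $w_N\in\mathrm{span}\{\Phi_N^j: j<|r|,\ \lambda^j=\lambda\}$ with $\|w_N-\Psi\|_{1,2}\to0$. -/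

import Mathlib

open Set Filter Topology MeasureTheory
open scoped ContDiff

noncomputable section

namespace SchrodingerFEM

/-! ### Sobolev functions of order one on a bounded interval -/

/-- `g` is a weak derivative of `u` on the open interval `(a, b)`. -/
def HasWeakDeriv (a b : ℝ) (u g : ℝ → ℂ) : Prop :=
  ∀ φ : ℝ → ℝ, ContDiff ℝ ∞ φ → HasCompactSupport φ → tsupport φ ⊆ Ioo a b →
    ∫ x in a..b, deriv φ x • u x = -∫ x in a..b, φ x • g x

/-- `u` is (the continuous representative on `[a, b]` of) an element of the Sobolev space
`H¹(a, b)`: it has a square integrable weak derivative. -/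
def MemH1 (a b : ℝ) (u : ℝ → ℂ) : Prop :=
  ContinuousOn u (Icc a b) ∧
    ∃ g : ℝ → ℂ, MemLp g 2 (volume.restrict (Ioo a b)) ∧ HasWeakDeriv a b u g

open Classical in
/-- The square integrable weak derivative of `u` on `(a, b)`. It is unique up to null sets;
it is only used for functions `u` that have one. -/
def weakDeriv (a b : ℝ) (u : ℝ → ℂ) : ℝ → ℂ :=
  if h : ∃ g : ℝ → ℂ, MemLp g 2 (volume.restrict (Ioo a b)) ∧ HasWeakDeriv a b u g
  then h.choose else 0

/-! ### The compact Riemannian 1-manifold with boundary and the Schrödinger operator -/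

/-- The data of a regular Schrödinger operator `-Δ_η + V` in dimension one: the manifold is the
disjoint union of the compact intervals `[a α, b α]`, with Riemannian metric `η α x dx²`. -/
structure Operator (n : ℕ) where
  a : Fin n → ℝ
  b : Fin n → ℝ
  a_lt_b : ∀ α, a α < b α
  η : Fin n → ℝ → ℝ
  η_smooth : ∀ α, ContDiffOn ℝ ∞ (η α) (Icc (a α) (b α))
  η_pos : ∀ α, ∀ x ∈ Icc (a α) (b α), 0 < η α x
  V : Fin n → ℝ → ℝ
  V_continuous : ∀ α, ContinuousOn (V α) (Icc (a α) (b α))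

/-- Complex functions on the manifold, one for each component; only the values on
`[a α, b α]` are relevant. -/
abbrev Fun (n : ℕ) : Type := Fin n → ℝ → ℂ

/-- Indices of the `2 n` boundary points: `inl α` is the left and `inr α` the right endpoint
of the interval number `α`. -/
abbrev Bdry (n : ℕ) : Type := Fin n ⊕ Fin n

namespace Operator

variable {n : ℕ} (H : Operator n)

/-- The inner product of `L²` of the manifold (Riemannian volume `√η dx`), conjugate linear in
the first argument. -/
def inner2 (Ψ Φ : Fun n) : ℂ :=
  ∑ α, ∫ x in (H.a α)..(H.b α),
    (starRingEnd ℂ) (Ψ α x) * Φ α x * (Real.sqrt (H.η α x) : ℂ)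

/-- The weak derivative `dΦ/dx` on every component. -/
def D (Φ : Fun n) : Fun n := fun α => weakDeriv (H.a α) (H.b α) (Φ α)

/-- The inner product `⟨Ψ', Φ'⟩` of the differentials: the covectors are paired by `η⁻¹` and
integrated against `√η dx`, which gives the weight `1 / √η`. -/
def energy (Ψ Φ : Fun n) : ℂ :=
  ∑ α, ∫ x in (H.a α)..(H.b α),
    (starRingEnd ℂ) (H.D Ψ α x) * H.D Φ α x * ((Real.sqrt (H.η α x))⁻¹ : ℂ)

/-- The Sobolev norm of order one. -/
def normH1 (Φ : Fun n) : ℝ := Real.sqrt (H.inner2 Φ Φ + H.energy Φ Φ).re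

/-- The length density `√η` of the metric at the boundary points. -/
def bdryDensity : Bdry n → ℝ
  | Sum.inl α => Real.sqrt (H.η α (H.a α))
  | Sum.inr α => Real.sqrt (H.η α (H.b α))

/-- Boundary values. -/
def trace (Φ : Fun n) : Bdry n → ℂ
  | Sum.inl α => Φ α (H.a α)
  | Sum.inr α => Φ α (H.b α)

/-- Derivatives `dΦ(ν)` along the exterior unit normal `ν` at the boundary points: `ν` is
`-η^(-1/2) d/dx` at a left endpoint and `η^(-1/2) d/dx` at a right endpoint. -/
def normalDeriv (Φ : Fun n) : Bdry n → ℂ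
  | Sum.inl α =>
      -(((H.bdryDensity (Sum.inl α))⁻¹ : ℝ) : ℂ) *
        derivWithin (Φ α) (Icc (H.a α) (H.b α)) (H.a α)
  | Sum.inr α =>
      (((H.bdryDensity (Sum.inr α))⁻¹ : ℝ) : ℂ) *
        derivWithin (Φ α) (Icc (H.a α) (H.b α)) (H.b α)

/-- The form `Q(Ψ, Φ) = ⟨Ψ', Φ'⟩ - [Ψ̄ Φ']_∂M + ⟨Ψ, V Φ⟩`. -/
def Q (Ψ Φ : Fun n) : ℂ :=
  H.energy Ψ Φ - ∑ l, (starRingEnd ℂ) (H.trace Ψ l) * H.normalDeriv Φ l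
    + H.inner2 Ψ (fun α x => (H.V α x : ℂ) * Φ α x)

/-- The boundary condition `φ - i φ̇ = U (φ + i φ̇)`. -/
def BoundaryCondition (U : Matrix.unitaryGroup (Bdry n) ℂ) (Φ : Fun n) : Prop :=
  H.trace Φ - Complex.I • H.normalDeriv Φ =
    (U : Matrix (Bdry n) (Bdry n) ℂ).mulVec (H.trace Φ + Complex.I • H.normalDeriv Φ)

/-- The space `D̃_U`: functions of class `H¹` whose normal derivatives at the boundary exist and
which satisfy the boundary condition given by `U`. -/
def weakDomain (U : Matrix.unitaryGroup (Bdry n) ℂ) : Set (Fun n) :=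
  {Φ | (∀ α, MemH1 (H.a α) (H.b α) (Φ α)) ∧
    (∀ α, DifferentiableWithinAt ℝ (Φ α) (Icc (H.a α) (H.b α)) (H.a α) ∧
      DifferentiableWithinAt ℝ (Φ α) (Icc (H.a α) (H.b α)) (H.b α)) ∧
    H.BoundaryCondition U Φ}

/-- Functions that are smooth on the manifold, up to the boundary. -/
def IsSmooth (Ψ : Fun n) : Prop := ∀ α, ContDiffOn ℝ ∞ (Ψ α) (Icc (H.a α) (H.b α))

/-- `(Φ, μ)` is a solution of the weak spectral problem, with `Φ` not zero on the manifold. -/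
def IsWeakEigenpair (U : Matrix.unitaryGroup (Bdry n) ℂ) (Φ : Fun n) (μ : ℂ) : Prop :=
  Φ ∈ H.weakDomain U ∧ (∃ α, ∃ x ∈ Icc (H.a α) (H.b α), Φ α x ≠ 0) ∧
    ∀ Ψ : Fun n, H.IsSmooth Ψ → H.Q Ψ Φ = μ * H.inner2 Ψ Φ

/-! ### The finite element spaces -/

/-- `r_α = [L_α N / L] + 1`, with `L_α = b α - a α` and `L` the sum of the `L_α`. -/
def r (N : ℕ) (α : Fin n) : ℕ :=
  ⌊(H.b α - H.a α) * N / ∑ γ, (H.b γ - H.a γ)⌋₊ + 1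

/-- The step `h_α = L_α / (r_α + 1)`. -/
def h (N : ℕ) (α : Fin n) : ℝ := (H.b α - H.a α) / (H.r N α + 1)

/-- The node `x_k` of the interval number `α`. -/
def node (N : ℕ) (α : Fin n) (k : ℕ) : ℝ := H.a α + H.h N α * k

/-- The function that is supported on the interval number `α`, piecewise linear on the
subdivision, `1` at the node `k` and `0` at all other nodes. For `2 ≤ k ≤ r_α - 1` this is the
bulk function `f_k^(α)`. -/
def hat (N : ℕ) (α : Fin n) (k : ℕ) : Fun n :=
  Pi.single α fun x => ((max 0 (1 - |x - H.node N α k| / H.h N α) : ℝ) : ℂ)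

/-- The step of the interval adjacent to a boundary point, measured with the metric at that
boundary point (it is `h_α` for the flat metric). A linear function on this interval with value
`v` at the boundary point and `w` at the other end has normal derivative `(v - w) / hBdry`. -/
def hBdry (N : ℕ) : Bdry n → ℝ
  | Sum.inl α => H.h N α * H.bdryDensity (Sum.inl α)
  | Sum.inr α => H.h N α * H.bdryDensity (Sum.inr α)

/-- The boundary matrix `F = diag(1 - i/h) - U diag(1 + i/h)`. -/
def boundaryMatrix (U : Matrix.unitaryGroup (Bdry n) ℂ) (N : ℕ) :
    Matrix (Bdry n) (Bdry n) ℂ :=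
  Matrix.diagonal (fun l => 1 - Complex.I / (H.hBdry N l : ℂ)) -
    (U : Matrix (Bdry n) (Bdry n) ℂ) *
      Matrix.diagonal (fun l => 1 + Complex.I / (H.hBdry N l : ℂ))

/-- The inhomogeneous term `C = -i (I + U) diag(1/h)`. -/
def boundaryRhs (U : Matrix.unitaryGroup (Bdry n) ℂ) (N : ℕ) :
    Matrix (Bdry n) (Bdry n) ℂ :=
  (-Complex.I) • ((1 + (U : Matrix (Bdry n) (Bdry n) ℂ)) *
    Matrix.diagonal (fun l => 1 / (H.hBdry N l : ℂ)))

/-- The solution of `F V = C` (when `F` is invertible): its column `i` holds the boundary values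
of the boundary function number `i`. -/
def boundaryValues (U : Matrix.unitaryGroup (Bdry n) ℂ) (N : ℕ) :
    Matrix (Bdry n) (Bdry n) ℂ :=
  (H.boundaryMatrix U N)⁻¹ * H.boundaryRhs U N

/-- The piecewise linear function that vanishes at all nodes except possibly the endpoints, where
its values are given by `v`, and the nodes adjacent to the endpoints, where its values are given
by `w`. -/
def betaFun (N : ℕ) (v w : Bdry n → ℂ) : Fun n :=
  ∑ α, (v (Sum.inl α) • H.hat N α 0 + w (Sum.inl α) • H.hat N α 1 +
    w (Sum.inr α) • H.hat N α (H.r N α) + v (Sum.inr α) • H.hat N α (H.r N α + 1))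

/-- The boundary function `β^(i)`. -/
def beta (U : Matrix.unitaryGroup (Bdry n) ℂ) (N : ℕ) (i : Bdry n) : Fun n :=
  H.betaFun N (fun l => H.boundaryValues U N l i) (Pi.single i 1)

/-- The Ritz-Galerkin space `S^N`, spanned by the bulk and the boundary functions. -/
def S (U : Matrix.unitaryGroup (Bdry n) ℂ) (N : ℕ) : Submodule ℂ (Fun n) :=
  Submodule.span ℂ
    ({f | ∃ α, ∃ k, 2 ≤ k ∧ k + 1 ≤ H.r N α ∧ f = H.hat N α k} ∪ Set.range (H.beta U N))

/-- The discretization number `N` is admissible for `U`: all `r_α ≥ 2`, and the boundary matrix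
is invertible, so that the boundary functions are determined. -/
def Admissible (U : Matrix.unitaryGroup (Bdry n) ℂ) (N : ℕ) : Prop :=
  (∀ α, 2 ≤ H.r N α) ∧ IsUnit (H.boundaryMatrix U N).det

/-- The dimension `|r|` of the approximation space. -/
def dimS (N : ℕ) : ℕ := ∑ α, H.r N α

/-- `(u k, μ k)`, for `k < |r|`, are solutions of the approximate eigenvalue problem on `S^N`,
with `u k` orthonormal in `L²`, and with the eigenvalues `μ k` in nondecreasing order. (The values
for `k ≥ |r|` are irrelevant.) -/
def IsRitzGalerkinSystem (U : Matrix.unitaryGroup (Bdry n) ℂ) (N : ℕ)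
    (u : ℕ → Fun n) (μ : ℕ → ℝ) : Prop :=
  (∀ k < H.dimS N, u k ∈ H.S U N ∧
    ∀ Ψ ∈ H.S U N, H.Q Ψ (u k) = (μ k : ℂ) * H.inner2 Ψ (u k)) ∧
  (∀ j < H.dimS N, ∀ k < H.dimS N, H.inner2 (u j) (u k) = if j = k then 1 else 0) ∧
  (∀ j k, j ≤ k → k < H.dimS N → μ j ≤ μ k)

/-- `(Φ k, lam k)` is an enumeration of all solutions of the weak spectral problem: the `lam k`
are the eigenvalues in nondecreasing order, repeated according to multiplicity, and the `Φ k` are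
corresponding eigenfunctions, orthonormal in `L²`. -/
def IsWeakSpectrum (U : Matrix.unitaryGroup (Bdry n) ℂ) (Φ : ℕ → Fun n) (lam : ℕ → ℝ) :
    Prop :=
  (∀ k, H.IsWeakEigenpair U (Φ k) (lam k : ℂ)) ∧
  (∀ j k, H.inner2 (Φ j) (Φ k) = if j = k then 1 else 0) ∧
  Monotone lam ∧ Tendsto lam atTop atTop ∧
  (∀ (Ψ : Fun n) (μ : ℂ), H.IsWeakEigenpair U Ψ μ →
    ∃ Ψ₁ ∈ Submodule.span ℂ {f | ∃ k, (lam k : ℂ) = μ ∧ f = Φ k},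
      ∀ α, EqOn (Ψ α) (Ψ₁ α) (Icc (H.a α) (H.b α)))

end Operator

end SchrodingerFEM

end

/-! The form `Q` is not hermitian on all of H¹, but on functions that satisfy the boundary condition
it becomes so. The condition says that φ = (1+U)s and φ̇ = -i(1-U)s for some s. Such pairs form an
isotropic subspace, so for every ψ in the range of 1+U the pairing of ψ with φ̇ depends on φ alone:
it equals the pairing with Aφ for a linear map A (`bdryMap`). Replacing φ̇ by Aφ in `Q` gives a
hermitian form (`form`) on the H¹ functions with trace in that range. A trace inequality with a
small parameter bounds it below, so after a shift it is a semi-inner product equivalent to the H¹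
one. The resulting space is complete and embeds compactly into L² by Arzelà–Ascoli.

Eigenvectors of this form that do not vanish on the manifold are the weak eigenfunctions. Weak
solutions are C¹ up to the boundary by the lemma of du Bois-Reymond, Green's formula then holds for
all H¹ test functions, and the boundary condition comes out as a natural one
(`IsWeakEigenpair.form_eq`, `isWeakEigenpair_of_form_eq`).

The spectral theory is done for an abstract compact embedding J : V → E, by successive minimization
of ‖v‖²/‖Jv‖². The space S^N satisfies the boundary condition, so the method is conforming: min-max
gives ρ k ≤ σ N k, and testing with approximations of the exact eigenvectors gives the reverse bound
in the limit (`IsGalerkin.le_ritz`, `IsGalerkin.ritz_le`). Convergence of eigenvectors follows from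
an energy identity and a gap in the spectrum (`tendsto_sub_spectral_projection`), used once with the
exact system and once with the discrete one.

It remains to approximate a C¹ eigenfunction in H¹ from S^N. Its nodal interpolant converges but
misses the discrete boundary condition. Keep the interior nodal values and let the boundary
condition fix the boundary values; let e be their change. Pairing the discrete condition with e
gives ∑ |e_l|²/ĥ_l ≤ C|e|² + A|e| with constants independent of N (`IsBoundaryPair.sum_le`). For
small ĥ the left side dominates, so e → 0 and then the whole sum tends to 0. Up to the boundary
densities this sum is the energy of the correction. The same inequality with zero data shows that F
is injective for large N (`eventually_admissible`). -/

namespace SchrodingerFEM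

/-! ### Spectral theory of a compact embedding of semi-inner product spaces -/

section Abstract

open scoped InnerProductSpace

variable {V E : Type*} [SeminormedAddCommGroup V] [InnerProductSpace ℂ V]
  [SeminormedAddCommGroup E] [InnerProductSpace ℂ E]

/-- A bounded linear map between semi-inner product spaces which vanishes only on vectors of
seminorm zero, and for which the images of bounded sequences have Cauchy subsequences. -/
structure IsCompactEmbedding (J : V →ₗ[ℂ] E) : Prop where
  bound : ∃ C, 0 ≤ C ∧ ∀ v, ‖J v‖ ≤ C * ‖v‖
  ker : ∀ v, ‖J v‖ = 0 → ‖v‖ = 0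
  compact : ∀ v : ℕ → V, (∃ C, ∀ n, ‖v n‖ ≤ C) →
    ∃ φ : ℕ → ℕ, StrictMono φ ∧ CauchySeq fun n => J (v (φ n))

variable {J : V →ₗ[ℂ] E}

/-- The parallelogram laws in `V` and in `E`, with the lower bound applied to `v + w`. Along a
minimizing sequence whose images are Cauchy the right-hand side tends to zero, so the sequence
itself is Cauchy; no weak compactness is needed. -/
lemma norm_sq_add_mul_le {K : Submodule ℂ V} {m : ℝ} (hm : ∀ v ∈ K, m ^ 2 * ‖J v‖ ^ 2 ≤ ‖v‖ ^ 2)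
    {v w : V} (hv : v ∈ K) (hw : w ∈ K) (hv1 : ‖J v‖ = 1) (hw1 : ‖J w‖ = 1) :
    ‖v - w‖ ^ 2 ≤ 2 * (‖v‖ ^ 2 - m ^ 2) + 2 * (‖w‖ ^ 2 - m ^ 2) + m ^ 2 * ‖J v - J w‖ ^ 2 := by
  have h1 := parallelogram_law_with_norm ℂ v w
  have h2 := parallelogram_law_with_norm ℂ (J v) (J w)
  have h3 := hm (v + w) (K.add_mem hv hw)
  rw [map_add] at h3
  rw [hv1, hw1] at h2
  have h4 : m ^ 2 * ‖J v + J w‖ ^ 2 = m ^ 2 * 4 - m ^ 2 * ‖J v - J w‖ ^ 2 := by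
    have : ‖J v + J w‖ ^ 2 = 4 - ‖J v - J w‖ ^ 2 := by linarith
    rw [this]; ring
  nlinarith

/-- The direct method: a normalized minimizing sequence is bounded, compactness makes the images of
a subsequence Cauchy, and `norm_sq_add_mul_le` lifts this to `V`. -/
lemma IsCompactEmbedding.exists_minimizer [CompleteSpace V] (hJ : IsCompactEmbedding J)
    (K : Submodule ℂ V) (hK : IsClosed (K : Set V)) (hne : ∃ v ∈ K, ‖v‖ ≠ 0) :
    ∃ u ∈ K, ‖J u‖ = 1 ∧ ∀ v ∈ K, ‖u‖ ^ 2 * ‖J v‖ ^ 2 ≤ ‖v‖ ^ 2 := by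
  set A : Set ℝ := {t | ∃ v ∈ K, ‖J v‖ = 1 ∧ ‖v‖ = t} with hA
  have scale : ∀ v ∈ K, ‖J v‖ ≠ 0 → ‖v‖ / ‖J v‖ ∈ A := by
    intro v hv h
    refine ⟨((‖J v‖⁻¹ : ℝ) : ℂ) • v, K.smul_mem _ hv, ?_, ?_⟩
    · rw [map_smul, norm_smul, Complex.norm_real, norm_inv, norm_norm, inv_mul_cancel₀ h]
    · rw [norm_smul, Complex.norm_real, norm_inv, norm_norm, div_eq_inv_mul]
  have hAne : A.Nonempty := by
    obtain ⟨v, hv, h⟩ := hne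
    exact ⟨_, scale v hv fun h' => h (hJ.ker v h')⟩
  have hAb : BddBelow A := ⟨0, by rintro _ ⟨v, -, -, rfl⟩; exact norm_nonneg v⟩
  set m := sInf A with hm
  have hm0 : 0 ≤ m := le_csInf hAne (by rintro _ ⟨v, -, -, rfl⟩; exact norm_nonneg v)
  have hmin : ∀ v ∈ K, m ^ 2 * ‖J v‖ ^ 2 ≤ ‖v‖ ^ 2 := by
    intro v hv
    by_cases h : ‖J v‖ = 0
    · rw [h]; simp
    · have := csInf_le hAb (scale v hv h)
      have hpos : 0 < ‖J v‖ := lt_of_le_of_ne (norm_nonneg _) (Ne.symm h)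
      rw [le_div_iff₀ hpos] at this
      rw [← mul_pow]
      exact pow_le_pow_left₀ (by positivity) this 2
  obtain ⟨t, -, htend, htA⟩ := exists_seq_tendsto_sInf hAne hAb
  choose v hvK hv1 hvt using htA
  obtain ⟨C, hC⟩ := htend.bddAbove_range
  obtain ⟨φ, hφ, hcau⟩ := hJ.compact v ⟨C, fun n => by rw [hvt]; exact hC ⟨n, rfl⟩⟩
  have hnorm : Tendsto (fun n => ‖v (φ n)‖ ^ 2 - m ^ 2) atTop (𝓝 0) := by
    have h1 : Tendsto (fun n => ‖v (φ n)‖) atTop (𝓝 m) := by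
      simp only [hvt]; exact htend.comp hφ.tendsto_atTop
    have h2 := (h1.pow 2).sub_const (m ^ 2)
    rwa [sub_self] at h2
  have hcv : CauchySeq fun n => v (φ n) := by
    rw [Metric.cauchySeq_iff]
    intro ε hε
    -- The two energy excesses will contribute at most `ε² / 4` together, and the image term at most
    -- another `ε² / 4`. The `m + 1` allows for `m = 0`.
    obtain ⟨N1, h1⟩ := Metric.cauchySeq_iff.1 hcau (ε / (2 * (m + 1))) (by positivity)
    obtain ⟨N2, h2⟩ := Metric.tendsto_atTop.1 hnorm (ε ^ 2 / 16) (by positivity)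
    refine ⟨max N1 N2, fun k hk l hl => ?_⟩
    have h3 := h1 k (le_of_max_le_left hk) l (le_of_max_le_left hl)
    have h4 := h2 k (le_of_max_le_right hk)
    have h5 := h2 l (le_of_max_le_right hl)
    rw [dist_eq_norm] at h3 ⊢
    rw [Real.dist_eq, sub_zero] at h4 h5
    have h6 := norm_sq_add_mul_le hmin (hvK (φ k)) (hvK (φ l)) (hv1 _) (hv1 _)
    have h7 : m ^ 2 * ‖J (v (φ k)) - J (v (φ l))‖ ^ 2 ≤ ε ^ 2 / 4 := by
      have : m * ‖J (v (φ k)) - J (v (φ l))‖ ≤ ε / 2 := by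
        calc m * ‖J (v (φ k)) - J (v (φ l))‖ ≤ (m + 1) * (ε / (2 * (m + 1))) := by
              gcongr; linarith
          _ = ε / 2 := by field_simp
      calc _ = (m * ‖J (v (φ k)) - J (v (φ l))‖) ^ 2 := by ring
        _ ≤ (ε / 2) ^ 2 := pow_le_pow_left₀ (by positivity) this 2
        _ = _ := by ring
    have h8 := le_abs_self (‖v (φ k)‖ ^ 2 - m ^ 2)
    have h9 := le_abs_self (‖v (φ l)‖ ^ 2 - m ^ 2)
    refine lt_of_pow_lt_pow_left₀ 2 hε.le ?_
    nlinarith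
  obtain ⟨u, hu⟩ := cauchySeq_tendsto_of_complete hcv
  have huK : u ∈ K := hK.mem_of_tendsto hu (Eventually.of_forall fun n => hvK _)
  have hum : ‖u‖ = m := by
    refine tendsto_nhds_unique hu.norm ?_
    simp only [hvt]; exact htend.comp hφ.tendsto_atTop
  have huJ : ‖J u‖ = 1 := by
    obtain ⟨C, -, hC⟩ := hJ.bound
    have hcont : Tendsto (fun n => J (v (φ n))) atTop (𝓝 (J u)) :=
      ((J.mkContinuous C hC).continuous.tendsto u).comp hu
    refine tendsto_nhds_unique hcont.norm ?_
    simp only [hv1]; exact tendsto_const_nhds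
  exact ⟨u, huK, huJ, by rw [hum]; exact hmin⟩

/-- First variation. Moving `u` by `-t * conj z • v`, with `z` the residual of the equation, changes
the inequality of the minimum by `2 t ‖z‖²` to first order; this must be dominated by a term in `t²`
for every real `t`. -/
lemma inner_eq_of_minimizer {K : Submodule ℂ V} {u : V} (hu : u ∈ K) (hu1 : ‖J u‖ = 1)
    (hmin : ∀ v ∈ K, ‖u‖ ^ 2 * ‖J v‖ ^ 2 ≤ ‖v‖ ^ 2) {v : V} (hv : v ∈ K) :
    ⟪v, u⟫_ℂ = ((‖u‖ ^ 2 : ℝ) : ℂ) * ⟪J v, J u⟫_ℂ := by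
  set z := ⟪u, v⟫_ℂ - ((‖u‖ ^ 2 : ℝ) : ℂ) * ⟪J u, J v⟫_ℂ with hz
  have key : ∀ t : ℝ, 2 * t * ‖z‖ ^ 2 ≤ t ^ 2 * (‖z‖ ^ 2 * ‖v‖ ^ 2) := by
    intro t
    have h := hmin (u - ((t : ℂ) * (starRingEnd ℂ) z) • v) (K.sub_mem hu (K.smul_mem _ hv))
    rw [map_sub, map_smul, norm_sub_sq (𝕜 := ℂ), norm_sub_sq (𝕜 := ℂ), inner_smul_right,
      inner_smul_right, norm_smul, norm_smul, hu1] at h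
    have e1 : RCLike.re (((t : ℂ) * (starRingEnd ℂ) z) * ⟪u, v⟫_ℂ)
        - ‖u‖ ^ 2 * RCLike.re (((t : ℂ) * (starRingEnd ℂ) z) * ⟪J u, J v⟫_ℂ) = t * ‖z‖ ^ 2 := by
      have : ((t : ℂ) * (starRingEnd ℂ) z) * ⟪u, v⟫_ℂ
        - ((‖u‖ ^ 2 : ℝ) : ℂ) * (((t : ℂ) * (starRingEnd ℂ) z) * ⟪J u, J v⟫_ℂ)
          = ((t * ‖z‖ ^ 2 : ℝ) : ℂ) := by
        have h1 : (starRingEnd ℂ) z * z = ((‖z‖ ^ 2 : ℝ) : ℂ) := by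
          rw [Complex.conj_mul']; push_cast; ring
        push_cast at h1 ⊢
        rw [← h1]
        simp only [hz]; push_cast; ring
      have h2 := congrArg Complex.re this
      rw [Complex.sub_re, Complex.re_ofReal_mul, Complex.ofReal_re] at h2
      exact h2
    have e2 : ‖(t : ℂ) * (starRingEnd ℂ) z‖ ^ 2 = t ^ 2 * ‖z‖ ^ 2 := by
      rw [norm_mul, Complex.norm_real, RCLike.norm_conj, mul_pow, Real.norm_eq_abs, sq_abs]
    rw [mul_pow, mul_pow, e2] at h
    have h5 : 0 ≤ ‖u‖ ^ 2 * (t ^ 2 * ‖z‖ ^ 2 * ‖J v‖ ^ 2) := by positivity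
    nlinarith
  have hz0 : z = 0 := by
    by_contra hne
    have hzp : 0 < ‖z‖ ^ 2 := by positivity
    -- If `z ≠ 0`, this `t` gives `2 (‖v‖² + 1) ≤ ‖v‖²`; it is meaningful also for `‖v‖ = 0`.
    have h1 := key (1 / (‖v‖ ^ 2 + 1))
    have hd : 0 < ‖v‖ ^ 2 + 1 := by positivity
    rw [div_pow, one_pow] at h1
    have h2 : 2 * ‖z‖ ^ 2 * (‖v‖ ^ 2 + 1) ≤ ‖z‖ ^ 2 * ‖v‖ ^ 2 := by
      have := mul_le_mul_of_nonneg_right h1 (sq_nonneg (‖v‖ ^ 2 + 1))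
      field_simp at this
      nlinarith
    nlinarith [mul_nonneg hzp.le (sq_nonneg ‖v‖)]
  have h := congrArg (starRingEnd ℂ) (sub_eq_zero.1 hz0)
  rw [map_mul, inner_conj_symm, inner_conj_symm, Complex.conj_ofReal] at h
  exact h

/-- The sequence in which every term is chosen as a function of the previous ones. -/
def greedy {α : Type*} (c : ∀ k : ℕ, (Fin k → α) → α) (k : ℕ) : α :=
  c k fun i => greedy c i

/-- `e k` minimizes the Rayleigh quotient `‖v‖² / ‖J v‖²` among the vectors orthogonal to the
previous members of the sequence `e`. -/
structure IsMinimizing (J : V →ₗ[ℂ] E) (e : ℕ → V) (k : ℕ) : Prop where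
  norm_eq : ‖J (e k)‖ = 1
  inner_eq : ∀ j < k, ⟪e j, e k⟫_ℂ = 0
  le : ∀ v, (∀ j < k, ⟪e j, v⟫_ℂ = 0) → ‖e k‖ ^ 2 * ‖J v‖ ^ 2 ≤ ‖v‖ ^ 2

/-- There are nonzero vectors orthogonal to any given `k` vectors. -/
def HasRoom (V : Type*) [SeminormedAddCommGroup V] [InnerProductSpace ℂ V] (k : ℕ) : Prop :=
  ∀ s : Fin k → V, ∃ v, (∀ i, ⟪s i, v⟫_ℂ = 0) ∧ ‖v‖ ≠ 0

/-- The choice function takes the value `0` once there is no room left, so a single sequence serves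
finite and infinite dimensional spaces alike. -/
lemma IsCompactEmbedding.exists_isMinimizing [CompleteSpace V] (hJ : IsCompactEmbedding J) :
    ∃ e : ℕ → V, ∀ k, HasRoom V k → IsMinimizing J e k := by
  have h : ∀ k : ℕ, ∀ s : Fin k → V, ∃ u : V, HasRoom V k → ‖J u‖ = 1 ∧
      (∀ i, ⟪s i, u⟫_ℂ = 0) ∧
      ∀ v, (∀ i, ⟪s i, v⟫_ℂ = 0) → ‖u‖ ^ 2 * ‖J v‖ ^ 2 ≤ ‖v‖ ^ 2 := by
    intro k s
    by_cases hr : HasRoom V k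
    · let K : Submodule ℂ V := ⨅ i, LinearMap.ker (innerSL ℂ (s i)).toLinearMap
      have hmem : ∀ v, v ∈ K ↔ ∀ i, ⟪s i, v⟫_ℂ = 0 := by
        intro v; simp [K, Submodule.mem_iInf]
      have hK : IsClosed (K : Set V) := by
        have : (K : Set V) = ⋂ i, {v | ⟪s i, v⟫_ℂ = 0} := by
          ext v; simp [hmem]
        rw [this]
        exact isClosed_iInter fun i =>
          isClosed_eq (continuous_const.inner continuous_id) continuous_const
      obtain ⟨v, hv, hv0⟩ := hr s
      obtain ⟨u, hu, h1, h2⟩ := hJ.exists_minimizer K hK ⟨v, (hmem v).2 hv, hv0⟩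
      exact ⟨u, fun _ => ⟨h1, (hmem u).1 hu, fun v hv => h2 v ((hmem v).2 hv)⟩⟩
    · exact ⟨0, fun h => absurd h hr⟩
  choose c hc using h
  refine ⟨greedy c, fun k hk => ?_⟩
  have heq : greedy c k = c k fun i => greedy c i := by rw [greedy]
  have := hc k (fun i => greedy c i) hk
  rw [← heq] at this
  exact ⟨this.1, fun j hj => this.2.1 ⟨j, hj⟩, fun v hv => this.2.2 v fun i => hv i i.2⟩

/-- The vectors `e k`, `k < m`, are `J`-orthonormal in `S`, and they satisfy the variational
eigenvalue equations on `S` for the numbers `ρ k`. -/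
structure IsOrthoEigen (J : V →ₗ[ℂ] E) (S : Submodule ℂ V) (m : ℕ) (e : ℕ → V) (ρ : ℕ → ℝ) :
    Prop where
  mem : ∀ k < m, e k ∈ S
  eig : ∀ k < m, ∀ v ∈ S, ⟪v, e k⟫_ℂ = (ρ k : ℂ) * ⟪J v, J (e k)⟫_ℂ
  orth : ∀ j < m, ∀ k < m, ⟪J (e j), J (e k)⟫_ℂ = if j = k then 1 else 0

/-- A family as in `IsOrthoEigen`, with `ρ 0 ≤ ρ 1 ≤ ⋯` given by the minimum principle. -/
structure IsEigenfamily (J : V →ₗ[ℂ] E) (S : Submodule ℂ V) (m : ℕ) (e : ℕ → V) (ρ : ℕ → ℝ) :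
    Prop extends IsOrthoEigen J S m e ρ where
  mono : ∀ j k, j ≤ k → k < m → ρ j ≤ ρ k
  tail : ∀ k < m, ∀ v ∈ S, (∀ j < k, ⟪J (e j), J v⟫_ℂ = 0) → ρ k * ‖J v‖ ^ 2 ≤ ‖v‖ ^ 2

lemma inner_self_eq_ofReal (v : V) : ⟪v, v⟫_ℂ = ((‖v‖ ^ 2 : ℝ) : ℂ) := by
  rw [inner_self_eq_norm_sq_to_K]; push_cast; rfl

lemma IsMinimizing.norm_pos (hJ : IsCompactEmbedding J) {e : ℕ → V} {k : ℕ}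
    (h : IsMinimizing J e k) : 0 < ‖e k‖ := by
  obtain ⟨C, hC0, hC⟩ := hJ.bound
  refine lt_of_le_of_ne (norm_nonneg _) fun h0 => ?_
  have := hC (e k)
  rw [h.norm_eq, ← h0] at this
  norm_num at this

/-- Minimality gives the eigenvalue equation only against vectors orthogonal to the earlier `e j`.
Any `v` differs from such a vector by its projection `w` onto the earlier ones, and `w` pairs to
zero with `e k` in `V` by construction, and under `J` by the equations already known for `j < k`,
whose eigenvalues are nonzero. -/
lemma IsMinimizing.isEigenfamily (hJ : IsCompactEmbedding J) {e : ℕ → V} {m : ℕ}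
    (h : ∀ k < m, IsMinimizing J e k) :
    IsEigenfamily J ⊤ m e fun k => ‖e k‖ ^ 2 := by
  have eig : ∀ k < m, ∀ v, ⟪v, e k⟫_ℂ = ((‖e k‖ ^ 2 : ℝ) : ℂ) * ⟪J v, J (e k)⟫_ℂ := by
    intro k
    induction k using Nat.strong_induction_on with
    | _ k ih =>
    intro hk v
    have hpos : ∀ j < k, ((‖e j‖ ^ 2 : ℝ) : ℂ) ≠ 0 := fun j hj => by
      have := (h j (hj.trans hk)).norm_pos hJ
      exact_mod_cast (pow_pos this 2).ne'
    have horth : ∀ i < k, ∀ j < k, i ≠ j → ⟪e i, e j⟫_ℂ = 0 := by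
      intro i hi j hj hij
      rcases lt_or_gt_of_ne hij with h1 | h1
      · exact (h j (hj.trans hk)).inner_eq i h1
      · rw [← inner_conj_symm, (h i (hi.trans hk)).inner_eq j h1, map_zero]
    have hJorth : ∀ j < k, ⟪J (e j), J (e k)⟫_ℂ = 0 := by
      intro j hj
      have h1 := ih j hj (hj.trans hk) (e k)
      rw [← inner_conj_symm, (h k hk).inner_eq j hj, map_zero] at h1
      rw [← inner_conj_symm, (mul_eq_zero.1 h1.symm).resolve_left (hpos j hj), map_zero]
    set w := ∑ j ∈ Finset.range k, (⟪e j, v⟫_ℂ / ((‖e j‖ ^ 2 : ℝ) : ℂ)) • e j with hw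
    have hself : ∀ j, ⟪e j, e j⟫_ℂ = ((‖e j‖ ^ 2 : ℝ) : ℂ) := fun j =>
      inner_self_eq_ofReal _
    have hK : ∀ i < k, ⟪e i, v - w⟫_ℂ = 0 := by
      intro i hi
      rw [inner_sub_right, hw, inner_sum, Finset.sum_eq_single i]
      · rw [inner_smul_right, hself, div_mul_cancel₀ _ (hpos i hi), sub_self]
      · intro j hj hji
        rw [inner_smul_right, horth i hi j (Finset.mem_range.1 hj) hji.symm, mul_zero]
      · intro hn; exact absurd (Finset.mem_range.2 hi) hn
    let K : Submodule ℂ V := ⨅ i : Fin k, LinearMap.ker (innerSL ℂ (e i)).toLinearMap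
    have hmem : ∀ v, v ∈ K ↔ ∀ j < k, ⟪e j, v⟫_ℂ = 0 := by
      intro v
      simp only [K, Submodule.mem_iInf, LinearMap.mem_ker]
      exact ⟨fun H j hj => H ⟨j, hj⟩, fun H i => H i i.2⟩
    have h1 := inner_eq_of_minimizer (K := K) ((hmem _).2 (h k hk).inner_eq) (h k hk).norm_eq
      (fun v hv => (h k hk).le v ((hmem v).1 hv)) ((hmem _).2 hK)
    have h2 : ⟪w, e k⟫_ℂ = 0 := by
      rw [hw, sum_inner]
      refine Finset.sum_eq_zero fun j hj => ?_
      rw [inner_smul_left, (h k hk).inner_eq j (Finset.mem_range.1 hj), mul_zero]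
    have h3 : ⟪J w, J (e k)⟫_ℂ = 0 := by
      rw [hw, map_sum, sum_inner]
      refine Finset.sum_eq_zero fun j hj => ?_
      rw [map_smul, inner_smul_left, hJorth j (Finset.mem_range.1 hj), mul_zero]
    rwa [map_sub, inner_sub_left, inner_sub_left, h2, h3, sub_zero, sub_zero] at h1
  have hlt : ∀ j k, j < k → k < m → ⟪J (e j), J (e k)⟫_ℂ = 0 := by
    intro j k hjk hk
    have h1 := eig k hk (e j)
    rw [(h k hk).inner_eq j hjk] at h1
    have h2 : ((‖e k‖ ^ 2 : ℝ) : ℂ) ≠ 0 := by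
      have := (h k hk).norm_pos hJ
      exact_mod_cast (pow_pos this 2).ne'
    exact (mul_eq_zero.1 h1.symm).resolve_left h2
  refine ⟨⟨fun _ _ => trivial, fun k hk v _ => eig k hk v, ?_⟩, ?_, ?_⟩
  · intro j hj k hk
    split_ifs with hjk
    · subst hjk
      rw [inner_self_eq_norm_sq_to_K, (h j hj).norm_eq]; simp
    · rcases lt_or_gt_of_ne hjk with h1 | h1
      · exact hlt j k h1 hk
      · rw [← inner_conj_symm, hlt k j h1 hj, map_zero]
  · intro j k hjk hk
    have h1 := (h j (hjk.trans_lt hk)).le (e k) fun i hi => (h k hk).inner_eq i (hi.trans_le hjk)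
    rwa [(h k hk).norm_eq, one_pow, mul_one] at h1
  · intro k hk v _ hv
    -- The eigenvalue equation converts `J`-orthogonality to `e j` into orthogonality in `V`.
    refine (h k hk).le v fun j hj => ?_
    rw [← inner_conj_symm, eig j (hj.trans hk) v, ← inner_conj_symm (J v), hv j hj]
    simp

section

variable {S : Submodule ℂ V} {m : ℕ} {e : ℕ → V} {ρ : ℕ → ℝ}

namespace IsOrthoEigen

lemma inner_eq (h : IsOrthoEigen J S m e ρ) {j k : ℕ} (hj : j < m) (hk : k < m) :
    ⟪e j, e k⟫_ℂ = if j = k then (ρ k : ℂ) else 0 := by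
  rw [h.eig k hk _ (h.mem j hj), h.orth j hj k hk]
  split_ifs <;> simp

lemma eig_left (h : IsOrthoEigen J S m e ρ) {k : ℕ} (hk : k < m) {v : V} (hv : v ∈ S) :
    ⟪e k, v⟫_ℂ = (ρ k : ℂ) * ⟪J (e k), J v⟫_ℂ := by
  rw [← inner_conj_symm, h.eig k hk v hv, map_mul, inner_conj_symm, Complex.conj_ofReal]

lemma norm_sq_eq (h : IsOrthoEigen J S m e ρ) {k : ℕ} (hk : k < m) : ‖e k‖ ^ 2 = ρ k := by
  have h1 := h.inner_eq hk hk
  rw [inner_self_eq_ofReal, if_pos rfl] at h1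
  exact_mod_cast h1

lemma norm_map_eq (h : IsOrthoEigen J S m e ρ) {k : ℕ} (hk : k < m) : ‖J (e k)‖ = 1 := by
  have h1 := h.orth k hk k hk
  rw [inner_self_eq_ofReal, if_pos rfl] at h1
  have h2 : ‖J (e k)‖ ^ 2 = 1 := by exact_mod_cast h1
  nlinarith [norm_nonneg (J (e k))]

lemma nonneg (h : IsOrthoEigen J S m e ρ) {k : ℕ} (hk : k < m) : 0 ≤ ρ k := by
  rw [← h.norm_sq_eq hk]; positivity

lemma norm_sq_sum (h : IsOrthoEigen J S m e ρ) {k : ℕ} (hk : k ≤ m) (c : ℕ → ℂ) :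
    ‖∑ i ∈ Finset.range k, c i • e i‖ ^ 2 = ∑ i ∈ Finset.range k, ρ i * ‖c i‖ ^ 2 := by
  have h1 : ⟪∑ i ∈ Finset.range k, c i • e i, ∑ i ∈ Finset.range k, c i • e i⟫_ℂ
      = ((∑ i ∈ Finset.range k, ρ i * ‖c i‖ ^ 2 : ℝ) : ℂ) := by
    rw [sum_inner]
    push_cast
    refine Finset.sum_congr rfl fun i hi => ?_
    rw [inner_sum, Finset.sum_eq_single i]
    · rw [inner_smul_left, inner_smul_right,
        h.inner_eq ((Finset.mem_range.1 hi).trans_le hk) ((Finset.mem_range.1 hi).trans_le hk),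
        if_pos rfl, ← mul_assoc, Complex.conj_mul', mul_comm]
    · intro j hj hji
      rw [inner_smul_left, inner_smul_right,
        h.inner_eq ((Finset.mem_range.1 hi).trans_le hk) ((Finset.mem_range.1 hj).trans_le hk),
        if_neg hji.symm]
      simp
    · intro hn; exact absurd hi hn
  rw [inner_self_eq_ofReal] at h1
  exact_mod_cast h1

lemma norm_sq_map_sum (h : IsOrthoEigen J S m e ρ) {k : ℕ} (hk : k ≤ m) (c : ℕ → ℂ) :
    ‖J (∑ i ∈ Finset.range k, c i • e i)‖ ^ 2 = ∑ i ∈ Finset.range k, ‖c i‖ ^ 2 := by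
  have h1 : ⟪J (∑ i ∈ Finset.range k, c i • e i), J (∑ i ∈ Finset.range k, c i • e i)⟫_ℂ
      = ((∑ i ∈ Finset.range k, ‖c i‖ ^ 2 : ℝ) : ℂ) := by
    simp only [map_sum, map_smul]
    rw [sum_inner]
    push_cast
    refine Finset.sum_congr rfl fun i hi => ?_
    rw [inner_sum, Finset.sum_eq_single i]
    · rw [inner_smul_left, inner_smul_right,
        h.orth _ ((Finset.mem_range.1 hi).trans_le hk) _ ((Finset.mem_range.1 hi).trans_le hk),
        if_pos rfl, ← mul_assoc, Complex.conj_mul', mul_one]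
    · intro j hj hji
      rw [inner_smul_left, inner_smul_right,
        h.orth _ ((Finset.mem_range.1 hi).trans_le hk) _ ((Finset.mem_range.1 hj).trans_le hk),
        if_neg hji.symm]
      simp
    · intro hn; exact absurd hi hn
  rw [inner_self_eq_ofReal] at h1
  exact_mod_cast h1

end IsOrthoEigen

/-- Among the linear combinations of `k + 1` vectors there is one which is admissible in the
minimum principle for `ρ k`. -/
lemma IsEigenfamily.exists_combination (h : IsEigenfamily J S m e ρ) {k : ℕ} (hk : k < m)
    (w : ℕ → V)
    (hw : ∀ i ≤ k, w i ∈ S) :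
    ∃ c : ℕ → ℂ, 0 < ∑ i ∈ Finset.range (k + 1), ‖c i‖ ^ 2 ∧
      ρ k * ‖J (∑ i ∈ Finset.range (k + 1), c i • w i)‖ ^ 2
        ≤ ‖∑ i ∈ Finset.range (k + 1), c i • w i‖ ^ 2 := by
  -- Orthogonality to `e 0, …, e (k - 1)` is `k` linear conditions on `k + 1` coefficients.
  let f : (Fin (k + 1) → ℂ) →ₗ[ℂ] (Fin k → ℂ) :=
    LinearMap.pi fun j => ∑ i : Fin (k + 1), ⟪J (e j), J (w i)⟫_ℂ • LinearMap.proj i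
  have hf : LinearMap.ker f ≠ ⊥ := LinearMap.ker_ne_bot_of_finrank_lt (by simp)
  obtain ⟨c, hc, hc0⟩ := (Submodule.ne_bot_iff _).1 hf
  let c' : ℕ → ℂ := fun i => if hi : i < k + 1 then c ⟨i, hi⟩ else 0
  have hc' : ∀ i : Fin (k + 1), c' i = c i := fun i => dif_pos i.2
  refine ⟨c', ?_, ?_⟩
  · rw [Finset.sum_range]
    simp only [hc']
    obtain ⟨i, hi⟩ := Function.ne_iff.1 hc0
    refine Finset.sum_pos' (fun i _ => by positivity) ⟨i, Finset.mem_univ _, ?_⟩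
    have : c i ≠ 0 := hi
    positivity
  · refine h.tail k hk _ (S.sum_mem fun i hi => S.smul_mem _ (hw i ?_)) fun j hj => ?_
    · exact Nat.lt_succ_iff.1 (Finset.mem_range.1 hi)
    · have := congrFun (LinearMap.mem_ker.1 hc) ⟨j, hj⟩
      rw [Finset.sum_range]
      simp only [hc', map_sum, map_smul, inner_sum, inner_smul_right]
      simpa [f, mul_comm] using this

end

/-- By dimension the family is a basis of `S`, and in coordinates the two squared norms are `∑ ρ i
‖c i‖²` and `∑ ‖c i‖²`, so the minimum principle is automatic. This makes the convergence theorem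
available for every choice of the Ritz–Galerkin bases, not only for those obtained by minimization.
-/
lemma isEigenfamily_of_finrank {S : Submodule ℂ V} {e : ℕ → V} {ρ : ℕ → ℝ} {m : ℕ}
    [FiniteDimensional ℂ S] (hd : Module.finrank ℂ S = m) (mem : ∀ k < m, e k ∈ S)
    (eig : ∀ k < m, ∀ v ∈ S, ⟪v, e k⟫_ℂ = (ρ k : ℂ) * ⟪J v, J (e k)⟫_ℂ)
    (orth : ∀ j < m, ∀ k < m, ⟪J (e j), J (e k)⟫_ℂ = if j = k then 1 else 0)
    (mono : ∀ j k, j ≤ k → k < m → ρ j ≤ ρ k) : IsEigenfamily J S m e ρ := by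
  have h0 : IsOrthoEigen J S m e ρ := ⟨mem, eig, orth⟩
  refine ⟨h0, mono, fun k hk v hv hvj => ?_⟩
  let f : Fin m → S := fun i => ⟨e i, mem i i.2⟩
  have hcoef : ∀ c : Fin m → ℂ, ∀ i : Fin m, ⟪J (e i), J (∑ j : Fin m, c j • e j)⟫_ℂ = c i := by
    intro c i
    simp only [map_sum, map_smul, inner_sum, inner_smul_right]
    rw [Finset.sum_eq_single i]
    · rw [orth i i.2 i i.2, if_pos rfl, mul_one]
    · intro j _ hji
      rw [orth i i.2 j j.2, if_neg (fun h => hji (Fin.ext h.symm)), mul_zero]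
    · simp
  have hli : LinearIndependent ℂ f := by
    rw [Fintype.linearIndependent_iff]
    intro c hc i
    have h1 : ∑ j, c j • e j = 0 := by
      have := congrArg (S.subtype) hc
      simpa [f] using this
    rw [← hcoef c i, h1]; simp
  have hspan : (⟨v, hv⟩ : S) ∈ Submodule.span ℂ (Set.range f) := by
    rw [hli.span_eq_top_of_card_eq_finrank' (by simp [hd])]; trivial
  obtain ⟨c, hc⟩ := (Submodule.mem_span_range_iff_exists_fun ℂ).1 hspan
  have hvc : v = ∑ j : Fin m, c j • e j := by
    have := congrArg (S.subtype) hc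
    simpa [f] using this.symm
  let c' : ℕ → ℂ := fun i => if hi : i < m then c ⟨i, hi⟩ else 0
  have hv' : v = ∑ i ∈ Finset.range m, c' i • e i := by
    rw [Finset.sum_range, hvc]
    simp [c']
  have hc0 : ∀ j < k, c' j = 0 := by
    intro j hj
    have h1 := hvj j hj
    rw [hvc, hcoef c ⟨j, hj.trans hk⟩] at h1
    simp [c', hj.trans hk, h1]
  rw [hv', h0.norm_sq_sum le_rfl, h0.norm_sq_map_sum le_rfl, Finset.mul_sum]
  refine Finset.sum_le_sum fun i hi => ?_
  rcases lt_or_ge i k with h1 | h1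
  · simp [hc0 i h1]
  · exact mul_le_mul_of_nonneg_right (mono k i h1 (Finset.mem_range.1 hi)) (by positivity)

/-- The seminorm may have a kernel, so completeness is read off from the separation quotient, which
is a finite dimensional normed space. -/
lemma completeSpace_of_finiteDimensional (W : Type*) [SeminormedAddCommGroup W]
    [InnerProductSpace ℂ W] [FiniteDimensional ℂ W] : CompleteSpace W := by
  have : FiniteDimensional ℂ (SeparationQuotient W) :=
    Module.Finite.of_surjective (SeparationQuotient.mkCLM ℂ W).toLinearMap
      SeparationQuotient.surjective_mk
  exact SeparationQuotient.completeSpace_iff.1 (FiniteDimensional.complete ℂ _)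

/-- On a finite dimensional subspace there is a complete system of eigenvectors. -/
lemma IsCompactEmbedding.exists_isEigenfamily_of_finrank (hJ : IsCompactEmbedding J)
    (S : Submodule ℂ V) [FiniteDimensional ℂ S] (hS : ∀ v ∈ S, ‖v‖ = 0 → v = 0) :
    ∃ (e : ℕ → V) (ρ : ℕ → ℝ), IsEigenfamily J S (Module.finrank ℂ S) e ρ := by
  have := completeSpace_of_finiteDimensional S
  have hJS : IsCompactEmbedding (J ∘ₗ S.subtype) := by
    refine ⟨?_, fun v hv => hJ.ker v hv, fun v hv => hJ.compact (fun n => v n) hv⟩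
    obtain ⟨C, h0, hC⟩ := hJ.bound
    exact ⟨C, h0, fun v => hC v⟩
  obtain ⟨e, he⟩ := hJS.exists_isMinimizing
  have hroom : ∀ k < Module.finrank ℂ S, HasRoom S k := by
    intro k hk s
    let f : S →ₗ[ℂ] (Fin k → ℂ) := LinearMap.pi fun i => (innerSL ℂ (s i)).toLinearMap
    have hf : LinearMap.ker f ≠ ⊥ := LinearMap.ker_ne_bot_of_finrank_lt (by simpa using hk)
    obtain ⟨v, hv, hv0⟩ := (Submodule.ne_bot_iff _).1 hf
    refine ⟨v, fun i => congrFun (LinearMap.mem_ker.1 hv) i, fun h => hv0 ?_⟩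
    exact Subtype.ext (hS v v.2 h)
  have h := IsMinimizing.isEigenfamily hJS fun k hk => he k (hroom k hk)
  refine ⟨fun k => e k, _, ⟨fun k _ => (e k).2, fun k hk v hv => h.eig k hk ⟨v, hv⟩ trivial,
    h.orth⟩, h.mono, fun k hk v hv => h.tail k hk ⟨v, hv⟩ trivial⟩

/-- The spectral theorem for a compact embedding, with eigenvalues in nondecreasing order. -/
lemma IsCompactEmbedding.exists_isEigenfamily [CompleteSpace V] (hJ : IsCompactEmbedding J)
    (hV : ∀ k, HasRoom V k) :
    ∃ (e : ℕ → V) (ρ : ℕ → ℝ), (∀ m, IsEigenfamily J ⊤ m e ρ) ∧ Tendsto ρ atTop atTop := by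
  obtain ⟨e, he⟩ := hJ.exists_isMinimizing
  have h : ∀ m, IsEigenfamily J ⊤ m e fun k => ‖e k‖ ^ 2 := fun m =>
    IsMinimizing.isEigenfamily hJ fun k _ => he k (hV k)
  refine ⟨e, _, h, ?_⟩
  have hmono : Monotone fun k => ‖e k‖ ^ 2 := fun j k hjk => (h (k + 1)).mono j k hjk k.lt_succ_self
  -- A monotone sequence tends to infinity or converges. In the second case `e` is bounded, yet the
  -- `J (e k)` are orthonormal, hence at mutual distance `√2`, and no subsequence of them is Cauchy.
  refine (tendsto_atTop_of_monotone hmono).resolve_right ?_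
  rintro ⟨l, hl⟩
  have hle : ∀ k, ‖e k‖ ^ 2 ≤ l := hmono.ge_of_tendsto hl
  obtain ⟨φ, hφ, hc⟩ := hJ.compact e ⟨Real.sqrt l, fun n => Real.le_sqrt_of_sq_le (hle n)⟩
  obtain ⟨N, hN⟩ := Metric.cauchySeq_iff.1 hc 1 one_pos
  have h1 := hN N le_rfl (N + 1) N.le_succ
  have hlt : φ N < φ (N + 1) := hφ N.lt_succ_self
  have hh := h (φ (N + 1) + 1)
  have h2 : ‖J (e (φ N)) - J (e (φ (N + 1)))‖ ^ 2 = 2 := by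
    rw [norm_sub_sq (𝕜 := ℂ), hh.norm_map_eq (by omega), hh.norm_map_eq (by omega),
      hh.orth _ (by omega) _ (by omega), if_neg hlt.ne]
    norm_num
  rw [dist_eq_norm] at h1
  nlinarith [norm_nonneg (J (e (φ N)) - J (e (φ (N + 1))))]

/-- Eigenvectors are, up to a vector of norm zero, linear combinations of the members of a
complete system. -/
lemma IsCompactEmbedding.exists_mem_span (hJ : IsCompactEmbedding J) {e : ℕ → V} {ρ : ℕ → ℝ}
    (he : ∀ m, IsEigenfamily J ⊤ m e ρ) (hρ : Tendsto ρ atTop atTop) {ψ : V} {z : ℂ}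
    (hψ : ∀ v, ⟪v, ψ⟫_ℂ = z * ⟪J v, J ψ⟫_ℂ) :
    ∃ w ∈ Submodule.span ℂ {v | ∃ k, (ρ k : ℂ) = z ∧ v = e k}, ‖ψ - w‖ = 0 := by
  classical
  -- Since `ρ` tends to infinity, only finitely many indices belong to `z`.
  obtain ⟨m, hm⟩ : ∃ m, ∀ k, m ≤ k → (ρ k : ℂ) ≠ z := by
    obtain ⟨m, hm⟩ := eventually_atTop.1 (hρ.eventually_gt_atTop z.re)
    exact ⟨m, fun k hk h => (hm k hk).ne' (by rw [← h, Complex.ofReal_re])⟩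
  set I := (Finset.range m).filter fun k => (ρ k : ℂ) = z with hI
  set w := ∑ k ∈ I, ⟪J (e k), J ψ⟫_ℂ • e k with hw
  refine ⟨w, Submodule.sum_mem _ fun k hk => Submodule.smul_mem _ _ (Submodule.subset_span
    ⟨k, (Finset.mem_filter.1 hk).2, rfl⟩), ?_⟩
  have horth : ∀ j k, ⟪J (e j), J (e k)⟫_ℂ = if j = k then 1 else 0 := fun j k =>
    (he (max j k + 1)).orth j (by omega) k (by omega)
  have hz : ∀ j, ⟪J (e j), J (ψ - w)⟫_ℂ = 0 := by
    intro j
    have hw' : ⟪J (e j), J w⟫_ℂ = if j ∈ I then ⟪J (e j), J ψ⟫_ℂ else 0 := by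
      simp only [hw, map_sum, map_smul, inner_sum, inner_smul_right, horth]
      simp
    rw [map_sub, inner_sub_right, hw']
    split_ifs with hj
    · rw [sub_self]
    · rw [sub_zero]
      have h1 : ⟪e j, ψ⟫_ℂ = _ := hψ (e j)
      rw [(he (j + 1)).eig_left j.lt_succ_self (Submodule.mem_top (x := ψ))] at h1
      have h2 : (ρ j : ℂ) ≠ z := fun h => by
        refine hj (Finset.mem_filter.2 ⟨Finset.mem_range.2 ?_, h⟩)
        by_contra hjm
        exact hm j (not_lt.1 hjm) h
      have h3 : ((ρ j : ℂ) - z) * ⟪J (e j), J ψ⟫_ℂ = 0 := by rw [sub_mul, h1, sub_self]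
      exact (mul_eq_zero.1 h3).resolve_left (sub_ne_zero.2 h2)
  refine hJ.ker _ ?_
  by_contra hne
  have hpos : 0 < ‖J (ψ - w)‖ ^ 2 := by positivity
  -- The image of `ψ - w` is orthogonal to all `J (e k)`, so the minimum principle would bound every
  -- `ρ k` by this quotient.
  obtain ⟨k, hk⟩ := (hρ.eventually_gt_atTop (‖ψ - w‖ ^ 2 / ‖J (ψ - w)‖ ^ 2)).exists
  have h1 := (he (k + 1)).tail k k.lt_succ_self (ψ - w) trivial fun j _ => hz j
  rw [div_lt_iff₀ hpos] at hk
  linarith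

end Abstract
end SchrodingerFEM

namespace SchrodingerFEM

/-! ### Convergence of the Galerkin method for an abstract compact embedding -/

section Galerkin

open scoped InnerProductSpace

variable {V E : Type*} [SeminormedAddCommGroup V] [InnerProductSpace ℂ V]
  [SeminormedAddCommGroup E] [InnerProductSpace ℂ E] {J : V →ₗ[ℂ] E}

lemma IsCompactEmbedding.tendsto_norm_map (hJ : IsCompactEmbedding J) {x : ℕ → V}
    (hx : Tendsto (fun N => ‖x N‖) atTop (𝓝 0)) : Tendsto (fun N => ‖J (x N)‖) atTop (𝓝 0) := by
  obtain ⟨C, -, hC⟩ := hJ.bound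
  exact squeeze_zero (fun _ => norm_nonneg _) (fun N => hC (x N)) (by simpa using hx.const_mul C)

/-- An approximate eigenvector is close to its spectral projection. -/
lemma tendsto_sub_spectral_projection {m : ℕ} {e : ℕ → ℕ → V} {ρ' : ℕ → ℕ → ℝ} {ρ : ℕ → ℝ}
    {S : ℕ → Submodule ℂ V} {r B : ℝ} {x : ℕ → V}
    (he : ∀ᶠ N in atTop, IsOrthoEigen J (S N) m (e N) (ρ' N))
    (hx : ∀ᶠ N in atTop, x N ∈ S N)
    (conv : ∀ j < m, Tendsto (fun N => ρ' N j) atTop (𝓝 (ρ j)))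
    (bdd : ∀ᶠ N in atTop, ‖J (x N)‖ ≤ B)
    (resid : ∀ j < m, Tendsto (fun N => ((ρ' N j - r : ℝ) : ℂ) * ⟪J (e N j), J (x N)⟫_ℂ)
      atTop (𝓝 0))
    (tot : Tendsto (fun N => ‖x N‖ ^ 2 - r * ‖J (x N)‖ ^ 2) atTop (𝓝 0))
    (tail : ∀ᶠ N in atTop, ∀ t ∈ S N, (∀ j < m, ⟪J (e N j), J t⟫_ℂ = 0) →
      2 * r * ‖J t‖ ^ 2 ≤ ‖t‖ ^ 2) :
    Tendsto (fun N => ‖x N - ∑ j ∈ (Finset.range m).filter (fun j => ρ j = r),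
      ⟪J (e N j), J (x N)⟫_ℂ • e N j‖) atTop (𝓝 0) := by
  set c : ℕ → ℕ → ℂ := fun N j => ⟪J (e N j), J (x N)⟫_ℂ with hc
  set t : ℕ → V := fun N => x N - ∑ j ∈ Finset.range m, c N j • e N j with ht
  have hcB : ∀ᶠ N in atTop, ∀ j < m, ‖c N j‖ ≤ B := by
    filter_upwards [he, bdd] with N h1 h2 j hj
    calc ‖c N j‖ ≤ ‖J (e N j)‖ * ‖J (x N)‖ := norm_inner_le_norm _ _
      _ = ‖J (x N)‖ := by rw [h1.norm_map_eq hj, one_mul]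
      _ ≤ B := h2
  have htorth : ∀ᶠ N in atTop, t N ∈ S N ∧ (∀ j < m, ⟪J (e N j), J (t N)⟫_ℂ = 0) := by
    filter_upwards [he, hx] with N h1 h2
    refine ⟨(S N).sub_mem h2 ((S N).sum_mem fun j hj => (S N).smul_mem _
      (h1.mem j (Finset.mem_range.1 hj))), fun j hj => ?_⟩
    simp only [ht, map_sub, map_sum, map_smul, inner_sub_right, inner_sum, inner_smul_right]
    rw [Finset.sum_eq_single j]
    · rw [h1.orth j hj j hj, if_pos rfl, mul_one, sub_self]
    · intro i hi hij
      rw [h1.orth j hj i (Finset.mem_range.1 hi), if_neg hij.symm, mul_zero]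
    · intro hn; exact absurd (Finset.mem_range.2 hj) hn
  -- Pythagoras in `V` and in `E` together: the energy excess of `x N` splits into that of the
  -- remainder `t N` and one contribution for each coefficient.
  have hpyth : ∀ᶠ N in atTop, ‖t N‖ ^ 2 - r * ‖J (t N)‖ ^ 2 = ‖x N‖ ^ 2 - r * ‖J (x N)‖ ^ 2
      - ∑ j ∈ Finset.range m, (ρ' N j - r) * ‖c N j‖ ^ 2 := by
    filter_upwards [he, htorth] with N h1 h2
    have hsum : x N = t N + ∑ j ∈ Finset.range m, c N j • e N j := by simp [ht]
    have e1 : ⟪t N, ∑ j ∈ Finset.range m, c N j • e N j⟫_ℂ = 0 := by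
      rw [inner_sum]
      refine Finset.sum_eq_zero fun j hj => ?_
      rw [inner_smul_right, h1.eig j (Finset.mem_range.1 hj) _ h2.1, ← inner_conj_symm (J (t N)),
        h2.2 j (Finset.mem_range.1 hj)]
      simp
    have e2 : ⟪J (t N), J (∑ j ∈ Finset.range m, c N j • e N j)⟫_ℂ = 0 := by
      simp only [map_sum, map_smul, inner_sum]
      refine Finset.sum_eq_zero fun j hj => ?_
      rw [inner_smul_right, ← inner_conj_symm (J (t N)), h2.2 j (Finset.mem_range.1 hj)]
      simp
    have e3 : ‖x N‖ ^ 2 = ‖t N‖ ^ 2 + ∑ j ∈ Finset.range m, ρ' N j * ‖c N j‖ ^ 2 := by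
      rw [hsum, norm_add_sq (𝕜 := ℂ), e1, h1.norm_sq_sum le_rfl]; simp
    have e4 : ‖J (x N)‖ ^ 2 = ‖J (t N)‖ ^ 2 + ∑ j ∈ Finset.range m, ‖c N j‖ ^ 2 := by
      rw [hsum, map_add, norm_add_sq (𝕜 := ℂ), e2, h1.norm_sq_map_sum le_rfl]; simp
    rw [e3, e4]
    simp only [sub_mul, Finset.sum_sub_distrib, ← Finset.mul_sum]
    ring
  have hsum0 : Tendsto (fun N => ∑ j ∈ Finset.range m, (ρ' N j - r) * ‖c N j‖ ^ 2) atTop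
      (𝓝 0) := by
    rw [← Finset.sum_const_zero (s := Finset.range m)]
    refine tendsto_finsetSum _ fun j hj => ?_
    have h1 := (resid j (Finset.mem_range.1 hj)).norm
    rw [norm_zero] at h1
    have h4 := h1.mul_const B
    rw [zero_mul] at h4
    refine squeeze_zero_norm' ?_ h4
    filter_upwards [hcB] with N h2
    have h3 := h2 j (Finset.mem_range.1 hj)
    rw [norm_mul, norm_mul, Complex.norm_real, norm_pow, norm_norm, pow_two, ← mul_assoc]
    exact mul_le_mul_of_nonneg_left h3 (by positivity)
  have ht0 : Tendsto (fun N => ‖t N‖) atTop (𝓝 0) := by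
    -- The factor `2` in `tail` is used here: it yields `‖t‖² ≤ 2 (‖t‖² - r ‖J t‖²)`.
    have h1 : Tendsto (fun N => 2 * (‖x N‖ ^ 2 - r * ‖J (x N)‖ ^ 2
        - ∑ j ∈ Finset.range m, (ρ' N j - r) * ‖c N j‖ ^ 2)) atTop (𝓝 0) := by
      simpa using (tot.sub hsum0).const_mul 2
    have h2 : Tendsto (fun N => ‖t N‖ ^ 2) atTop (𝓝 0) := by
      refine squeeze_zero' (Eventually.of_forall fun N => by positivity) ?_ h1
      filter_upwards [hpyth, htorth, tail] with N h2 h3 h4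
      rw [← h2]
      linarith [h4 _ h3.1 h3.2]
    simpa using h2.sqrt
  -- Where `ρ j ≠ r`, the factor `ρ' N j - r` stays away from zero and can be divided out of the
  -- residual.
  have hcoef : ∀ j < m, ρ j ≠ r → Tendsto (fun N => ‖c N j • e N j‖) atTop (𝓝 0) := by
    intro j hj hne
    have h1 : Tendsto (fun N => ((ρ' N j - r : ℝ) : ℂ)) atTop (𝓝 ((ρ j - r : ℝ) : ℂ)) :=
      (Complex.continuous_ofReal.tendsto _).comp ((conv j hj).sub_const r)
    have hne' : ((ρ j - r : ℝ) : ℂ) ≠ 0 := by exact_mod_cast sub_ne_zero.2 hne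
    have h2 := (h1.inv₀ hne').mul (resid j hj)
    rw [mul_zero] at h2
    have h3 : Tendsto (fun N => c N j) atTop (𝓝 0) := by
      refine h2.congr' ?_
      filter_upwards [h1.eventually_ne hne'] with N h4
      exact inv_mul_cancel_left₀ h4 _
    have h4 : Tendsto (fun N => Real.sqrt (ρ' N j)) atTop (𝓝 (Real.sqrt (ρ j))) := (conv j hj).sqrt
    have h5 := h3.norm.mul h4
    rw [norm_zero, zero_mul] at h5
    refine h5.congr' ?_
    filter_upwards [he] with N h6
    rw [norm_smul, ← h6.norm_sq_eq hj, Real.sqrt_sq (norm_nonneg _)]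
  have hrest : Tendsto (fun N => ∑ j ∈ (Finset.range m).filter (fun j => ¬ ρ j = r),
      ‖c N j • e N j‖) atTop (𝓝 0) := by
    rw [← Finset.sum_const_zero (s := (Finset.range m).filter (fun j => ¬ ρ j = r))]
    exact tendsto_finsetSum _ fun j hj => hcoef j (Finset.mem_range.1 (Finset.mem_filter.1 hj).1)
      (Finset.mem_filter.1 hj).2
  refine squeeze_zero (fun _ => norm_nonneg _) (fun N => ?_) (by simpa using ht0.add hrest)
  have : x N - ∑ j ∈ (Finset.range m).filter (fun j => ρ j = r), c N j • e N j
      = t N + ∑ j ∈ (Finset.range m).filter (fun j => ¬ ρ j = r), c N j • e N j := by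
    simp only [ht]
    rw [← Finset.sum_filter_add_sum_filter_not (Finset.range m) (fun j => ρ j = r)]
    abel
  rw [this]
  exact (norm_add_le _ _).trans (by gcongr; exact norm_sum_le _ _)

/-- The setting of the convergence theorem for the Galerkin method: `Φ`, `ρ` is a complete system
of eigenvectors, `u N`, `σ N` are complete systems of approximate eigenvectors in the subspaces
`S N`, and eigenvectors are limits of members of the `S N`. -/
structure IsGalerkin (J : V →ₗ[ℂ] E) (Φ : ℕ → V) (ρ : ℕ → ℝ) (S : ℕ → Submodule ℂ V) (d : ℕ → ℕ)
    (u : ℕ → ℕ → V) (σ : ℕ → ℕ → ℝ) : Prop where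
  emb : IsCompactEmbedding J
  eigen : ∀ m, IsEigenfamily J ⊤ m Φ ρ
  tendsto_eigen : Tendsto ρ atTop atTop
  ritz : ∀ᶠ N in atTop, IsEigenfamily J (S N) (d N) (u N) (σ N)
  dim : Tendsto d atTop atTop
  approx : ∀ (Ψ : V) (r : ℝ), (∀ v, ⟪v, Ψ⟫_ℂ = (r : ℂ) * ⟪J v, J Ψ⟫_ℂ) →
    ∃ x : ℕ → V, (∀ᶠ N in atTop, x N ∈ S N) ∧ Tendsto (fun N => ‖x N - Ψ‖) atTop (𝓝 0)

namespace IsGalerkin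

variable {Φ : ℕ → V} {ρ : ℕ → ℝ} {S : ℕ → Submodule ℂ V} {d : ℕ → ℕ} {u : ℕ → ℕ → V}
  {σ : ℕ → ℕ → ℝ}

lemma ritz_lt (h : IsGalerkin J Φ ρ S d u σ) (k : ℕ) :
    ∀ᶠ N in atTop, k < d N ∧ IsEigenfamily J (S N) (d N) (u N) (σ N) :=
  (h.dim.eventually_gt_atTop k).and h.ritz

/-- Half of min-max: some combination of the first `k + 1` discrete eigenvectors is admissible in
the exact minimum principle for `ρ k`, while its Rayleigh quotient is at most `σ N k`. -/
lemma le_ritz (h : IsGalerkin J Φ ρ S d u σ) (k : ℕ) : ∀ᶠ N in atTop, ρ k ≤ σ N k := by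
  filter_upwards [h.ritz_lt k] with N ⟨hk, hN⟩
  obtain ⟨c, hc, hle⟩ := (h.eigen (k + 1)).exists_combination k.lt_succ_self (u N)
    fun _ _ => trivial
  rw [hN.norm_sq_sum hk, hN.norm_sq_map_sum hk] at hle
  have h1 : ∑ i ∈ Finset.range (k + 1), σ N i * ‖c i‖ ^ 2
      ≤ σ N k * ∑ i ∈ Finset.range (k + 1), ‖c i‖ ^ 2 := by
    rw [Finset.mul_sum]
    exact Finset.sum_le_sum fun i hi => mul_le_mul_of_nonneg_right
      (hN.mono i k (Nat.lt_succ_iff.1 (Finset.mem_range.1 hi)) hk) (by positivity)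
  exact le_of_mul_le_mul_right (hle.trans h1) hc

lemma approx_eigen (h : IsGalerkin J Φ ρ S d u σ) (k : ℕ) : ∃ x : ℕ → V,
    (∀ᶠ N in atTop, x N ∈ S N) ∧ Tendsto (fun N => ‖x N - Φ k‖) atTop (𝓝 0) :=
  h.approx (Φ k) (ρ k) fun v => (h.eigen (k + 1)).eig k k.lt_succ_self v trivial

/-- The other half: the discrete minimum principle is tested on a combination of approximations `x i
N` of the exact eigenvectors. If the coefficients have Euclidean length `s`, replacing `Φ i` by `x i
N` costs at most `s * δ N` in `V` and `C * s * δ N` in `E`, which leads to the bound `((√(ρ k) + δ)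
/ (1 - C δ))²`. -/
lemma ritz_le (h : IsGalerkin J Φ ρ S d u σ) (k : ℕ) :
    ∃ b : ℕ → ℝ, Tendsto b atTop (𝓝 (ρ k)) ∧ ∀ᶠ N in atTop, σ N k ≤ b N := by
  obtain ⟨C, hC0, hC⟩ := h.emb.bound
  choose x hxS hx using h.approx_eigen
  set δ : ℕ → ℝ := fun N => ∑ i ∈ Finset.range (k + 1), ‖x i N - Φ i‖ with hδ
  have hδ0 : Tendsto δ atTop (𝓝 0) := by
    rw [← Finset.sum_const_zero (s := Finset.range (k + 1))]
    exact tendsto_finsetSum _ fun i _ => hx i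
  have hCδ : Tendsto (fun N => 1 - C * δ N) atTop (𝓝 1) := by
    simpa using (hδ0.const_mul C).const_sub 1
  refine ⟨fun N => ((Real.sqrt (ρ k) + δ N) / (1 - C * δ N)) ^ 2, ?_, ?_⟩
  · have h1 := ((hδ0.const_add (Real.sqrt (ρ k))).div hCδ one_ne_zero).pow 2
    rw [add_zero, div_one, Real.sq_sqrt ((h.eigen (k + 1)).nonneg k.lt_succ_self)] at h1
    exact h1
  have hall : ∀ᶠ N in atTop, ∀ i ∈ Finset.range (k + 1), x i N ∈ S N :=
    (Finset.eventually_all _).2 fun i _ => hxS i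
  filter_upwards [h.ritz_lt k, hall, hCδ.eventually_const_lt one_pos] with N ⟨hk, hN⟩ hxN hpos
  obtain ⟨c, hc, hle⟩ := hN.exists_combination hk (fun i => x i N)
    fun i hi => hxN i (Finset.mem_range.2 (Nat.lt_succ_iff.2 hi))
  set s := Real.sqrt (∑ i ∈ Finset.range (k + 1), ‖c i‖ ^ 2) with hs
  have hs0 : 0 < s := Real.sqrt_pos.2 hc
  have hs2 : s ^ 2 = ∑ i ∈ Finset.range (k + 1), ‖c i‖ ^ 2 := Real.sq_sqrt hc.le
  have hΦ := h.eigen (k + 1)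
  set v := ∑ i ∈ Finset.range (k + 1), c i • x i N with hv
  set w := ∑ i ∈ Finset.range (k + 1), c i • Φ i with hw
  have hvw : ‖v - w‖ ≤ s * δ N := by
    rw [hv, hw, ← Finset.sum_sub_distrib, hδ, Finset.mul_sum]
    refine (norm_sum_le _ _).trans (Finset.sum_le_sum fun i hi => ?_)
    rw [← smul_sub, norm_smul]
    refine mul_le_mul_of_nonneg_right ?_ (norm_nonneg _)
    exact Real.le_sqrt_of_sq_le (Finset.single_le_sum (f := fun i => ‖c i‖ ^ 2)
      (fun i _ => by positivity) hi)
  have hwn : ‖w‖ ≤ Real.sqrt (ρ k) * s := by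
    have h1 : ‖w‖ ^ 2 ≤ ρ k * s ^ 2 := by
      rw [hw, hΦ.norm_sq_sum le_rfl, hs2, Finset.mul_sum]
      exact Finset.sum_le_sum fun i hi => mul_le_mul_of_nonneg_right
        (hΦ.mono i k (Nat.lt_succ_iff.1 (Finset.mem_range.1 hi)) k.lt_succ_self) (by positivity)
    rw [← Real.sqrt_sq (norm_nonneg w)]
    refine (Real.sqrt_le_sqrt h1).trans_eq ?_
    rw [Real.sqrt_mul (hΦ.nonneg k.lt_succ_self), Real.sqrt_sq hs0.le]
  have hJw : ‖J w‖ = s := by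
    rw [hs, ← hΦ.norm_sq_map_sum le_rfl, ← hw, Real.sqrt_sq (norm_nonneg _)]
  have hJv : s * (1 - C * δ N) ≤ ‖J v‖ := by
    have h1 := hC (v - w)
    have h2 := norm_sub_norm_le (J w) (J v)
    rw [← map_sub, ← norm_neg (J (w - v)), ← map_neg, neg_sub] at h2
    have h3 := mul_le_mul_of_nonneg_left hvw hC0
    nlinarith
  have hvn : ‖v‖ ≤ s * (Real.sqrt (ρ k) + δ N) := by
    have h1 := norm_le_norm_add_norm_sub' v w
    nlinarith
  have hσ : 0 ≤ σ N k := hN.nonneg hk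
  have h1 : Real.sqrt (σ N k) * (s * (1 - C * δ N)) ≤ s * (Real.sqrt (ρ k) + δ N) := by
    refine (mul_le_mul_of_nonneg_left hJv (Real.sqrt_nonneg _)).trans (le_trans ?_ hvn)
    refine le_of_sq_le_sq ?_ (norm_nonneg _)
    rw [mul_pow, Real.sq_sqrt hσ]
    exact hle
  have h2 : Real.sqrt (σ N k) ≤ (Real.sqrt (ρ k) + δ N) / (1 - C * δ N) := by
    rw [le_div_iff₀ hpos]
    refine le_of_mul_le_mul_left ?_ hs0
    linarith
  calc σ N k = Real.sqrt (σ N k) ^ 2 := (Real.sq_sqrt hσ).symm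
    _ ≤ _ := pow_le_pow_left₀ (Real.sqrt_nonneg _) h2 2

/-- Convergence of the eigenvalues. -/
lemma tendsto_eigenvalue (h : IsGalerkin J Φ ρ S d u σ) (k : ℕ) :
    Tendsto (fun N => σ N k) atTop (𝓝 (ρ k)) := by
  obtain ⟨b, hb, hle⟩ := h.ritz_le k
  exact tendsto_of_tendsto_of_tendsto_of_le_of_le' tendsto_const_nhds hb (h.le_ritz k) hle

lemma tendsto_norm_inner_zero {x y : ℕ → E} {B : ℝ} (hx : ∀ᶠ N in atTop, ‖x N‖ ≤ B)
    (hy : Tendsto (fun N => ‖y N‖) atTop (𝓝 0)) :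
    Tendsto (fun N => ⟪x N, y N⟫_ℂ) atTop (𝓝 0) := by
  refine squeeze_zero_norm' ?_ (by simpa using hy.const_mul B)
  filter_upwards [hx] with N hN
  exact (norm_inner_le_norm _ _).trans (mul_le_mul_of_nonneg_right hN (norm_nonneg _))

lemma eventually_norm_ritz_le (h : IsGalerkin J Φ ρ S d u σ) (k : ℕ) :
    ∃ B, ∀ᶠ N in atTop, ‖u N k‖ ≤ B := by
  refine ⟨Real.sqrt (ρ k + 1), ?_⟩
  filter_upwards [h.ritz_lt k, (h.tendsto_eigenvalue k).eventually_le_const (lt_add_one _)]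
    with N ⟨hk, hN⟩ h1
  refine Real.le_sqrt_of_sq_le ?_
  rwa [hN.norm_sq_eq hk]

/-- The index `m` supplies the spectral gap that `tendsto_sub_spectral_projection` asks of vectors
orthogonal to the first `m` eigenvectors. -/
lemma exists_index (h : IsGalerkin J Φ ρ S d u σ) (r : ℝ) :
    ∃ m, 2 * r < ρ m ∧ ∀ j, ρ j = r → j < m := by
  obtain ⟨m, hm⟩ := eventually_atTop.1 (h.tendsto_eigen.eventually_gt_atTop (max (2 * r) r))
  refine ⟨m, (le_max_left _ _).trans_lt (hm m le_rfl), fun j hj => ?_⟩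
  by_contra hjm
  have := hm j (not_lt.1 hjm)
  exact absurd ((le_max_right _ _).trans_lt this) (by rw [hj]; exact lt_irrefl _)

/-- The approximate eigenvectors approach the exact eigenspaces. -/
lemma tendsto_ritz_sub (h : IsGalerkin J Φ ρ S d u σ) (k : ℕ) :
    ∃ m, Tendsto (fun N => ‖u N k - ∑ j ∈ (Finset.range m).filter (fun j => ρ j = ρ k),
      ⟪J (Φ j), J (u N k)⟫_ℂ • Φ j‖) atTop (𝓝 0) := by
  obtain ⟨m, hm, -⟩ := h.exists_index (ρ k)
  refine ⟨m, ?_⟩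
  obtain ⟨B, hB⟩ := h.eventually_norm_ritz_le k
  have hσ := h.tendsto_eigenvalue k
  -- Here the exact system does the projecting, on the whole space, and the projected vector is the
  -- discrete eigenvector.
  refine tendsto_sub_spectral_projection (e := fun _ => Φ) (ρ' := fun _ => ρ) (S := fun _ => ⊤)
    (B := 1) (Eventually.of_forall fun _ => (h.eigen m).toIsOrthoEigen)
    (Eventually.of_forall fun _ => trivial) (fun j _ => tendsto_const_nhds) ?_ ?_ ?_ ?_
  · filter_upwards [h.ritz_lt k] with N ⟨hk, hN⟩
    rw [hN.norm_map_eq hk]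
  · intro j hj
    obtain ⟨x, hxS, hx⟩ := h.approx_eigen j
    have hx' : Tendsto (fun N => ‖Φ j - x N‖) atTop (𝓝 0) := by
      simpa only [norm_sub_rev] using hx
    have hJx : Tendsto (fun N => ‖J (Φ j - x N)‖) atTop (𝓝 0) := h.emb.tendsto_norm_map hx'
    have hJu : ∀ᶠ N in atTop, ‖J (u N k)‖ ≤ 1 := by
      filter_upwards [h.ritz_lt k] with N ⟨hk, hN⟩
      rw [hN.norm_map_eq hk]
    have hσ' : Tendsto (fun N => ((σ N k : ℝ) : ℂ)) atTop (𝓝 (ρ k : ℂ)) :=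
      (Complex.continuous_ofReal.tendsto _).comp hσ
    have t1 : Tendsto (fun N => ⟪Φ j - x N, u N k⟫_ℂ) atTop (𝓝 0) := by
      have := (Complex.continuous_conj.tendsto 0).comp (tendsto_norm_inner_zero hB hx')
      rw [map_zero] at this
      exact this.congr fun N => inner_conj_symm _ _
    have t2 : Tendsto (fun N => ⟪J (Φ j - x N), J (u N k)⟫_ℂ) atTop (𝓝 0) := by
      have := (Complex.continuous_conj.tendsto 0).comp (tendsto_norm_inner_zero hJu hJx)
      rw [map_zero] at this
      exact this.congr fun N => inner_conj_symm _ _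
    have t3 : Tendsto (fun N => ((σ N k - ρ k : ℝ) : ℂ) * ⟪J (Φ j), J (u N k)⟫_ℂ) atTop
        (𝓝 0) := by
      have h0 : Tendsto (fun N => ‖((σ N k - ρ k : ℝ) : ℂ)‖) atTop (𝓝 0) := by
        have h1 := (hσ.sub_const (ρ k)).norm
        rw [sub_self, norm_zero] at h1
        simpa only [Complex.norm_real] using h1
      refine squeeze_zero_norm' ?_ h0
      filter_upwards [hJu] with N h1
      rw [norm_mul]
      have h2 : ‖⟪J (Φ j), J (u N k)⟫_ℂ‖ ≤ 1 := by
        refine (norm_inner_le_norm _ _).trans ?_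
        rw [(h.eigen m).norm_map_eq hj, one_mul]
        exact h1
      exact mul_le_of_le_one_right (norm_nonneg _) h2
    -- With `x N ∈ S N` close to `Φ j`, the two eigenvalue equations write the residual as `⟪Φ j -
    -- x, u⟫ - σ ⟪J (Φ j - x), J u⟫ + (σ - ρ k) ⟪J (Φ j), J u⟫`, and each term tends to zero.
    have t4 := (t1.sub (hσ'.mul t2)).add t3
    rw [mul_zero, sub_zero, add_zero] at t4
    refine t4.congr' ?_
    filter_upwards [h.ritz_lt k, hxS] with N ⟨hk, hN⟩ hxN
    have e1 := hN.eig k hk (x N) hxN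
    have e2 := (h.eigen m).eig_left hj (Submodule.mem_top (x := u N k))
    rw [map_sub, inner_sub_left, inner_sub_left, e1, e2]
    push_cast
    ring
  · have h1 := hσ.sub_const (ρ k)
    rw [sub_self] at h1
    refine h1.congr' ?_
    filter_upwards [h.ritz_lt k] with N ⟨hk, hN⟩
    rw [hN.norm_sq_eq hk, hN.norm_map_eq hk]; ring
  · refine Eventually.of_forall fun _ t _ ht => ?_
    have h1 := (h.eigen (m + 1)).tail m m.lt_succ_self t trivial ht
    exact (mul_le_mul_of_nonneg_right hm.le (sq_nonneg _)).trans h1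

/-- Every eigenvector is approached by linear combinations of the corresponding approximate
eigenvectors. -/
lemma tendsto_sub_eigenvector (h : IsGalerkin J Φ ρ S d u σ) {Ψ : V} {r : ℝ}
    (hΨ : ∀ v, ⟪v, Ψ⟫_ℂ = (r : ℂ) * ⟪J v, J Ψ⟫_ℂ) :
    ∃ (m : ℕ) (c : ℕ → ℕ → ℂ), Tendsto (fun N => ‖∑ j ∈ (Finset.range m).filter
      (fun j => ρ j = r), c N j • u N j - Ψ‖) atTop (𝓝 0) := by
  obtain ⟨m, hm, -⟩ := h.exists_index r
  obtain ⟨x, hxS, hx⟩ := h.approx Ψ r hΨ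
  have hJx : Tendsto (fun N => ‖J (x N - Ψ)‖) atTop (𝓝 0) := h.emb.tendsto_norm_map hx
  have hxn : Tendsto (fun N => ‖x N‖) atTop (𝓝 ‖Ψ‖) :=
    tendsto_iff_norm_sub_tendsto_zero.2 (squeeze_zero (fun _ => norm_nonneg _)
      (fun N => abs_norm_sub_norm_le _ _) hx)
  have hJxn : Tendsto (fun N => ‖J (x N)‖) atTop (𝓝 ‖J Ψ‖) :=
    tendsto_iff_norm_sub_tendsto_zero.2 (squeeze_zero (fun _ => norm_nonneg _)
      (fun N => (abs_norm_sub_norm_le _ _).trans_eq (by rw [map_sub])) hJx)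
  have hr : ‖Ψ‖ ^ 2 - r * ‖J Ψ‖ ^ 2 = 0 := by
    have h1 := hΨ Ψ
    rw [inner_self_eq_ofReal, inner_self_eq_ofReal] at h1
    have h2 : ‖Ψ‖ ^ 2 = r * ‖J Ψ‖ ^ 2 := by exact_mod_cast h1
    rw [h2, sub_self]
  -- The roles are exchanged: the discrete system projects, and the projected vector is an
  -- approximation of `Ψ` in `S N`.
  have key := tendsto_sub_spectral_projection (J := J) (m := m) (e := u) (ρ' := σ) (ρ := ρ) (S := S)
    (r := r) (B := ‖J Ψ‖ + 1) (x := x) ?_ hxS (fun j _ => h.tendsto_eigenvalue j)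
    (hJxn.eventually_le_const (lt_add_one _)) ?_ ?_ ?_
  · refine ⟨m, fun N j => ⟪J (u N j), J (x N)⟫_ℂ, ?_⟩
    refine squeeze_zero (fun _ => norm_nonneg _) (fun N => ?_) (by simpa using key.add hx)
    rw [norm_sub_rev (x N)]
    exact norm_sub_le_norm_sub_add_norm_sub _ _ _
  · filter_upwards [h.ritz_lt m] with N ⟨hk, hN⟩
    exact ⟨fun k hkm => hN.mem k (hkm.trans hk), fun k hkm => hN.eig k (hkm.trans hk),
      fun i hi j hj => hN.orth i (hi.trans hk) j (hj.trans hk)⟩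
  · intro j hj
    obtain ⟨B, hB⟩ := h.eventually_norm_ritz_le j
    have hJu : ∀ᶠ N in atTop, ‖J (u N j)‖ ≤ 1 := by
      filter_upwards [h.ritz_lt j] with N ⟨hk, hN⟩
      rw [hN.norm_map_eq hk]
    -- The residual equals `⟪u, x - Ψ⟫ - r ⟪J u, J (x - Ψ)⟫` by the two eigenvalue equations.
    have t := (tendsto_norm_inner_zero hB hx).sub
      ((tendsto_norm_inner_zero hJu hJx).const_mul (r : ℂ))
    rw [mul_zero, sub_zero] at t
    refine t.congr' ?_
    filter_upwards [h.ritz_lt j, hxS] with N ⟨hk, hN⟩ hxN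
    rw [map_sub, inner_sub_right, inner_sub_right, hΨ, hN.eig_left hk hxN]
    push_cast
    ring
  · rw [← hr]
    exact (hxn.pow 2).sub ((hJxn.pow 2).const_mul r)
  · filter_upwards [h.ritz_lt m, (h.tendsto_eigenvalue m).eventually_const_lt hm]
      with N ⟨hk, hN⟩ h1 t htS ht
    exact (mul_le_mul_of_nonneg_right h1.le (sq_nonneg _)).trans (hN.tail m hk t htS ht)

end IsGalerkin

end Galerkin
end SchrodingerFEM

namespace SchrodingerFEM

/-! ### Absolutely continuous functions, weak derivatives and the lemma of du Bois-Reymond -/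

section Interval

variable {a b : ℝ}

lemma absolutelyContinuousOnInterval_of_dist_le {X Y : Type*} [PseudoMetricSpace X]
    [PseudoMetricSpace Y] {f : ℝ → X} {g : ℝ → Y}
    (hg : AbsolutelyContinuousOnInterval g a b)
    (h : ∀ x ∈ uIcc a b, ∀ y ∈ uIcc a b, dist (f x) (f y) ≤ dist (g x) (g y)) :
    AbsolutelyContinuousOnInterval f a b := by
  rw [absolutelyContinuousOnInterval_iff] at hg ⊢
  intro ε hε
  obtain ⟨δ, hδ, H⟩ := hg ε hε
  refine ⟨δ, hδ, fun E hE hE' => lt_of_le_of_lt (Finset.sum_le_sum fun i hi => ?_) (H E hE hE')⟩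
  exact h _ (hE.1 i hi).1 _ (hE.1 i hi).2

/-- Increments of the primitive of `g` are dominated by those of the real primitive of `‖g‖`. -/
lemma absolutelyContinuousOnInterval_integral {g : ℝ → ℂ} (hg : IntervalIntegrable g volume a b) :
    AbsolutelyContinuousOnInterval (fun x => ∫ t in a..x, g t) a b := by
  refine absolutelyContinuousOnInterval_of_dist_le
    (hg.norm.absolutelyContinuousOnInterval_intervalIntegral left_mem_uIcc) fun x hx y hy => ?_
  have hi : ∀ z ∈ uIcc a b, IntervalIntegrable g volume a z := fun z hz =>
    hg.mono_set (uIcc_subset_uIcc_left hz)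
  rw [dist_eq_norm, dist_eq_norm, intervalIntegral.integral_interval_sub_left (hi x hx) (hi y hy),
    intervalIntegral.integral_interval_sub_left (hi x hx).norm (hi y hy).norm, Real.norm_eq_abs]
  exact intervalIntegral.norm_integral_le_abs_integral_norm

/-- Integration by parts for absolutely continuous functions. -/
lemma integral_deriv_mul_add {F G f g : ℝ → ℂ} (hab : a ≤ b)
    (hf : IntervalIntegrable f volume a b) (hg : IntervalIntegrable g volume a b)
    (hF : ∀ x ∈ Icc a b, F x = F a + ∫ t in a..x, f t)
    (hG : ∀ x ∈ Icc a b, G x = G a + ∫ t in a..x, g t) :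
    ∫ x in a..b, (f x * G x + F x * g x) = F b * G b - F a * G a := by
  -- `F` and `G` are prescribed only on `[a, b]`; the integral formulas give versions on the whole
  -- line, to which two-sided derivatives apply.
  set F' : ℝ → ℂ := fun x => F a + ∫ t in a..x, f t with hF'
  set G' : ℝ → ℂ := fun x => G a + ∫ t in a..x, g t with hG'
  have acF : AbsolutelyContinuousOnInterval F' a b :=
    absolutelyContinuousOnInterval_of_dist_le (absolutelyContinuousOnInterval_integral hf)
      fun x _ y _ => by simp [hF']
  have acG : AbsolutelyContinuousOnInterval G' a b :=
    absolutelyContinuousOnInterval_of_dist_le (absolutelyContinuousOnInterval_integral hg)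
      fun x _ y _ => by simp [hG']
  have hi : IntervalIntegrable (fun x => f x * G' x + F' x * g x) volume a b :=
    (hf.mul_continuousOn acG.continuousOn).add (hg.continuousOn_mul acF.continuousOn)
  -- The product minus the primitive of its formal derivative is absolutely continuous with
  -- derivative zero almost everywhere, hence constant.
  have ac := (acF.fun_smul acG).sub (absolutelyContinuousOnInterval_integral hi)
  obtain ⟨C, hC⟩ := ac.const_of_ae_hasDerivAt_zero (by
    filter_upwards [hf.ae_hasDerivAt_integral, hg.ae_hasDerivAt_integral,
      hi.ae_hasDerivAt_integral] with x h1 h2 h3 hx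
    have d1 : HasDerivAt F' (f x) x := (h1 hx a left_mem_uIcc).const_add _
    have d2 : HasDerivAt G' (g x) x := (h2 hx a left_mem_uIcc).const_add _
    have d3 := (d1.mul d2).sub (h3 hx a left_mem_uIcc)
    rw [sub_self] at d3
    exact d3)
  have h1 := (hC a left_mem_uIcc).trans (hC b right_mem_uIcc).symm
  simp only [Pi.sub_apply, smul_eq_mul, intervalIntegral.integral_same, sub_zero] at h1
  have ha : F' a = F a := (hF a (left_mem_Icc.2 hab)).symm
  have hb : F' b = F b := (hF b (right_mem_Icc.2 hab)).symm
  have ha' : G' a = G a := (hG a (left_mem_Icc.2 hab)).symm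
  have hb' : G' b = G b := (hG b (right_mem_Icc.2 hab)).symm
  rw [ha, hb, ha', hb'] at h1
  have h2 : ∫ x in a..b, (f x * G x + F x * g x) = ∫ x in a..b, (f x * G' x + F' x * g x) := by
    refine intervalIntegral.integral_congr fun x hx => ?_
    rw [uIcc_of_le hab] at hx
    simp only [hF', hG']
    rw [← hF x hx, ← hG x hx]
  rw [h2, h1]
  ring

lemma intervalIntegrable_of_memLp {g : ℝ → ℂ} (hab : a ≤ b)
    (hg : MemLp g 2 (volume.restrict (Ioo a b))) : IntervalIntegrable g volume a b := by
  rw [intervalIntegrable_iff_integrableOn_Ioo_of_le hab]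
  exact hg.integrable one_le_two

lemma eq_zero_of_tsupport_subset {φ : ℝ → ℝ} (h : tsupport φ ⊆ Ioo a b) {x : ℝ}
    (hx : x ∉ Ioo a b) : φ x = 0 :=
  image_eq_zero_of_notMem_tsupport fun h' => hx (h h')

lemma contDiff_eq_integral {φ : ℝ → ℝ} (hφ : ContDiff ℝ ∞ φ) (x : ℝ) :
    (φ x : ℂ) = φ a + ∫ t in a..x, ((deriv φ t : ℝ) : ℂ) := by
  rw [intervalIntegral.integral_ofReal, intervalIntegral.integral_deriv_eq_sub]
  · push_cast; ring
  · exact fun y _ => (hφ.differentiable (by simp)).differentiableAt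
  · exact (hφ.continuous_deriv (by simp)).intervalIntegrable _ _

lemma hasWeakDeriv_of_integral {u g : ℝ → ℂ} (hab : a ≤ b) (hg : IntervalIntegrable g volume a b)
    (hu : ∀ x ∈ Icc a b, u x = u a + ∫ t in a..x, g t) : HasWeakDeriv a b u g := by
  intro φ hφ hφc hφs
  have hd : IntervalIntegrable (fun t => ((deriv φ t : ℝ) : ℂ)) volume a b :=
    (Complex.continuous_ofReal.comp (hφ.continuous_deriv (by simp))).intervalIntegrable _ _
  have h := integral_deriv_mul_add (F := fun x => (φ x : ℂ)) hab hd hg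
    (fun x _ => contDiff_eq_integral hφ x) hu
  have h1 : φ a = 0 := eq_zero_of_tsupport_subset hφs (fun h => lt_irrefl _ h.1)
  have h2 : φ b = 0 := eq_zero_of_tsupport_subset hφs (fun h => lt_irrefl _ h.2)
  have hcu : ContinuousOn u (uIcc a b) := by
    have h3 := (absolutelyContinuousOnInterval_integral hg).continuousOn
    refine (continuousOn_const.add h3 (f := fun _ => u a)).congr fun x hx => ?_
    rw [uIcc_of_le hab] at hx
    exact hu x hx
  rw [intervalIntegral.integral_add (hd.mul_continuousOn hcu)
    (hg.continuousOn_mul (g := fun x => (φ x : ℂ))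
      (Complex.continuous_ofReal.comp hφ.continuous).continuousOn),
    h1, h2] at h
  simp only [Complex.real_smul]
  simp only [Complex.ofReal_zero, zero_mul, sub_zero] at h
  exact eq_neg_of_add_eq_zero_left h

lemma exists_Icc_of_isCompact (hab : a < b) {K : Set ℝ} (hK : IsCompact K) (hs : K ⊆ Ioo a b) :
    ∃ c d, a < c ∧ d < b ∧ K ⊆ Icc c d := by
  rcases K.eq_empty_or_nonempty with rfl | hne
  · exact ⟨(a + b) / 2, (a + b) / 2, by linarith, by linarith, empty_subset _⟩
  · obtain ⟨c, hc⟩ := hK.exists_isLeast hne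
    obtain ⟨d, hd⟩ := hK.exists_isGreatest hne
    exact ⟨c, d, (hs hc.1).1, (hs hd.1).2, fun x hx => ⟨hc.2 hx, hd.2 hx⟩⟩

/-- The primitive vanishes to the left of the support of `θ`, and to its right because `θ` has
integral zero, so it is again a test function. -/
lemma exists_test_primitive (hab : a < b) {θ : ℝ → ℝ} (hθ : ContDiff ℝ ∞ θ)
    (hθc : HasCompactSupport θ) (hθs : tsupport θ ⊆ Ioo a b) (h0 : ∫ x in a..b, θ x = 0) :
    ∃ ψ : ℝ → ℝ, ContDiff ℝ ∞ ψ ∧ HasCompactSupport ψ ∧ tsupport ψ ⊆ Ioo a b ∧ deriv ψ = θ := by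
  obtain ⟨c, d, hac, hdb, hcd⟩ := exists_Icc_of_isCompact hab hθc hθs
  have hθ0 : ∀ x, x ∉ Icc c d → θ x = 0 := fun x hx =>
    image_eq_zero_of_notMem_tsupport fun h => hx (hcd h)
  have hderiv : ∀ x, HasDerivAt (fun x => ∫ t in a..x, θ t) (θ x) x := fun x =>
    intervalIntegral.integral_hasDerivAt_right (hθ.continuous.intervalIntegrable _ _)
      (hθ.continuous.stronglyMeasurableAtFilter _ _) hθ.continuous.continuousAt
  have hd : deriv (fun x => ∫ t in a..x, θ t) = θ := funext fun x => (hderiv x).deriv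
  have hsupp : Function.support (fun x => ∫ t in a..x, θ t) ⊆ Icc c d := by
    intro x hx
    by_contra hn
    apply hx
    rcases not_and_or.1 hn with h | h
    · rw [not_le] at h
      refine intervalIntegral.integral_zero_ae (Eventually.of_forall fun t ht =>
          hθ0 t fun h' => ?_)
      rcases le_total a x with hax | hax
      · rw [uIoc_of_le hax] at ht; linarith [ht.2, h'.1]
      · rw [uIoc_of_ge hax] at ht; linarith [ht.2, h'.1]
    · rw [not_le] at h
      have h1 : ∫ t in b..x, θ t = 0 := by
        refine intervalIntegral.integral_zero_ae (Eventually.of_forall fun t ht =>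
          hθ0 t fun h' => ?_)
        rcases le_total b x with hax | hax
        · rw [uIoc_of_le hax] at ht; linarith [ht.1, h'.2]
        · rw [uIoc_of_ge hax] at ht; linarith [ht.1, h'.2]
      have h2 := intervalIntegral.integral_add_adjacent_intervals
        (hθ.continuous.intervalIntegrable (μ := volume) a b)
        (hθ.continuous.intervalIntegrable (μ := volume) b x)
      show ∫ t in a..x, θ t = 0
      rw [← h2, h0, h1, add_zero]
  have hts : tsupport (fun x => ∫ t in a..x, θ t) ⊆ Icc c d := closure_minimal hsupp isClosed_Icc
  refine ⟨fun x => ∫ t in a..x, θ t, ?_, ?_, ?_, hd⟩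
  · rw [contDiff_infty_iff_deriv, hd]
    exact ⟨fun x => (hderiv x).differentiableAt, hθ⟩
  · exact isCompact_Icc.of_isClosed_subset (isClosed_tsupport _) hts
  · exact hts.trans fun x hx => ⟨hac.trans_le hx.1, hx.2.trans_lt hdb⟩

lemma exists_test_integral_eq_one (hab : a < b) :
    ∃ χ : ℝ → ℝ, ContDiff ℝ ∞ χ ∧ HasCompactSupport χ ∧ tsupport χ ⊆ Ioo a b ∧
      ∫ x in a..b, χ x = 1 := by
  let f : ContDiffBump ((a + b) / 2) := ⟨(b - a) / 8, (b - a) / 4, by linarith, by linarith⟩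
  have hts : tsupport (f.normed volume) ⊆ Ioo a b := by
    rw [f.tsupport_normed_eq]
    intro x hx
    rw [Metric.mem_closedBall, Real.dist_eq, abs_le] at hx
    have : f.rOut = (b - a) / 4 := rfl
    rw [this] at hx
    constructor <;> linarith [hx.1, hx.2]
  refine ⟨f.normed volume, f.contDiff_normed, f.hasCompactSupport_normed, hts, ?_⟩
  rw [← f.integral_normed (μ := volume), intervalIntegral.integral_of_le hab.le,
    setIntegral_eq_integral_of_forall_compl_eq_zero]
  intro x hx
  exact eq_zero_of_tsupport_subset hts fun h => hx (Ioo_subset_Ioc_self h)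

/-- The lemma of du Bois-Reymond. -/
lemma HasWeakDeriv.ae_eq_integral {u g : ℝ → ℂ} (hab : a < b) (hu : IntervalIntegrable u volume a b)
    (hg : IntervalIntegrable g volume a b) (h : HasWeakDeriv a b u g) :
    ∃ C : ℂ, ∀ᵐ x, x ∈ Ioo a b → u x = C + ∫ t in a..x, g t := by
  set P : ℝ → ℂ := fun x => ∫ t in a..x, g t with hP
  have hPi : IntervalIntegrable P volume a b :=
    (absolutelyContinuousOnInterval_integral hg).continuousOn.intervalIntegrable
  have hPw : HasWeakDeriv a b P g := hasWeakDeriv_of_integral hab.le hg fun x _ => by simp [hP]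
  set w : ℝ → ℂ := fun x => u x - P x with hw
  have hwi : IntervalIntegrable w volume a b := hu.sub hPi
  have hint : ∀ (φ : ℝ → ℝ) (v : ℝ → ℂ), Continuous φ → IntervalIntegrable v volume a b →
      IntervalIntegrable (fun x => φ x • v x) volume a b := fun φ v hφ hv =>
    hv.continuousOn_smul hφ.continuousOn
  have hw0 : ∀ φ : ℝ → ℝ, ContDiff ℝ ∞ φ → HasCompactSupport φ → tsupport φ ⊆ Ioo a b →
      ∫ x in a..b, deriv φ x • w x = 0 := by
    intro φ h1 h2 h3
    simp only [hw, smul_sub]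
    rw [intervalIntegral.integral_sub (hint _ _ (h1.continuous_deriv (by simp)) hu)
      (hint _ _ (h1.continuous_deriv (by simp)) hPi), h φ h1 h2 h3, hPw φ h1 h2 h3, sub_self]
  obtain ⟨χ, χ1, χ2, χ3, χ4⟩ := exists_test_integral_eq_one hab
  set C : ℂ := ∫ x in a..b, χ x • w x with hC
  have key : ∀ φ : ℝ → ℝ, ContDiff ℝ ∞ φ → HasCompactSupport φ → tsupport φ ⊆ Ioo a b →
      ∫ x in a..b, φ x • (w x - C) = 0 := by
    intro φ h1 h2 h3
    -- Subtracting `I * χ` makes the integral of `φ` zero, so the difference is the derivative of a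
    -- test function, and `w` annihilates all such derivatives.
    set I : ℝ := ∫ x in a..b, φ x with hI
    have hs : tsupport (fun x => φ x - I * χ x) ⊆ tsupport φ ∪ tsupport χ := by
      refine closure_minimal ?_ ((isClosed_tsupport _).union (isClosed_tsupport _))
      intro x hx
      by_contra hn
      rw [mem_union, not_or] at hn
      exact hx (by simp [image_eq_zero_of_notMem_tsupport hn.1,
        image_eq_zero_of_notMem_tsupport hn.2])
    obtain ⟨ψ, p1, p2, p3, p4⟩ := exists_test_primitive hab
      (θ := fun x => φ x - I * χ x) (h1.sub (contDiff_const.mul χ1))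
      ((h2.union χ2).of_isClosed_subset (isClosed_tsupport _) hs)
      (hs.trans (union_subset h3 χ3)) (by
        rw [intervalIntegral.integral_sub (h1.continuous.intervalIntegrable _ _)
          ((χ1.continuous.intervalIntegrable _ _).const_mul I),
          intervalIntegral.integral_const_mul, χ4, mul_one, sub_self])
    have h4 := hw0 ψ p1 p2 p3
    rw [p4] at h4
    simp only [sub_smul, mul_smul] at h4
    rw [intervalIntegral.integral_sub (hint _ _ h1.continuous hwi)
      (f := fun x => φ x • w x) (g := fun x => I • χ x • w x)
      ((hint _ _ χ1.continuous hwi).smul I), intervalIntegral.integral_smul, ← hC] at h4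
    simp only [smul_sub]
    rw [intervalIntegral.integral_sub (hint _ _ h1.continuous hwi)
      (hint _ _ h1.continuous intervalIntegrable_const), intervalIntegral.integral_smul_const, ← hI]
    exact h4
  have hae : ∀ᵐ x, x ∈ Ioo a b → w x - C = 0 := by
    refine isOpen_Ioo.ae_eq_zero_of_integral_contDiff_smul_eq_zero ?_ fun φ h1 h2 h3 => ?_
    · exact ((intervalIntegrable_iff_integrableOn_Ioo_of_le hab.le).1
        (hwi.sub intervalIntegrable_const)).locallyIntegrableOn
    · rw [← key φ h1 h2 h3, intervalIntegral.integral_of_le hab.le,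
        setIntegral_eq_integral_of_forall_compl_eq_zero]
      intro x hx
      rw [eq_zero_of_tsupport_subset h3 fun h => hx (Ioo_subset_Ioc_self h), zero_smul]
  refine ⟨C, ?_⟩
  filter_upwards [hae] with x hx h
  have h1 := hx h
  simp only [hw, hP] at h1
  linear_combination h1

/-- For continuous `u` the almost everywhere identity holds everywhere on `[a, b]`, and evaluation
at `a` identifies the constant. -/
lemma HasWeakDeriv.eq_integral {u g : ℝ → ℂ} (hab : a < b) (hu : ContinuousOn u (Icc a b))
    (hg : IntervalIntegrable g volume a b) (h : HasWeakDeriv a b u g) :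
    ∀ x ∈ Icc a b, u x = u a + ∫ t in a..x, g t := by
  obtain ⟨C, hC⟩ := h.ae_eq_integral hab (hu.intervalIntegrable_of_Icc hab.le) hg
  have hPc : ContinuousOn (fun x => C + ∫ t in a..x, g t) (Icc a b) := by
    have := (absolutelyContinuousOnInterval_integral hg).continuousOn
    rw [uIcc_of_le hab.le] at this
    exact continuousOn_const.add this
  have heq : EqOn u (fun x => C + ∫ t in a..x, g t) (Icc a b) := by
    refine Measure.eqOn_Icc_of_ae_eq volume hab.ne ?_ hu hPc
    rwa [Filter.EventuallyEq, ← restrict_Ioo_eq_restrict_Icc, ae_restrict_iff' measurableSet_Ioo]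
  intro x hx
  have h2 : u a = C := by simpa using heq (left_mem_Icc.2 hab.le)
  rw [h2]
  exact heq hx

end Interval
end SchrodingerFEM

namespace SchrodingerFEM

/-! ### The Sobolev space H¹ of an interval -/

section SobolevInterval

variable {a b : ℝ} {u v : ℝ → ℂ}

lemma memH1_of_integral {g : ℝ → ℂ} (hab : a ≤ b) (hg : MemLp g 2 (volume.restrict (Ioo a b)))
    (hu : ∀ x ∈ Icc a b, u x = u a + ∫ t in a..x, g t) : MemH1 a b u := by
  have hi := intervalIntegrable_of_memLp hab hg
  refine ⟨?_, g, hg, hasWeakDeriv_of_integral hab hi hu⟩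
  have h := (absolutelyContinuousOnInterval_integral hi).continuousOn
  rw [uIcc_of_le hab] at h
  exact (continuousOn_const.add h (f := fun _ => u a)).congr hu

namespace MemH1

lemma weakDeriv_spec (hu : MemH1 a b u) :
    MemLp (weakDeriv a b u) 2 (volume.restrict (Ioo a b)) ∧
      HasWeakDeriv a b u (weakDeriv a b u) := by
  rw [weakDeriv, dif_pos hu.2]
  exact hu.2.choose_spec

lemma memLp (hu : MemH1 a b u) : MemLp (weakDeriv a b u) 2 (volume.restrict (Ioo a b)) :=
  hu.weakDeriv_spec.1

lemma intervalIntegrable (hu : MemH1 a b u) (hab : a ≤ b) :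
    IntervalIntegrable (weakDeriv a b u) volume a b :=
  intervalIntegrable_of_memLp hab hu.memLp

lemma eq_integral (hu : MemH1 a b u) (hab : a < b) :
    ∀ x ∈ Icc a b, u x = u a + ∫ t in a..x, weakDeriv a b u t :=
  hu.weakDeriv_spec.2.eq_integral hab hu.1 (hu.intervalIntegrable hab.le)

lemma ae_hasDerivAt (hu : MemH1 a b u) (hab : a < b) :
    ∀ᵐ x ∂volume.restrict (Ioo a b), HasDerivAt u (weakDeriv a b u x) x := by
  rw [ae_restrict_iff' measurableSet_Ioo]
  filter_upwards [(hu.intervalIntegrable hab.le).ae_hasDerivAt_integral] with x hx h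
  have h1 := (hx (by rw [uIcc_of_le hab.le]; exact Ioo_subset_Icc_self h) a
    left_mem_uIcc).const_add (u a)
  refine h1.congr_of_eventuallyEq ?_
  filter_upwards [Icc_mem_nhds h.1 h.2] with y hy
  exact hu.eq_integral hab y hy

/-- `weakDeriv` is an arbitrary choice, but by Lebesgue differentiation it agrees almost everywhere
with the pointwise derivative. The computation rules for weak derivatives all come from this. -/
lemma weakDeriv_ae_eq (hu : MemH1 a b u) (hab : a < b) {g : ℝ → ℂ}
    (h : ∀ᵐ x ∂volume.restrict (Ioo a b), HasDerivAt u (g x) x) :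
    weakDeriv a b u =ᵐ[volume.restrict (Ioo a b)] g := by
  filter_upwards [hu.ae_hasDerivAt hab, h] with x h1 h2
  exact h1.unique h2

lemma add (hu : MemH1 a b u) (hv : MemH1 a b v) : MemH1 a b (u + v) := by
  by_cases hab : a < b
  · refine memH1_of_integral hab.le (hu.memLp.add hv.memLp) fun x hx => ?_
    have hs : uIcc a x ⊆ uIcc a b := by
      rw [uIcc_of_le hx.1, uIcc_of_le hab.le]; exact Icc_subset_Icc_right hx.2
    simp only [Pi.add_apply]
    rw [hu.eq_integral hab x hx, hv.eq_integral hab x hx, intervalIntegral.integral_add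
      ((hu.intervalIntegrable hab.le).mono_set hs) ((hv.intervalIntegrable hab.le).mono_set hs)]
    ring
  -- On a degenerate interval the only test function is zero.
  · refine ⟨hu.1.add hv.1, 0, MemLp.zero, fun φ _ _ hφ => ?_⟩
    rw [Ioo_eq_empty hab, subset_empty_iff, tsupport_eq_empty_iff] at hφ
    simp [hφ]

lemma const_smul (hu : MemH1 a b u) (c : ℂ) : MemH1 a b (c • u) := by
  by_cases hab : a < b
  · refine memH1_of_integral hab.le (hu.memLp.const_smul c) fun x hx => ?_
    simp only [Pi.smul_apply]
    rw [hu.eq_integral hab x hx, intervalIntegral.integral_smul, smul_add]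
  · refine ⟨hu.1.const_smul c, 0, MemLp.zero, fun φ _ _ hφ => ?_⟩
    rw [Ioo_eq_empty hab, subset_empty_iff, tsupport_eq_empty_iff] at hφ
    simp [hφ]

lemma zero : MemH1 a b 0 :=
  ⟨continuousOn_const, 0, MemLp.zero, fun φ _ _ _ => by simp⟩

lemma neg (hu : MemH1 a b u) : MemH1 a b (-u) := by simpa using hu.const_smul (-1)

lemma sub (hu : MemH1 a b u) (hv : MemH1 a b v) : MemH1 a b (u - v) := by
  rw [sub_eq_add_neg]; exact hu.add hv.neg

lemma weakDeriv_add (hu : MemH1 a b u) (hv : MemH1 a b v) (hab : a < b) :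
    weakDeriv a b (u + v) =ᵐ[volume.restrict (Ioo a b)] weakDeriv a b u + weakDeriv a b v := by
  refine (hu.add hv).weakDeriv_ae_eq hab ?_
  filter_upwards [hu.ae_hasDerivAt hab, hv.ae_hasDerivAt hab] with x h1 h2 using h1.add h2

lemma weakDeriv_sub (hu : MemH1 a b u) (hv : MemH1 a b v) (hab : a < b) :
    weakDeriv a b (u - v) =ᵐ[volume.restrict (Ioo a b)] weakDeriv a b u - weakDeriv a b v := by
  refine (hu.sub hv).weakDeriv_ae_eq hab ?_
  filter_upwards [hu.ae_hasDerivAt hab, hv.ae_hasDerivAt hab] with x h1 h2 using h1.sub h2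

lemma weakDeriv_const_smul (hu : MemH1 a b u) (c : ℂ) (hab : a < b) :
    weakDeriv a b (c • u) =ᵐ[volume.restrict (Ioo a b)] c • weakDeriv a b u := by
  refine (hu.const_smul c).weakDeriv_ae_eq hab ?_
  filter_upwards [hu.ae_hasDerivAt hab] with x h1 using h1.const_smul c

end MemH1

lemma memLp_two_of_bound {g : ℝ → ℂ} {C : ℝ}
    (hg : AEStronglyMeasurable g (volume.restrict (Ioo a b))) (h : ∀ x ∈ Ioo a b, ‖g x‖ ≤ C) :
    MemLp g 2 (volume.restrict (Ioo a b)) :=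
  MemLp.of_bound hg C ((ae_restrict_iff' measurableSet_Ioo).2 (Eventually.of_forall h))

lemma memLp_two_of_continuousOn {g : ℝ → ℂ} (hg : ContinuousOn g (Icc a b)) :
    MemLp g 2 (volume.restrict (Ioo a b)) := by
  obtain ⟨C, hC⟩ := isCompact_Icc.exists_bound_of_continuousOn hg
  exact memLp_two_of_bound ((hg.mono Ioo_subset_Icc_self).aestronglyMeasurable measurableSet_Ioo)
    fun x hx => hC x (Ioo_subset_Icc_self hx)

lemma memH1_of_hasDerivAt {g : ℝ → ℂ} (hab : a ≤ b) (hu : ContinuousOn u (Icc a b))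
    (hg : ContinuousOn g (Icc a b)) (h : ∀ x ∈ Ioo a b, HasDerivAt u (g x) x) : MemH1 a b u := by
  refine memH1_of_integral hab (memLp_two_of_continuousOn hg) fun x hx => ?_
  rw [intervalIntegral.integral_eq_sub_of_hasDerivAt_of_le hx.1
    (hu.mono (Icc_subset_Icc_right hx.2)) (fun y hy => h y ⟨hy.1, hy.2.trans_le hx.2⟩)]
  · ring
  · exact ContinuousOn.intervalIntegrable_of_Icc hx.1 (hg.mono (Icc_subset_Icc_right hx.2))

lemma memH1_of_contDiffOn (hab : a < b) (hu : ContDiffOn ℝ 1 u (Icc a b)) : MemH1 a b u := by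
  refine memH1_of_hasDerivAt hab.le hu.continuousOn
    (hu.continuousOn_derivWithin (uniqueDiffOn_Icc hab) le_rfl) fun x hx => ?_
  exact ((hu.differentiableOn one_ne_zero) x (Ioo_subset_Icc_self hx)).hasDerivWithinAt.hasDerivAt
    (Icc_mem_nhds hx.1 hx.2)

/-- A Lipschitz function is absolutely continuous, hence the integral of its bounded derivative.
Tent functions enter H¹ by this route. -/
lemma memH1_ofReal_of_lipschitzOnWith {f : ℝ → ℝ} {K : NNReal} (hab : a ≤ b)
    (hf : LipschitzOnWith K f (Icc a b)) : MemH1 a b fun x => (f x : ℂ) := by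
  have hm : AEStronglyMeasurable (deriv f) (volume.restrict (Ioo a b)) :=
    (measurable_deriv f).aestronglyMeasurable
  refine memH1_of_integral (g := fun x => ((deriv f x : ℝ) : ℂ)) hab ?_ fun x hx => ?_
  · refine memLp_two_of_bound (C := K)
      (Complex.continuous_ofReal.comp_aestronglyMeasurable hm) fun x hx => ?_
    rw [Complex.norm_real]
    by_cases hd : DifferentiableAt ℝ f x
    · refine norm_deriv_le_of_lipschitzOn (Icc_mem_nhds hx.1 hx.2) hf
    · rw [deriv_zero_of_not_differentiableAt hd, norm_zero]; exact K.2
  · have h1 : LipschitzOnWith K f (uIcc a x) := by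
      rw [uIcc_of_le hx.1]; exact hf.mono (Icc_subset_Icc_right hx.2)
    rw [intervalIntegral.integral_ofReal, h1.absolutelyContinuousOnInterval.integral_deriv_eq_sub]
    push_cast; ring

/-- The square of the `L²` norm of a function on `(a, b)`. -/
noncomputable def normSq (a b : ℝ) (g : ℝ → ℂ) : ℝ := ∫ x in a..b, ‖g x‖ ^ 2

lemma intervalIntegrable_norm_sq {g : ℝ → ℂ} (hab : a ≤ b)
    (hg : MemLp g 2 (volume.restrict (Ioo a b))) :
    IntervalIntegrable (fun x => ‖g x‖ ^ 2) volume a b := by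
  rw [intervalIntegrable_iff_integrableOn_Ioo_of_le hab]
  exact hg.integrable_norm_pow (by norm_num)

lemma normSq_nonneg (hab : a ≤ b) (g : ℝ → ℂ) : 0 ≤ normSq a b g :=
  intervalIntegral.integral_nonneg hab fun x _ => by positivity

lemma normSq_mono {g : ℝ → ℂ} (hab : a ≤ b) (hg : MemLp g 2 (volume.restrict (Ioo a b)))
    {c d : ℝ} (hac : a ≤ c) (hcd : c ≤ d) (hdb : d ≤ b) : normSq c d g ≤ normSq a b g :=
  intervalIntegral.integral_mono_interval hac hcd hdb
    (Eventually.of_forall fun x => by positivity) (intervalIntegrable_norm_sq hab hg)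

lemma norm_integral_sq_le {g : ℝ → ℂ} (hab : a ≤ b) (hg : MemLp g 2 (volume.restrict (Ioo a b))) :
    ‖∫ x in a..b, g x‖ ^ 2 ≤ (b - a) * normSq a b g := by
  rcases hab.eq_or_lt with rfl | hlt
  · simp
  have h1 : ‖∫ x in a..b, g x‖ ≤ ∫ x in a..b, ‖g x‖ :=
    intervalIntegral.norm_integral_le_integral_norm hab
  have hn := (intervalIntegrable_of_memLp hab hg).norm
  have hs := intervalIntegrable_norm_sq hab hg
  set I := ∫ x in a..b, ‖g x‖ with hI
  set t := I / (b - a) with ht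
  have h2 : 0 ≤ ∫ x in a..b, (‖g x‖ - t) ^ 2 :=
    intervalIntegral.integral_nonneg hab fun x _ => by positivity
  have h3 : ∫ x in a..b, (‖g x‖ - t) ^ 2 = normSq a b g - 2 * t * I + t ^ 2 * (b - a) := by
    have : ∀ x, (‖g x‖ - t) ^ 2 = ‖g x‖ ^ 2 - 2 * t * ‖g x‖ + t ^ 2 := fun x => by ring
    simp only [this]
    rw [intervalIntegral.integral_add (hs.sub (hn.const_mul _)) intervalIntegrable_const,
      intervalIntegral.integral_sub hs (hn.const_mul _), intervalIntegral.integral_const_mul,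
      intervalIntegral.integral_const, smul_eq_mul, normSq]
    ring
  have hpos : 0 < b - a := sub_pos.2 hlt
  have h4 : t * (b - a) = I := div_mul_cancel₀ _ hpos.ne'
  have h5 : I ^ 2 ≤ (b - a) * normSq a b g := by
    rw [h3] at h2
    have : 0 ≤ (b - a) * (normSq a b g - 2 * t * I + t ^ 2 * (b - a)) := by positivity
    nlinarith
  exact (pow_le_pow_left₀ (norm_nonneg _) h1 2).trans h5

namespace MemH1

lemma sub_eq_integral (hu : MemH1 a b u) (hab : a < b) {x y : ℝ} (hx : x ∈ Icc a b)
    (hy : y ∈ Icc a b) : u y - u x = ∫ t in x..y, weakDeriv a b u t := by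
  have hi : ∀ z ∈ Icc a b, IntervalIntegrable (weakDeriv a b u) volume a z := fun z hz =>
    (hu.intervalIntegrable hab.le).mono_set (by
      rw [uIcc_of_le hz.1, uIcc_of_le hab.le]; exact Icc_subset_Icc_right hz.2)
  rw [hu.eq_integral hab x hx, hu.eq_integral hab y hy, add_sub_add_left_eq_sub,
    intervalIntegral.integral_interval_sub_left (hi y hy) (hi x hx)]

/-- Members of `H¹` are Hölder continuous with exponent `1/2`. -/
lemma norm_sub_sq_le (hu : MemH1 a b u) (hab : a < b) {x y : ℝ} (hx : x ∈ Icc a b)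
    (hy : y ∈ Icc a b) : ‖u y - u x‖ ^ 2 ≤ |y - x| * normSq a b (weakDeriv a b u) := by
  wlog hxy : x ≤ y generalizing x y
  · rw [norm_sub_rev, abs_sub_comm]; exact this hy hx (le_of_not_ge hxy)
  rw [hu.sub_eq_integral hab hx hy, abs_of_nonneg (sub_nonneg.2 hxy)]
  have hm : MemLp (weakDeriv a b u) 2 (volume.restrict (Ioo x y)) :=
    hu.memLp.mono_measure (Measure.restrict_mono (Ioo_subset_Ioo hx.1 hy.2) le_rfl)
  exact (norm_integral_sq_le hxy hm).trans
    (mul_le_mul_of_nonneg_left (normSq_mono hab.le hu.memLp hx.1 hxy hy.2) (sub_nonneg.2 hxy))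

lemma memLp_self (hu : MemH1 a b u) : MemLp u 2 (volume.restrict (Ioo a b)) :=
  memLp_two_of_continuousOn hu.1

/-- The trace inequality. -/
lemma norm_sq_le (hu : MemH1 a b u) (hab : a < b) {c d x : ℝ} (hac : a ≤ c) (hdb : d ≤ b)
    (hcd : c ≤ d) (hx : x ∈ Icc c d) :
    (d - c) * ‖u x‖ ^ 2 ≤ 2 * normSq a b u + 2 * (d - c) ^ 2 * normSq a b (weakDeriv a b u) := by
  have hsub : Icc c d ⊆ Icc a b := Icc_subset_Icc hac hdb
  have hcu : ContinuousOn (fun y => ‖u y‖ ^ 2) (Icc c d) := ((hu.1.mono hsub).norm.pow 2)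
  -- The value at `x` is compared with that at a variable `y` by Hölder continuity; integrating over
  -- `y` then gives the claim.
  have h1 : ∀ y ∈ Icc c d,
      ‖u x‖ ^ 2 ≤ 2 * ‖u y‖ ^ 2 + 2 * ((d - c) * normSq a b (weakDeriv a b u)) := by
    intro y hy
    have h2 := hu.norm_sub_sq_le hab (hsub hy) (hsub hx)
    have h3 : |x - y| ≤ d - c := abs_sub_le_iff.2 ⟨by linarith [hx.2, hy.1], by
      linarith [hy.2, hx.1]⟩
    have h4 := h2.trans (mul_le_mul_of_nonneg_right h3 (normSq_nonneg hab.le _))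
    have h5 := norm_le_norm_add_norm_sub' (u x) (u y)
    nlinarith [sq_nonneg (‖u y‖ - ‖u x - u y‖), norm_nonneg (u x)]
  have h2 := intervalIntegral.integral_mono_on (μ := volume) hcd intervalIntegrable_const
    (((hcu.intervalIntegrable_of_Icc hcd).const_mul 2).add intervalIntegrable_const) h1
  rw [intervalIntegral.integral_add ((hcu.intervalIntegrable_of_Icc hcd).const_mul 2)
    intervalIntegrable_const, intervalIntegral.integral_const, intervalIntegral.integral_const,
    intervalIntegral.integral_const_mul, smul_eq_mul, smul_eq_mul] at h2
  have h3 : normSq c d u ≤ normSq a b u := normSq_mono hab.le hu.memLp_self hac hcd hdb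
  rw [normSq] at h3
  nlinarith

lemma norm_le_sqrt (hu : MemH1 a b u) (hab : a < b) {x : ℝ} (hx : x ∈ Icc a b) :
    ‖u x‖ ^ 2 ≤ 2 * ‖u a‖ ^ 2 + 2 * (b - a) * normSq a b (weakDeriv a b u) := by
  have h1 := hu.norm_sub_sq_le hab (left_mem_Icc.2 hab.le) hx
  rw [abs_of_nonneg (sub_nonneg.2 hx.1)] at h1
  have h2 : (x - a) * normSq a b (weakDeriv a b u) ≤ (b - a) * normSq a b (weakDeriv a b u) :=
    mul_le_mul_of_nonneg_right (by linarith [hx.2]) (normSq_nonneg hab.le _)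
  have h5 := norm_le_norm_add_norm_sub' (u x) (u a)
  nlinarith [sq_nonneg (‖u a‖ - ‖u x - u a‖), norm_nonneg (u x)]

end MemH1

end SobolevInterval
end SchrodingerFEM

namespace SchrodingerFEM

/-! ### Linear algebra of the boundary condition -/

section Boundary

variable {n : ℕ} (U : Matrix.unitaryGroup (Bdry n) ℂ)

/-- The boundary condition for a pair of boundary values and normal derivatives. -/
def IsBoundaryPair (φ d : Bdry n → ℂ) : Prop :=
  φ - Complex.I • d = (U : Matrix (Bdry n) (Bdry n) ℂ).mulVec (φ + Complex.I • d)

/-- The hermitian inner product on the space of boundary values. -/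
def bdryInner (ψ φ : Bdry n → ℂ) : ℂ := ∑ l, (starRingEnd ℂ) (ψ l) * φ l

/-- The boundary values that are compatible with the boundary condition. -/
def bdryRange : Submodule ℂ (Bdry n → ℂ) :=
  LinearMap.range (Matrix.mulVecLin (1 + (U : Matrix (Bdry n) (Bdry n) ℂ)))

lemma bdryInner_eq (ψ φ : Bdry n → ℂ) : bdryInner ψ φ = star ψ ⬝ᵥ φ := rfl

lemma bdryInner_self (φ : Bdry n → ℂ) : bdryInner φ φ = ((∑ l, ‖φ l‖ ^ 2 : ℝ) : ℂ) := by
  simp [bdryInner, Complex.conj_mul']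

lemma bdryInner_add_left (ψ₁ ψ₂ φ : Bdry n → ℂ) :
    bdryInner (ψ₁ + ψ₂) φ = bdryInner ψ₁ φ + bdryInner ψ₂ φ := by
  simp [bdryInner_eq, add_dotProduct]

lemma bdryInner_add_right (ψ φ₁ φ₂ : Bdry n → ℂ) :
    bdryInner ψ (φ₁ + φ₂) = bdryInner ψ φ₁ + bdryInner ψ φ₂ := by
  simp [bdryInner_eq, dotProduct_add]

lemma bdryInner_sub_left (ψ₁ ψ₂ φ : Bdry n → ℂ) :
    bdryInner (ψ₁ - ψ₂) φ = bdryInner ψ₁ φ - bdryInner ψ₂ φ := by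
  simp [bdryInner_eq, sub_dotProduct]

lemma bdryInner_sub_right (ψ φ₁ φ₂ : Bdry n → ℂ) :
    bdryInner ψ (φ₁ - φ₂) = bdryInner ψ φ₁ - bdryInner ψ φ₂ := by
  simp [bdryInner_eq, dotProduct_sub]

lemma bdryInner_smul_left (c : ℂ) (ψ φ : Bdry n → ℂ) :
    bdryInner (c • ψ) φ = (starRingEnd ℂ) c * bdryInner ψ φ := by
  simp [bdryInner_eq, star_smul]

lemma bdryInner_smul_right (c : ℂ) (ψ φ : Bdry n → ℂ) :
    bdryInner ψ (c • φ) = c * bdryInner ψ φ := by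
  simp [bdryInner_eq]

lemma bdryInner_conj_symm (ψ φ : Bdry n → ℂ) :
    (starRingEnd ℂ) (bdryInner ψ φ) = bdryInner φ ψ := by
  simp [bdryInner, map_sum, mul_comm]

lemma norm_bdryInner_le (ψ φ : Bdry n → ℂ) :
    ‖bdryInner ψ φ‖ ≤ Fintype.card (Bdry n) * (‖ψ‖ * ‖φ‖) := by
  refine (norm_sum_le _ _).trans ?_
  rw [← nsmul_eq_mul, ← Finset.card_univ]
  refine Finset.sum_le_card_nsmul _ _ _ fun l _ => ?_
  rw [norm_mul, RCLike.norm_conj]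
  exact mul_le_mul (norm_le_pi_norm ψ l) (norm_le_pi_norm φ l) (norm_nonneg _) (norm_nonneg _)

lemma bdryInner_mulVec_conjTranspose (M : Matrix (Bdry n) (Bdry n) ℂ) (ψ φ : Bdry n → ℂ) :
    bdryInner (M.mulVec ψ) φ = bdryInner ψ (M.conjTranspose.mulVec φ) := by
  rw [bdryInner_eq, bdryInner_eq, Matrix.star_mulVec, Matrix.dotProduct_mulVec]

lemma bdryInner_unitary (ψ φ : Bdry n → ℂ) :
    bdryInner ((U : Matrix (Bdry n) (Bdry n) ℂ).mulVec ψ)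
      ((U : Matrix (Bdry n) (Bdry n) ℂ).mulVec φ) = bdryInner ψ φ := by
  rw [bdryInner_mulVec_conjTranspose, Matrix.mulVec_mulVec, ← Matrix.star_eq_conjTranspose,
    (Matrix.mem_unitaryGroup_iff').1 U.2, Matrix.one_mulVec]

variable {U}

/-- The boundary condition defines an isotropic subspace. -/
lemma IsBoundaryPair.inner_eq {ψ e φ d : Bdry n → ℂ} (h₁ : IsBoundaryPair U ψ e)
    (h₂ : IsBoundaryPair U φ d) : bdryInner ψ d = bdryInner e φ := by
  have h := bdryInner_unitary U (ψ + Complex.I • e) (φ + Complex.I • d)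
  rw [← h₁, ← h₂] at h
  simp only [bdryInner_add_left, bdryInner_add_right, bdryInner_sub_left, bdryInner_sub_right,
    bdryInner_smul_left, bdryInner_smul_right, Complex.conj_I] at h
  have h3 : 2 * Complex.I * (bdryInner e φ - bdryInner ψ d) = 0 := by linear_combination h
  have h4 : (2 * Complex.I : ℂ) ≠ 0 := by simp
  exact (sub_eq_zero.1 ((mul_eq_zero.1 h3).resolve_left h4)).symm

lemma IsBoundaryPair.add {ψ e φ d : Bdry n → ℂ} (h₁ : IsBoundaryPair U ψ e)
    (h₂ : IsBoundaryPair U φ d) : IsBoundaryPair U (ψ + φ) (e + d) := by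
  unfold IsBoundaryPair at *
  have : (ψ + φ) + Complex.I • (e + d) = (ψ + Complex.I • e) + (φ + Complex.I • d) := by
    rw [smul_add]; abel
  rw [this, Matrix.mulVec_add, ← h₁, ← h₂, smul_add]; abel

/-- Adding `φ + i d` to both sides of the condition gives `2 φ = (1 + U)(φ + i d)`. -/
lemma IsBoundaryPair.mem_range {φ d : Bdry n → ℂ} (h : IsBoundaryPair U φ d) :
    φ ∈ bdryRange U := by
  refine ⟨(2⁻¹ : ℂ) • (φ + Complex.I • d), ?_⟩
  unfold IsBoundaryPair at h
  rw [map_smul, Matrix.mulVecLin_apply, Matrix.add_mulVec, Matrix.one_mulVec, ← h]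
  ext l
  simp
  ring

variable (U) in
-- For `φ = s + U s` and `d = -i (s - U s)` one has `φ + i d = 2 s` and `φ - i d = 2 U s`. A linear
-- right inverse of `1 + U` on its range selects `s`.
lemma exists_bdryMap : ∃ A : (Bdry n → ℂ) →ₗ[ℂ] (Bdry n → ℂ),
    ∀ φ ∈ bdryRange U, IsBoundaryPair U φ (A φ) := by
  set f := Matrix.mulVecLin (1 + (U : Matrix (Bdry n) (Bdry n) ℂ)) with hf
  obtain ⟨g, hg⟩ := f.rangeRestrict.exists_rightInverse_of_surjective
    (LinearMap.range_rangeRestrict f)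
  obtain ⟨g', hg'⟩ := LinearMap.exists_extend g
  refine ⟨(-Complex.I) • (Matrix.mulVecLin (1 - (U : Matrix (Bdry n) (Bdry n) ℂ)) ∘ₗ g'),
    fun φ hφ => ?_⟩
  set s := g' φ with hs
  have h1 : φ = s + (U : Matrix (Bdry n) (Bdry n) ℂ).mulVec s := by
    have h2 := congrArg Subtype.val (LinearMap.congr_fun hg ⟨φ, hφ⟩)
    have h3 : g ⟨φ, hφ⟩ = s := (LinearMap.congr_fun hg' ⟨φ, hφ⟩).symm
    simp only [LinearMap.comp_apply, h3] at h2
    have h4 : f s = φ := h2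
    rw [hf, Matrix.mulVecLin_apply, Matrix.add_mulVec, Matrix.one_mulVec] at h4
    exact h4.symm
  have h2 : ((-Complex.I) • (Matrix.mulVecLin (1 - (U : Matrix (Bdry n) (Bdry n) ℂ)) ∘ₗ g')) φ
      = (-Complex.I) • (s - (U : Matrix (Bdry n) (Bdry n) ℂ).mulVec s) := by
    simp [hs]
  rw [h2]
  unfold IsBoundaryPair
  rw [smul_smul, mul_neg, Complex.I_mul_I, neg_neg, one_smul, h1]
  have h3 : s + (U : Matrix (Bdry n) (Bdry n) ℂ).mulVec s
      + (s - (U : Matrix (Bdry n) (Bdry n) ℂ).mulVec s) = s + s := by abel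
  rw [h3, Matrix.mulVec_add]
  abel

variable (U) in
/-- A choice of normal derivatives for given boundary values. -/
noncomputable def bdryMap : (Bdry n → ℂ) →ₗ[ℂ] (Bdry n → ℂ) := (exists_bdryMap U).choose

lemma isBoundaryPair_bdryMap {φ : Bdry n → ℂ} (hφ : φ ∈ bdryRange U) :
    IsBoundaryPair U φ (bdryMap U φ) := (exists_bdryMap U).choose_spec φ hφ

/-- Isotropy moves both pairings onto `φ`, with the normal derivatives attached to `ψ` instead. So
pairings with admissible boundary values do not see which normal derivatives accompany `φ`, and the
choice made in `bdryMap` does not affect the form. -/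
lemma IsBoundaryPair.inner_eq_bdryMap {φ d ψ : Bdry n → ℂ} (h : IsBoundaryPair U φ d)
    (hψ : ψ ∈ bdryRange U) : bdryInner ψ d = bdryInner ψ (bdryMap U φ) := by
  rw [(isBoundaryPair_bdryMap hψ).inner_eq h,
    (isBoundaryPair_bdryMap hψ).inner_eq (isBoundaryPair_bdryMap h.mem_range)]

lemma bdryInner_bdryMap_symm {φ ψ : Bdry n → ℂ} (hφ : φ ∈ bdryRange U) (hψ : ψ ∈ bdryRange U) :
    (starRingEnd ℂ) (bdryInner φ (bdryMap U ψ)) = bdryInner ψ (bdryMap U φ) := by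
  rw [bdryInner_conj_symm,
    (isBoundaryPair_bdryMap hψ).inner_eq (isBoundaryPair_bdryMap hφ)]

lemma bdryInner_eq_zero {e : Bdry n → ℂ} (h : bdryInner e e = 0) : e = 0 := by
  rw [bdryInner_self, Complex.ofReal_eq_zero,
    Finset.sum_eq_zero_iff_of_nonneg fun l _ => by positivity] at h
  ext l
  simpa using h l (Finset.mem_univ l)

/-- The boundary condition is determined by pairing the normal derivatives with the admissible
boundary values. -/
lemma isBoundaryPair_of_inner_eq {φ d : Bdry n → ℂ} (hφ : φ ∈ bdryRange U)
    (h : ∀ ψ ∈ bdryRange U, bdryInner ψ d = bdryInner ψ (bdryMap U φ)) :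
    IsBoundaryPair U φ d := by
  set e := d - bdryMap U φ with he
  set M : Matrix (Bdry n) (Bdry n) ℂ := 1 + (U : Matrix (Bdry n) (Bdry n) ℂ) with hM
  -- The difference `e` is orthogonal to the range of `1 + U`, which for unitary `U` means `U e =
  -- -e`. Hence `(0, e)` satisfies the boundary condition and may be added to `(φ, bdryMap U φ)`.
  have h1 : M.conjTranspose.mulVec e = 0 := by
    refine bdryInner_eq_zero ?_
    rw [← bdryInner_mulVec_conjTranspose, he, bdryInner_sub_right,
      h (M.mulVec _) ⟨_, rfl⟩, sub_self]
  have h2 : (U : Matrix (Bdry n) (Bdry n) ℂ).mulVec e = -e := by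
    have h3 := congrArg (U : Matrix (Bdry n) (Bdry n) ℂ).mulVec h1
    rw [Matrix.mulVec_mulVec, hM, Matrix.conjTranspose_add, Matrix.conjTranspose_one, mul_add,
      mul_one, ← Matrix.star_eq_conjTranspose, (Matrix.mem_unitaryGroup_iff).1 U.2,
      Matrix.add_mulVec, Matrix.one_mulVec, Matrix.mulVec_zero] at h3
    exact eq_neg_of_add_eq_zero_left h3
  have h4 : IsBoundaryPair U 0 e := by
    unfold IsBoundaryPair
    rw [zero_add, Matrix.mulVec_smul, h2, zero_sub, smul_neg]
  have h5 := (isBoundaryPair_bdryMap hφ).add h4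
  rwa [add_zero, he, add_sub_cancel] at h5

variable (U) in
lemma exists_bdryMap_bound : ∃ C, 0 ≤ C ∧ ∀ ψ φ : Bdry n → ℂ,
    ‖bdryInner ψ (bdryMap U φ)‖ ≤ C * (‖ψ‖ * ‖φ‖) := by
  refine ⟨Fintype.card (Bdry n) * ‖(bdryMap U).toContinuousLinearMap‖, by positivity,
    fun ψ φ => ?_⟩
  refine (norm_bdryInner_le _ _).trans ?_
  have h := (bdryMap U).toContinuousLinearMap.le_opNorm φ
  have h' : ‖bdryMap U φ‖ ≤ ‖(bdryMap U).toContinuousLinearMap‖ * ‖φ‖ := h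
  calc _ ≤ (Fintype.card (Bdry n) : ℝ) *
        (‖ψ‖ * (‖(bdryMap U).toContinuousLinearMap‖ * ‖φ‖)) := by gcongr
    _ = _ := by ring

end Boundary

/-! ### Weighted L² inner products on an interval -/

section Weighted

variable {a b : ℝ} {w : ℝ → ℝ} {f f' g : ℝ → ℂ}

/-- The `L²` inner product on `(a, b)` with weight `w`. -/
noncomputable def weightedInner (a b : ℝ) (w : ℝ → ℝ) (f g : ℝ → ℂ) : ℂ :=
  ∫ x in a..b, (starRingEnd ℂ) (f x) * g x * (w x : ℂ)

lemma intervalIntegrable_weighted (hab : a ≤ b) (hw : ContinuousOn w (Icc a b))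
    (hf : MemLp f 2 (volume.restrict (Ioo a b))) (hg : MemLp g 2 (volume.restrict (Ioo a b))) :
    IntervalIntegrable (fun x => (starRingEnd ℂ) (f x) * g x * (w x : ℂ)) volume a b := by
  have h1 : IntervalIntegrable (fun x => (starRingEnd ℂ) (f x) * g x) volume a b := by
    rw [intervalIntegrable_iff_integrableOn_Ioo_of_le hab]
    exact MemLp.integrable_mul hf.star hg
  refine h1.mul_continuousOn (g := fun x => (w x : ℂ)) ?_
  rw [uIcc_of_le hab]
  exact Complex.continuous_ofReal.comp_continuousOn hw

lemma weightedInner_congr (hab : a ≤ b) (hf : f =ᵐ[volume.restrict (Ioo a b)] f')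
    {g' : ℝ → ℂ} (hg : g =ᵐ[volume.restrict (Ioo a b)] g') :
    weightedInner a b w f g = weightedInner a b w f' g' := by
  unfold weightedInner
  rw [intervalIntegral.integral_of_le hab, intervalIntegral.integral_of_le hab,
    integral_Ioc_eq_integral_Ioo, integral_Ioc_eq_integral_Ioo]
  refine integral_congr_ae ?_
  filter_upwards [hf, hg] with x h1 h2
  rw [h1, h2]

lemma weightedInner_add_left (hab : a ≤ b) (hw : ContinuousOn w (Icc a b))
    (hf : MemLp f 2 (volume.restrict (Ioo a b))) (hf' : MemLp f' 2 (volume.restrict (Ioo a b)))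
    (hg : MemLp g 2 (volume.restrict (Ioo a b))) :
    weightedInner a b w (f + f') g = weightedInner a b w f g + weightedInner a b w f' g := by
  unfold weightedInner
  rw [← intervalIntegral.integral_add (intervalIntegrable_weighted hab hw hf hg)
    (intervalIntegrable_weighted hab hw hf' hg)]
  refine intervalIntegral.integral_congr fun x _ => ?_
  simp only [Pi.add_apply, map_add]
  ring

lemma weightedInner_smul_left (c : ℂ) :
    weightedInner a b w (c • f) g = (starRingEnd ℂ) c * weightedInner a b w f g := by
  unfold weightedInner
  rw [← intervalIntegral.integral_const_mul]
  refine intervalIntegral.integral_congr fun x _ => ?_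
  simp only [Pi.smul_apply, smul_eq_mul, map_mul]
  ring

lemma weightedInner_conj_symm :
    (starRingEnd ℂ) (weightedInner a b w f g) = weightedInner a b w g f := by
  unfold weightedInner
  rw [← intervalIntegral.intervalIntegral_conj]
  refine intervalIntegral.integral_congr fun x _ => ?_
  simp only [map_mul, Complex.conj_conj, Complex.conj_ofReal]
  ring

lemma weightedInner_self : weightedInner a b w f f = ((∫ x in a..b, ‖f x‖ ^ 2 * w x : ℝ) : ℂ) := by
  unfold weightedInner
  rw [← intervalIntegral.integral_ofReal]
  refine intervalIntegral.integral_congr fun x _ => ?_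
  simp only [Complex.conj_mul']
  push_cast
  ring

lemma intervalIntegrable_norm_sq_mul (hab : a ≤ b) (hw : ContinuousOn w (Icc a b))
    (hf : MemLp f 2 (volume.restrict (Ioo a b))) :
    IntervalIntegrable (fun x => ‖f x‖ ^ 2 * w x) volume a b := by
  refine (intervalIntegrable_norm_sq hab hf).mul_continuousOn ?_
  rwa [uIcc_of_le hab]

lemma le_weightedInner_self (hab : a ≤ b) (hw : ContinuousOn w (Icc a b))
    (hf : MemLp f 2 (volume.restrict (Ioo a b))) {m : ℝ} (hm : ∀ x ∈ Icc a b, m ≤ w x) :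
    m * normSq a b f ≤ (weightedInner a b w f f).re := by
  rw [weightedInner_self, Complex.ofReal_re, normSq, ← intervalIntegral.integral_const_mul]
  refine intervalIntegral.integral_mono_on hab ((intervalIntegrable_norm_sq hab hf).const_mul m)
    (intervalIntegrable_norm_sq_mul hab hw hf) fun x hx => ?_
  rw [mul_comm]
  exact mul_le_mul_of_nonneg_left (hm x hx) (by positivity)

lemma weightedInner_self_le (hab : a ≤ b) (hw : ContinuousOn w (Icc a b))
    (hf : MemLp f 2 (volume.restrict (Ioo a b))) {m : ℝ} (hm : ∀ x ∈ Icc a b, w x ≤ m) :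
    (weightedInner a b w f f).re ≤ m * normSq a b f := by
  rw [weightedInner_self, Complex.ofReal_re, normSq, ← intervalIntegral.integral_const_mul]
  refine intervalIntegral.integral_mono_on hab (intervalIntegrable_norm_sq_mul hab hw hf)
    ((intervalIntegrable_norm_sq hab hf).const_mul m) fun x hx => ?_
  rw [mul_comm]
  exact mul_le_mul_of_nonneg_right (hm x hx) (by positivity)

end Weighted
end SchrodingerFEM

/-! ### The quadratic form on the manifold and its bounds -/

namespace SchrodingerFEM

lemma eqOn_zero_of_normSq_eq_zero {a b : ℝ} (hab : a < b) {u : ℝ → ℂ}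
    (hu : ContinuousOn u (Icc a b)) (h : normSq a b u = 0) : EqOn u 0 (Icc a b) := by
  have hi : IntervalIntegrable (fun x => ‖u x‖ ^ 2) volume a b :=
    (hu.norm.pow 2).intervalIntegrable_of_Icc hab.le
  rw [normSq, intervalIntegral.integral_eq_zero_iff_of_nonneg_ae
    (Eventually.of_forall fun x => by positivity) hi] at h
  refine Measure.eqOn_Icc_of_ae_eq volume hab.ne ?_ hu continuousOn_const
  rw [Ioc_eq_empty (not_lt.2 hab.le), union_empty] at h
  rw [← restrict_Ioc_eq_restrict_Icc]
  filter_upwards [h] with x hx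
  simpa using hx

lemma normSq_le_of_norm_le {a b : ℝ} (hab : a ≤ b) {u : ℝ → ℂ} (hu : ContinuousOn u (Icc a b))
    {C : ℝ} (h : ∀ x ∈ Icc a b, ‖u x‖ ^ 2 ≤ C) : normSq a b u ≤ (b - a) * C := by
  have h1 := intervalIntegral.integral_mono_on (μ := volume) hab
    ((hu.norm.pow 2).intervalIntegrable_of_Icc hab) intervalIntegrable_const h
  rwa [intervalIntegral.integral_const, smul_eq_mul] at h1

lemma normSq_congr {a b : ℝ} (hab : a ≤ b) {f g : ℝ → ℂ}
    (h : f =ᵐ[volume.restrict (Ioo a b)] g) : normSq a b f = normSq a b g := by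
  unfold normSq
  rw [intervalIntegral.integral_of_le hab, intervalIntegral.integral_of_le hab,
    integral_Ioc_eq_integral_Ioo, integral_Ioc_eq_integral_Ioo]
  refine integral_congr_ae ?_
  filter_upwards [h] with x h1
  rw [h1]

lemma exists_forall_le {ι : Type*} [Finite ι] (f : ι → ℝ) : ∃ M, 0 < M ∧ ∀ i, f i ≤ M := by
  obtain ⟨M, hM⟩ := (Set.finite_range f).bddAbove
  exact ⟨max M 1, lt_max_of_lt_right one_pos, fun i => (hM ⟨i, rfl⟩).trans (le_max_left _ _)⟩

namespace Operator

variable {n : ℕ} (H : Operator n) (U : Matrix.unitaryGroup (Bdry n) ℂ)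

/-- Membership in the Sobolev space `H¹` of the manifold. -/
def IsH1 (Φ : Fun n) : Prop := ∀ α, MemH1 (H.a α) (H.b α) (Φ α)

variable {H} in
lemma IsH1.add {Ψ Φ : Fun n} (h₁ : H.IsH1 Ψ) (h₂ : H.IsH1 Φ) : H.IsH1 (Ψ + Φ) :=
  fun α => (h₁ α).add (h₂ α)

variable {H} in
lemma IsH1.sub {Ψ Φ : Fun n} (h₁ : H.IsH1 Ψ) (h₂ : H.IsH1 Φ) : H.IsH1 (Ψ - Φ) :=
  fun α => (h₁ α).sub (h₂ α)

variable {H} in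
lemma IsH1.smul {Φ : Fun n} (c : ℂ) (h : H.IsH1 Φ) : H.IsH1 (c • Φ) :=
  fun α => (h α).const_smul c

lemma continuousOn_sqrt (α : Fin n) :
    ContinuousOn (fun x => Real.sqrt (H.η α x)) (Icc (H.a α) (H.b α)) :=
  Real.continuous_sqrt.comp_continuousOn (H.η_smooth α).continuousOn

lemma sqrt_pos (α : Fin n) {x : ℝ} (hx : x ∈ Icc (H.a α) (H.b α)) : 0 < Real.sqrt (H.η α x) :=
  Real.sqrt_pos.2 (H.η_pos α x hx)

lemma continuousOn_inv_sqrt (α : Fin n) :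
    ContinuousOn (fun x => (Real.sqrt (H.η α x))⁻¹) (Icc (H.a α) (H.b α)) :=
  (H.continuousOn_sqrt α).inv₀ fun _ hx => (H.sqrt_pos α hx).ne'

lemma continuousOn_potential (α : Fin n) :
    ContinuousOn (fun x => H.V α x * Real.sqrt (H.η α x)) (Icc (H.a α) (H.b α)) :=
  (H.V_continuous α).mul (H.continuousOn_sqrt α)

lemma exists_bound : ∃ M, 0 < M ∧ ∀ α, ∀ x ∈ Icc (H.a α) (H.b α), Real.sqrt (H.η α x) ≤ M ∧
    (Real.sqrt (H.η α x))⁻¹ ≤ M ∧ |H.V α x * Real.sqrt (H.η α x)| ≤ M := by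
  have h : ∀ α, ∃ M, ∀ x ∈ Icc (H.a α) (H.b α), Real.sqrt (H.η α x) ≤ M ∧
      (Real.sqrt (H.η α x))⁻¹ ≤ M ∧ |H.V α x * Real.sqrt (H.η α x)| ≤ M := by
    intro α
    obtain ⟨M1, h1⟩ := isCompact_Icc.exists_bound_of_continuousOn (H.continuousOn_sqrt α)
    obtain ⟨M2, h2⟩ := isCompact_Icc.exists_bound_of_continuousOn (H.continuousOn_inv_sqrt α)
    obtain ⟨M3, h3⟩ := isCompact_Icc.exists_bound_of_continuousOn (H.continuousOn_potential α)
    refine ⟨max M1 (max M2 M3), fun x hx => ⟨?_, ?_, ?_⟩⟩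
    · exact (le_abs_self _).trans ((h1 x hx).trans (le_max_left _ _))
    · exact (le_abs_self _).trans ((h2 x hx).trans ((le_max_left _ _).trans (le_max_right _ _)))
    · exact (h3 x hx).trans ((le_max_right _ _).trans (le_max_right _ _))
  choose M hM using h
  obtain ⟨M', h0, h'⟩ := exists_forall_le M
  exact ⟨M', h0, fun α x hx => ⟨(hM α x hx).1.trans (h' α), (hM α x hx).2.1.trans (h' α),
    (hM α x hx).2.2.trans (h' α)⟩⟩

lemma inner2_eq (Ψ Φ : Fun n) : H.inner2 Ψ Φ = ∑ α, weightedInner (H.a α) (H.b α)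
    (fun x => Real.sqrt (H.η α x)) (Ψ α) (Φ α) := rfl

lemma energy_eq (Ψ Φ : Fun n) : H.energy Ψ Φ = ∑ α, weightedInner (H.a α) (H.b α)
    (fun x => (Real.sqrt (H.η α x))⁻¹) (H.D Ψ α) (H.D Φ α) := by
  unfold energy weightedInner
  simp only [Complex.ofReal_inv]

/-- Multiplication by the potential. -/
def potMul (Φ : Fun n) : Fun n := fun α x => (H.V α x : ℂ) * Φ α x

lemma inner2_potMul_eq (Ψ Φ : Fun n) : H.inner2 Ψ (H.potMul Φ) =
    ∑ α, weightedInner (H.a α) (H.b α) (fun x => H.V α x * Real.sqrt (H.η α x)) (Ψ α) (Φ α) := by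
  unfold inner2 weightedInner potMul
  refine Finset.sum_congr rfl fun α _ => intervalIntegral.integral_congr fun x _ => ?_
  push_cast
  ring

/-- The closed hermitian form of the self-adjoint extension, shifted by `c`. -/
noncomputable def form (c : ℝ) (Ψ Φ : Fun n) : ℂ :=
  H.energy Ψ Φ - bdryInner (H.trace Ψ) (bdryMap U (H.trace Φ)) + H.inner2 Ψ (H.potMul Φ)
    + c * H.inner2 Ψ Φ

lemma trace_add (Ψ Φ : Fun n) : H.trace (Ψ + Φ) = H.trace Ψ + H.trace Φ := by
  ext l; rcases l with α | α <;> rfl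

lemma trace_sub (Ψ Φ : Fun n) : H.trace (Ψ - Φ) = H.trace Ψ - H.trace Φ := by
  ext l; rcases l with α | α <;> rfl

lemma trace_smul (c : ℂ) (Φ : Fun n) : H.trace (c • Φ) = c • H.trace Φ := by
  ext l; rcases l with α | α <;> rfl

/-- The domain of the form: functions of class `H¹` with admissible boundary values. -/
def h1Space : Submodule ℂ (Fun n) where
  carrier := {Φ | H.IsH1 Φ ∧ H.trace Φ ∈ bdryRange U}
  zero_mem' := ⟨fun _ => MemH1.zero, by
    have : H.trace 0 = 0 := by ext l; rcases l with α | α <;> rfl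
    rw [this]; exact Submodule.zero_mem _⟩
  add_mem' h₁ h₂ := ⟨h₁.1.add h₂.1, by rw [H.trace_add]; exact Submodule.add_mem _ h₁.2 h₂.2⟩
  smul_mem' c _ h := ⟨h.1.smul c, by rw [H.trace_smul]; exact Submodule.smul_mem _ _ h.2⟩

section FormProperties

variable {H} {Ψ Ψ' Φ : Fun n}

lemma inner2_add_left (h₁ : ∀ α, MemLp (Ψ α) 2 (volume.restrict (Ioo (H.a α) (H.b α))))
    (h₂ : ∀ α, MemLp (Ψ' α) 2 (volume.restrict (Ioo (H.a α) (H.b α))))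
    (h₃ : ∀ α, MemLp (Φ α) 2 (volume.restrict (Ioo (H.a α) (H.b α)))) :
    H.inner2 (Ψ + Ψ') Φ = H.inner2 Ψ Φ + H.inner2 Ψ' Φ := by
  simp only [inner2_eq, ← Finset.sum_add_distrib, Pi.add_apply]
  exact Finset.sum_congr rfl fun α _ =>
    weightedInner_add_left (H.a_lt_b α).le (H.continuousOn_sqrt α) (h₁ α) (h₂ α) (h₃ α)

lemma inner2_smul_left (c : ℂ) : H.inner2 (c • Ψ) Φ = (starRingEnd ℂ) c * H.inner2 Ψ Φ := by
  simp only [inner2_eq, Finset.mul_sum, Pi.smul_apply]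
  exact Finset.sum_congr rfl fun α _ => weightedInner_smul_left c

lemma inner2_conj_symm : (starRingEnd ℂ) (H.inner2 Ψ Φ) = H.inner2 Φ Ψ := by
  simp only [inner2_eq, map_sum, weightedInner_conj_symm]

lemma energy_conj_symm : (starRingEnd ℂ) (H.energy Ψ Φ) = H.energy Φ Ψ := by
  simp only [energy_eq, map_sum, weightedInner_conj_symm]

lemma IsH1.memLp (h : H.IsH1 Φ) (α : Fin n) :
    MemLp (Φ α) 2 (volume.restrict (Ioo (H.a α) (H.b α))) := (h α).memLp_self

lemma IsH1.memLp_D (h : H.IsH1 Φ) (α : Fin n) :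
    MemLp (H.D Φ α) 2 (volume.restrict (Ioo (H.a α) (H.b α))) := (h α).memLp

lemma form_add_left (c : ℝ) (h₁ : H.IsH1 Ψ) (h₂ : H.IsH1 Ψ') (h₃ : H.IsH1 Φ) :
    H.form U c (Ψ + Ψ') Φ = H.form U c Ψ Φ + H.form U c Ψ' Φ := by
  have e1 : H.energy (Ψ + Ψ') Φ = H.energy Ψ Φ + H.energy Ψ' Φ := by
    simp only [energy_eq, ← Finset.sum_add_distrib]
    refine Finset.sum_congr rfl fun α _ => ?_
    rw [← weightedInner_add_left (H.a_lt_b α).le (H.continuousOn_inv_sqrt α) (h₁.memLp_D α)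
      (h₂.memLp_D α) (h₃.memLp_D α)]
    exact weightedInner_congr (H.a_lt_b α).le ((h₁ α).weakDeriv_add (h₂ α) (H.a_lt_b α))
      (ae_eq_refl _)
  have e2 : H.inner2 (Ψ + Ψ') (H.potMul Φ)
      = H.inner2 Ψ (H.potMul Φ) + H.inner2 Ψ' (H.potMul Φ) := by
    simp only [inner2_potMul_eq, ← Finset.sum_add_distrib, Pi.add_apply]
    exact Finset.sum_congr rfl fun α _ => weightedInner_add_left (H.a_lt_b α).le
      (H.continuousOn_potential α) (h₁.memLp α) (h₂.memLp α) (h₃.memLp α)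
  rw [form, e1, e2, H.trace_add, bdryInner_add_left, inner2_add_left h₁.memLp h₂.memLp h₃.memLp,
    form, form]
  ring

lemma form_smul_left (c : ℝ) (z : ℂ) (h : H.IsH1 Ψ) :
    H.form U c (z • Ψ) Φ = (starRingEnd ℂ) z * H.form U c Ψ Φ := by
  have e1 : H.energy (z • Ψ) Φ = (starRingEnd ℂ) z * H.energy Ψ Φ := by
    simp only [energy_eq, Finset.mul_sum]
    refine Finset.sum_congr rfl fun α _ => ?_
    rw [← weightedInner_smul_left]
    exact weightedInner_congr (H.a_lt_b α).le ((h α).weakDeriv_const_smul z (H.a_lt_b α))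
      (ae_eq_refl _)
  rw [form, e1, H.trace_smul, bdryInner_smul_left, inner2_smul_left, inner2_smul_left, form]
  ring

lemma form_conj_symm (c : ℝ) (h₁ : H.trace Ψ ∈ bdryRange U) (h₂ : H.trace Φ ∈ bdryRange U) :
    (starRingEnd ℂ) (H.form U c Φ Ψ) = H.form U c Ψ Φ := by
  have e2 : (starRingEnd ℂ) (H.inner2 Φ (H.potMul Ψ)) = H.inner2 Ψ (H.potMul Φ) := by
    simp only [inner2_potMul_eq, map_sum, weightedInner_conj_symm]
  rw [form, map_add, map_add, map_sub, map_mul, e2, energy_conj_symm, inner2_conj_symm,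
    Complex.conj_ofReal, bdryInner_bdryMap_symm h₂ h₁, form]

variable (H) in
/-- The sum of the squares of the `L²` norms of the derivatives. -/
noncomputable def derivSq (Φ : Fun n) : ℝ := ∑ α, normSq (H.a α) (H.b α) (H.D Φ α)

variable (H) in
/-- The sum of the squares of the `L²` norms of the components. -/
noncomputable def valueSq (Φ : Fun n) : ℝ := ∑ α, normSq (H.a α) (H.b α) (Φ α)

lemma derivSq_nonneg (Φ : Fun n) : 0 ≤ H.derivSq Φ :=
  Finset.sum_nonneg fun α _ => normSq_nonneg (H.a_lt_b α).le _

lemma valueSq_nonneg (Φ : Fun n) : 0 ≤ H.valueSq Φ :=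
  Finset.sum_nonneg fun α _ => normSq_nonneg (H.a_lt_b α).le _

lemma normSq_le_derivSq (Φ : Fun n) (α : Fin n) :
    normSq (H.a α) (H.b α) (H.D Φ α) ≤ H.derivSq Φ :=
  Finset.single_le_sum (f := fun α => normSq (H.a α) (H.b α) (H.D Φ α))
    (fun α _ => normSq_nonneg (H.a_lt_b α).le _) (Finset.mem_univ α)

lemma normSq_le_valueSq (Φ : Fun n) (α : Fin n) :
    normSq (H.a α) (H.b α) (Φ α) ≤ H.valueSq Φ :=
  Finset.single_le_sum (f := fun α => normSq (H.a α) (H.b α) (Φ α))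
    (fun α _ => normSq_nonneg (H.a_lt_b α).le _) (Finset.mem_univ α)

variable (H) in
lemma exists_form_bounds : ∃ M, 0 < M ∧
    (∀ Φ, H.IsH1 Φ → M⁻¹ * H.derivSq Φ ≤ (H.energy Φ Φ).re ∧ (H.energy Φ Φ).re ≤ M * H.derivSq Φ)
    ∧ (∀ Φ : Fun n, (∀ α, MemLp (Φ α) 2 (volume.restrict (Ioo (H.a α) (H.b α)))) →
      M⁻¹ * H.valueSq Φ ≤ (H.inner2 Φ Φ).re ∧ (H.inner2 Φ Φ).re ≤ M * H.valueSq Φ ∧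
      -(M * H.valueSq Φ) ≤ (H.inner2 Φ (H.potMul Φ)).re ∧
      (H.inner2 Φ (H.potMul Φ)).re ≤ M * H.valueSq Φ) := by
  obtain ⟨M, hM, hb⟩ := H.exists_bound
  refine ⟨M, hM, fun Φ h => ⟨?_, ?_⟩, fun Φ h => ⟨?_, ?_, ?_, ?_⟩⟩
  · rw [energy_eq, Complex.re_sum, derivSq, Finset.mul_sum]
    refine Finset.sum_le_sum fun α _ => le_weightedInner_self (H.a_lt_b α).le
      (H.continuousOn_inv_sqrt α) (h.memLp_D α) fun x hx => ?_
    exact inv_anti₀ (H.sqrt_pos α hx) (hb α x hx).1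
  · rw [energy_eq, Complex.re_sum, derivSq, Finset.mul_sum]
    exact Finset.sum_le_sum fun α _ => weightedInner_self_le (H.a_lt_b α).le
      (H.continuousOn_inv_sqrt α) (h.memLp_D α) fun x hx => (hb α x hx).2.1
  · rw [inner2_eq, Complex.re_sum, valueSq, Finset.mul_sum]
    refine Finset.sum_le_sum fun α _ => le_weightedInner_self (H.a_lt_b α).le
      (H.continuousOn_sqrt α) (h α) fun x hx => ?_
    exact inv_le_of_inv_le₀ (H.sqrt_pos α hx) (hb α x hx).2.1
  · rw [inner2_eq, Complex.re_sum, valueSq, Finset.mul_sum]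
    exact Finset.sum_le_sum fun α _ => weightedInner_self_le (H.a_lt_b α).le
      (H.continuousOn_sqrt α) (h α) fun x hx => (hb α x hx).1
  · rw [inner2_potMul_eq, Complex.re_sum, valueSq, Finset.mul_sum, ← Finset.sum_neg_distrib]
    refine Finset.sum_le_sum fun α _ => ?_
    rw [← neg_mul]
    exact le_weightedInner_self (H.a_lt_b α).le
      (H.continuousOn_potential α) (h α) fun x hx => (abs_le.1 (hb α x hx).2.2).1
  · rw [inner2_potMul_eq, Complex.re_sum, valueSq, Finset.mul_sum]
    exact Finset.sum_le_sum fun α _ => weightedInner_self_le (H.a_lt_b α).le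
      (H.continuousOn_potential α) (h α) fun x hx => (abs_le.1 (hb α x hx).2.2).2

variable (H) in
-- The trace inequality on a subinterval of length `δ` at each endpoint. Since `δ` is free, the
-- derivatives can be given as small a coefficient as desired, at the price of a large coefficient
-- for the values.
lemma exists_trace_bound : ∃ δ₀, 0 < δ₀ ∧ ∀ δ, 0 < δ → δ ≤ δ₀ → ∀ Φ, H.IsH1 Φ →
    ‖H.trace Φ‖ ^ 2 ≤ 2 / δ * H.valueSq Φ + 2 * δ * H.derivSq Φ := by
  obtain ⟨K, hK, hb⟩ := exists_forall_le fun α => (H.b α - H.a α)⁻¹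
  refine ⟨K⁻¹, inv_pos.2 hK, fun δ hδ hδ' Φ h => ?_⟩
  have hlen : ∀ α, δ ≤ H.b α - H.a α := fun α =>
    hδ'.trans (inv_le_of_inv_le₀ (sub_pos.2 (H.a_lt_b α)) (hb α))
  set X := 2 / δ * H.valueSq Φ + 2 * δ * H.derivSq Φ with hX
  have hX0 : 0 ≤ X := by
    have := H.valueSq_nonneg Φ; have := H.derivSq_nonneg Φ; positivity
  have key : ∀ α (z : ℂ), δ * ‖z‖ ^ 2 ≤ 2 * normSq (H.a α) (H.b α) (Φ α)
      + 2 * δ ^ 2 * normSq (H.a α) (H.b α) (H.D Φ α) → ‖z‖ ^ 2 ≤ X := by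
    intro α z hz
    refine le_of_mul_le_mul_left (hz.trans ?_) hδ
    have h1 : δ * X = 2 * H.valueSq Φ + 2 * δ ^ 2 * H.derivSq Φ := by
      rw [hX]; field_simp
    rw [h1]
    have := H.normSq_le_valueSq Φ α
    have := H.normSq_le_derivSq Φ α
    gcongr
  rw [← Real.sqrt_le_sqrt_iff hX0, Real.sqrt_sq (norm_nonneg _),
    pi_norm_le_iff_of_nonneg (Real.sqrt_nonneg _)]
  intro l
  refine Real.le_sqrt_of_sq_le ?_
  rcases l with α | α
  · refine key α _ ?_
    have h1 := (h α).norm_sq_le (H.a_lt_b α) (c := H.a α) (d := H.a α + δ) (x := H.a α) le_rfl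
      (by linarith [hlen α]) (by linarith) ⟨le_rfl, by linarith⟩
    rwa [add_sub_cancel_left] at h1
  · refine key α _ ?_
    have h1 := (h α).norm_sq_le (H.a_lt_b α) (c := H.b α - δ) (d := H.b α) (x := H.b α)
      (by linarith [hlen α]) le_rfl (by linarith) ⟨by linarith, le_rfl⟩
    rwa [sub_sub_cancel] at h1

variable (H) in
/-- The form is bounded below. -/
lemma exists_shift : ∃ c : ℝ, ∃ κ, 0 < κ ∧ ∀ Φ, H.IsH1 Φ →
    κ * (H.derivSq Φ + H.valueSq Φ) ≤ (H.form U c Φ Φ).re := by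
  obtain ⟨M, hM, h1, h2⟩ := H.exists_form_bounds
  obtain ⟨δ₀, hδ₀, h3⟩ := H.exists_trace_bound
  obtain ⟨C, hC, h4⟩ := exists_bdryMap_bound U
  -- With this `δ` the boundary term consumes at most half of the lower bound `M⁻¹` of the energy;
  -- `C + 1` guards against `C = 0`.
  set δ := min δ₀ (M⁻¹ / (4 * (C + 1))) with hδ
  have hδ0 : 0 < δ := lt_min hδ₀ (by positivity)
  have hCδ : C * (2 * δ) ≤ M⁻¹ / 2 := by
    calc C * (2 * δ) ≤ (C + 1) * (2 * (M⁻¹ / (4 * (C + 1)))) := by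
          gcongr
          · linarith
          · exact min_le_right _ _
      _ = M⁻¹ / 2 := by field_simp; norm_num
  -- The shift, multiplied by the lower bound `M⁻¹` of the L² weight, pays for the potential (`M`)
  -- and for the value part of the trace (`C * (2 / δ)`), and leaves `M⁻¹ / 2`.
  refine ⟨M * (M + C * (2 / δ) + M⁻¹ / 2), M⁻¹ / 2, by positivity, fun Φ h => ?_⟩
  set c := M * (M + C * (2 / δ) + M⁻¹ / 2) with hc
  have hc0 : 0 ≤ c := by positivity
  have hcM : c * M⁻¹ = M + C * (2 / δ) + M⁻¹ / 2 := by rw [hc]; field_simp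
  have e1 := (h1 Φ h).1
  obtain ⟨e2, -, e3, -⟩ := h2 Φ h.memLp
  have e4 : (bdryInner (H.trace Φ) (bdryMap U (H.trace Φ))).re
      ≤ C * (2 / δ * H.valueSq Φ + 2 * δ * H.derivSq Φ) := by
    refine (Complex.re_le_norm _).trans ((h4 _ _).trans ?_)
    rw [← pow_two]
    exact mul_le_mul_of_nonneg_left (h3 δ hδ0 (min_le_left _ _) Φ h) hC
  have e5 := mul_le_mul_of_nonneg_left e2 hc0
  have e6 := mul_le_mul_of_nonneg_right hCδ (H.derivSq_nonneg Φ)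
  rw [← mul_assoc, hcM] at e5
  rw [form, Complex.add_re, Complex.add_re, Complex.sub_re, Complex.re_ofReal_mul]
  nlinarith

lemma exists_form_le (c : ℝ) : ∃ K, 0 ≤ K ∧ ∀ Φ, H.IsH1 Φ →
    (H.form U c Φ Φ).re ≤ K * (H.derivSq Φ + H.valueSq Φ) := by
  obtain ⟨M, hM, h1, h2⟩ := H.exists_form_bounds
  obtain ⟨δ, hδ, h3⟩ := H.exists_trace_bound
  obtain ⟨C, hC, h4⟩ := exists_bdryMap_bound U
  refine ⟨M + C * (2 / δ + 2 * δ) + |c| * M, by positivity, fun Φ h => ?_⟩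
  have e1 := (h1 Φ h).2
  obtain ⟨e2', e2, -, e3⟩ := h2 Φ h.memLp
  have hv := H.valueSq_nonneg Φ
  have hd := H.derivSq_nonneg Φ
  have e4 : -(bdryInner (H.trace Φ) (bdryMap U (H.trace Φ))).re
      ≤ C * (2 / δ * H.valueSq Φ + 2 * δ * H.derivSq Φ) := by
    refine (neg_le_abs _).trans ((Complex.abs_re_le_norm _).trans ((h4 _ _).trans ?_))
    rw [← pow_two]
    exact mul_le_mul_of_nonneg_left (h3 δ hδ le_rfl Φ h) hC
  have e5 : c * (H.inner2 Φ Φ).re ≤ |c| * (M * H.valueSq Φ) := by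
    have h0 : 0 ≤ (H.inner2 Φ Φ).re := le_trans (by positivity) e2'
    exact mul_le_mul (le_abs_self c) e2 h0 (abs_nonneg c)
  rw [form, Complex.add_re, Complex.add_re, Complex.sub_re, Complex.re_ofReal_mul]
  have e6 : 0 ≤ C * (2 / δ) * H.derivSq Φ := by positivity
  have e7 : 0 ≤ C * (2 * δ) * H.valueSq Φ := by positivity
  have e8 : 0 ≤ |c| * M * H.derivSq Φ := by positivity
  nlinarith

end FormProperties

end Operator
end SchrodingerFEM

/-! ### The form domain and its compact embedding into L² -/

namespace SchrodingerFEM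

/-- A bounded sequence of uniformly Hölder continuous functions has a uniformly Cauchy
subsequence. -/
lemma exists_subseq_uniformCauchy {a b : ℝ} {f : ℕ → ℝ → ℂ} {B K : ℝ}
    (hb : ∀ k, ∀ x ∈ Icc a b, ‖f k x‖ ≤ B)
    (hh : ∀ k, ∀ x ∈ Icc a b, ∀ y ∈ Icc a b, ‖f k y - f k x‖ ^ 2 ≤ |y - x| * K) :
    ∃ φ : ℕ → ℕ, StrictMono φ ∧ ∀ ε > 0, ∃ N, ∀ k ≥ N, ∀ l ≥ N, ∀ x ∈ Icc a b,
      ‖f (φ k) x - f (φ l) x‖ ≤ ε := by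
  have hle : ∀ k (x y : Icc a b), dist (f k x) (f k y) ≤ Real.sqrt (dist x y * K) := by
    intro k x y
    refine Real.le_sqrt_of_sq_le ?_
    rw [dist_eq_norm, Subtype.dist_eq, Real.dist_eq]
    exact hh k y y.2 x x.2
  have hmod : Tendsto (fun t : ℝ => Real.sqrt (t * K)) (𝓝 0) (𝓝 0) := by
    have : Continuous fun t : ℝ => Real.sqrt (t * K) := by fun_prop
    simpa using this.tendsto 0
  have hc : ∀ k, Continuous fun x : Icc a b => f k x := fun k =>
    continuous_iff_continuousAt.2 fun x => tendsto_iff_dist_tendsto_zero.2 <|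
      squeeze_zero (fun _ => dist_nonneg) (fun y => hle k y x)
        (hmod.comp (tendsto_iff_dist_tendsto_zero.1 tendsto_id))
  let F : ℕ → BoundedContinuousFunction (Icc a b) ℂ := fun k =>
    BoundedContinuousFunction.mkOfCompact ⟨_, hc k⟩
  have hcomp : IsCompact (closure (Set.range F)) := by
    refine BoundedContinuousFunction.arzela_ascoli (Metric.closedBall 0 B)
      (isCompact_closedBall _ _) _ ?_ ?_
    · rintro _ x ⟨k, rfl⟩
      rw [mem_closedBall_zero_iff]
      exact hb k x x.2
    · refine Metric.equicontinuous_of_continuity_modulus _ hmod _ ?_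
      rintro x y ⟨_, k, rfl⟩
      exact hle k x y
  obtain ⟨g, -, φ, hφ, hlim⟩ := hcomp.tendsto_subseq fun k => subset_closure (mem_range_self k)
  refine ⟨φ, hφ, fun ε hε => ?_⟩
  obtain ⟨N, hN⟩ := Metric.cauchySeq_iff.1 hlim.cauchySeq ε hε
  refine ⟨N, fun k hk l hl x hx => ?_⟩
  have := (BoundedContinuousFunction.dist_coe_le_dist (f := F (φ k)) (g := F (φ l)) ⟨x, hx⟩).trans
    (hN k hk l hl).le
  rwa [dist_eq_norm] at this

lemma norm_sq_eq_integral {a b : ℝ} (hab : a ≤ b) {f : ℝ → ℂ}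
    (hf : MemLp f 2 (volume.restrict (Ioo a b))) : ‖hf.toLp f‖ ^ 2 = normSq a b f := by
  have h := inner_self_eq_ofReal (hf.toLp f)
  rw [L2.inner_def] at h
  have h2 : ∫ x in Ioo a b, inner ℂ (hf.toLp f x) (hf.toLp f x) = ((normSq a b f : ℝ) : ℂ) := by
    rw [normSq, intervalIntegral.integral_of_le hab, integral_Ioc_eq_integral_Ioo,
      ← integral_complex_ofReal]
    refine integral_congr_ae ?_
    filter_upwards [hf.coeFn_toLp] with x hx
    rw [hx, inner_self_eq_ofReal]
  rw [h2] at h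
  exact_mod_cast h.symm

namespace Operator

variable {n : ℕ} (H : Operator n) (U : Matrix.unitaryGroup (Bdry n) ℂ)

/-- A shift that makes the form coercive. -/
noncomputable def shift : ℝ := (H.exists_shift U).choose

lemma exists_coercive : ∃ κ, 0 < κ ∧ ∀ Φ, H.IsH1 Φ →
    κ * (H.derivSq Φ + H.valueSq Φ) ≤ (H.form U (H.shift U) Φ Φ).re :=
  (H.exists_shift U).choose_spec

/-- The form domain, with the inner product given by the shifted form. -/
def FormSpace : Type := H.h1Space U

instance : AddCommGroup (H.FormSpace U) := inferInstanceAs (AddCommGroup (H.h1Space U))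

instance : Module ℂ (H.FormSpace U) := inferInstanceAs (Module ℂ (H.h1Space U))

/-- The linear inclusion of the form domain into the space of all functions. -/
def FormSpace.toFun : H.FormSpace U →ₗ[ℂ] Fun n := (H.h1Space U).subtype

variable {H U} in
lemma FormSpace.isH1 (u : H.FormSpace U) : H.IsH1 (FormSpace.toFun H U u) :=
  (show H.h1Space U from u).2.1

variable {H U} in
lemma FormSpace.trace_mem (u : H.FormSpace U) :
    H.trace (FormSpace.toFun H U u) ∈ bdryRange U :=
  (show H.h1Space U from u).2.2

/-- The semi-inner product on the form domain. -/
noncomputable abbrev formCore : PreInnerProductSpace.Core ℂ (H.FormSpace U) where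
  inner u v := H.form U (H.shift U) (FormSpace.toFun H U u) (FormSpace.toFun H U v)
  conj_inner_symm u v := form_conj_symm U _ u.trace_mem v.trace_mem
  re_inner_nonneg u := by
    obtain ⟨κ, hκ, h⟩ := H.exists_coercive U
    refine le_trans ?_ (h _ u.isH1)
    have := H.derivSq_nonneg (FormSpace.toFun H U u)
    have := H.valueSq_nonneg (FormSpace.toFun H U u)
    positivity
  add_left u v w := by
    rw [map_add]; exact form_add_left U _ u.isH1 v.isH1 w.isH1
  smul_left u v z := by
    rw [map_smul]; exact form_smul_left U _ z u.isH1

/-- Only a seminorm, because members of `Fun n` live on the whole line and their values off the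
intervals are not seen. This is why the abstract theory works with seminorms. -/
noncomputable instance : SeminormedAddCommGroup (H.FormSpace U) :=
  @InnerProductSpace.Core.toSeminormedAddCommGroup ℂ _ _ _ _ (H.formCore U)

noncomputable instance : InnerProductSpace ℂ (H.FormSpace U) :=
  InnerProductSpace.ofCore (H.formCore U)

lemma FormSpace.inner_def (u v : H.FormSpace U) :
    inner ℂ u v = H.form U (H.shift U) (FormSpace.toFun H U u) (FormSpace.toFun H U v) := rfl

lemma FormSpace.norm_sq (u : H.FormSpace U) : ‖u‖ ^ 2 =
    (H.form U (H.shift U) (FormSpace.toFun H U u) (FormSpace.toFun H U u)).re := by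
  rw [← FormSpace.inner_def, inner_self_eq_ofReal, Complex.ofReal_re]

/-- The square integrable functions on the manifold. -/
def l2Space : Submodule ℂ (Fun n) where
  carrier := {Φ | ∀ α, MemLp (Φ α) 2 (volume.restrict (Ioo (H.a α) (H.b α)))}
  zero_mem' := fun _ => MemLp.zero
  add_mem' h₁ h₂ := fun α => (h₁ α).add (h₂ α)
  smul_mem' c _ h := fun α => (h α).const_smul c

/-- The square integrable functions, with the inner product `inner2`. -/
def L2Space : Type := H.l2Space

instance : AddCommGroup H.L2Space := inferInstanceAs (AddCommGroup H.l2Space)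

instance : Module ℂ H.L2Space := inferInstanceAs (Module ℂ H.l2Space)

/-- The linear inclusion into the space of all functions. -/
def L2Space.toFun : H.L2Space →ₗ[ℂ] Fun n := H.l2Space.subtype

variable {H} in
lemma L2Space.memLp (u : H.L2Space) (α : Fin n) :
    MemLp (L2Space.toFun H u α) 2 (volume.restrict (Ioo (H.a α) (H.b α))) :=
  (show H.l2Space from u).2 α

/-- The semi-inner product on the square integrable functions. -/
noncomputable abbrev l2Core : PreInnerProductSpace.Core ℂ H.L2Space where
  inner u v := H.inner2 (L2Space.toFun H u) (L2Space.toFun H v)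
  conj_inner_symm u v := inner2_conj_symm
  re_inner_nonneg u := by
    obtain ⟨M, hM, -, h⟩ := H.exists_form_bounds
    refine le_trans ?_ (h _ u.memLp).1
    have := H.valueSq_nonneg (L2Space.toFun H u)
    positivity
  add_left u v w := by
    rw [map_add]; exact inner2_add_left u.memLp v.memLp w.memLp
  smul_left u v z := by
    rw [map_smul]; exact inner2_smul_left z

noncomputable instance : SeminormedAddCommGroup H.L2Space :=
  @InnerProductSpace.Core.toSeminormedAddCommGroup ℂ _ _ _ _ H.l2Core

noncomputable instance : InnerProductSpace ℂ H.L2Space :=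
  InnerProductSpace.ofCore H.l2Core

lemma L2Space.inner_def (u v : H.L2Space) :
    inner ℂ u v = H.inner2 (L2Space.toFun H u) (L2Space.toFun H v) := rfl

lemma L2Space.norm_sq (u : H.L2Space) :
    ‖u‖ ^ 2 = (H.inner2 (L2Space.toFun H u) (L2Space.toFun H u)).re := by
  rw [← L2Space.inner_def, inner_self_eq_ofReal, Complex.ofReal_re]

/-- The embedding of the form domain into `L²`. -/
def embed : H.FormSpace U →ₗ[ℂ] H.L2Space :=
  LinearMap.codRestrict H.l2Space (FormSpace.toFun H U) fun u => u.isH1.memLp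

lemma inner_embed (u v : H.FormSpace U) : inner ℂ (H.embed U u) (H.embed U v)
    = H.inner2 (FormSpace.toFun H U u) (FormSpace.toFun H U v) := rfl

lemma norm_sq_embed (u : H.FormSpace U) : ‖H.embed U u‖ ^ 2
    = (H.inner2 (FormSpace.toFun H U u) (FormSpace.toFun H U u)).re := L2Space.norm_sq _ _

/-- Equivalence of the norm of the form domain and the Sobolev norm. -/
lemma exists_norm_equiv : ∃ κ K, 0 < κ ∧ 0 ≤ K ∧ ∀ u : H.FormSpace U,
    κ * (H.derivSq (FormSpace.toFun H U u) + H.valueSq (FormSpace.toFun H U u)) ≤ ‖u‖ ^ 2 ∧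
    ‖u‖ ^ 2 ≤ K * (H.derivSq (FormSpace.toFun H U u) + H.valueSq (FormSpace.toFun H U u)) := by
  obtain ⟨κ, hκ, h⟩ := H.exists_coercive U
  obtain ⟨K, hK, h'⟩ := exists_form_le (H := H) U (H.shift U)
  refine ⟨κ, K, hκ, hK, fun u => ?_⟩
  rw [FormSpace.norm_sq]
  exact ⟨h _ u.isH1, h' _ u.isH1⟩

variable {H} in
-- A Poincaré inequality: one boundary value per component and the derivative control the function.
lemma valueSq_le_of_isH1 {Φ : Fun n} (h : H.IsH1 Φ) {t : ℝ} (ht : ∀ α, ‖Φ α (H.a α)‖ ^ 2 ≤ t) :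
    H.valueSq Φ ≤ (∑ α, (H.b α - H.a α)) * (2 * t)
      + (∑ α, (H.b α - H.a α) * (2 * (H.b α - H.a α))) * H.derivSq Φ := by
  rw [valueSq, Finset.sum_mul, Finset.sum_mul, ← Finset.sum_add_distrib]
  refine Finset.sum_le_sum fun α _ => ?_
  have hab := H.a_lt_b α
  refine (normSq_le_of_norm_le hab.le (h α).1 fun x hx =>
    (h α).norm_le_sqrt hab hx).trans ?_
  have h1 := ht α
  have h2 : normSq (H.a α) (H.b α) (weakDeriv (H.a α) (H.b α) (Φ α)) ≤ H.derivSq Φ :=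
    H.normSq_le_derivSq Φ α
  have h3 : 0 < H.b α - H.a α := sub_pos.2 hab
  calc _ ≤ (H.b α - H.a α) * (2 * t + 2 * (H.b α - H.a α) * H.derivSq Φ) := by gcongr
    _ = _ := by ring

lemma embed_bound : ∃ C, 0 ≤ C ∧ ∀ v : H.FormSpace U, ‖H.embed U v‖ ≤ C * ‖v‖ := by
  obtain ⟨κ, K, hκ, -, hn⟩ := H.exists_norm_equiv U
  obtain ⟨M, hM, -, hb⟩ := H.exists_form_bounds
  refine ⟨Real.sqrt (M / κ), Real.sqrt_nonneg _, fun v => ?_⟩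
  refine le_of_sq_le_sq ?_ (by positivity)
  rw [mul_pow, Real.sq_sqrt (by positivity), norm_sq_embed]
  refine (hb _ v.isH1.memLp).2.1.trans ?_
  rw [div_mul_eq_mul_div, le_div_iff₀ hκ]
  have h1 := (hn v).1
  have h2 := H.derivSq_nonneg (FormSpace.toFun H U v)
  nlinarith [mul_nonneg hκ.le h2]

variable {H} in
lemma eqOn_zero_of_inner2_eq_zero {Φ : Fun n}
    (hΦ : ∀ α, ContinuousOn (Φ α) (Icc (H.a α) (H.b α))) (h : (H.inner2 Φ Φ).re = 0) (α : Fin n) :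
    EqOn (Φ α) 0 (Icc (H.a α) (H.b α)) := by
  obtain ⟨M, hM, -, hb⟩ := H.exists_form_bounds
  have h1 := (hb Φ fun α => memLp_two_of_continuousOn (hΦ α)).1
  rw [h] at h1
  have h2 : H.valueSq Φ ≤ 0 := by
    by_contra hn
    have : 0 < M⁻¹ * H.valueSq Φ := mul_pos (inv_pos.2 hM) (not_le.1 hn)
    linarith
  refine eqOn_zero_of_normSq_eq_zero (H.a_lt_b α) (hΦ α) (le_antisymm ?_ (normSq_nonneg
    (H.a_lt_b α).le _))
  exact (H.normSq_le_valueSq Φ α).trans h2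

/-- By continuity, vanishing in L² means vanishing on the manifold; then the derivative, and with it
the form norm, is zero. -/
lemma embed_ker (v : H.FormSpace U) (hv : ‖H.embed U v‖ = 0) : ‖v‖ = 0 := by
  obtain ⟨κ, K, -, hK, hn⟩ := H.exists_norm_equiv U
  have h1 := norm_sq_embed H U v
  rw [hv] at h1
  have h2 : ∀ α, EqOn (FormSpace.toFun H U v α) 0 (Icc (H.a α) (H.b α)) :=
    eqOn_zero_of_inner2_eq_zero (fun α => (v.isH1 α).1) (by rw [← h1]; norm_num)
  have h3 : H.derivSq (FormSpace.toFun H U v) = 0 := by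
    refine Finset.sum_eq_zero fun α _ => ?_
    have hab := H.a_lt_b α
    have h4 : H.D (FormSpace.toFun H U v) α =ᵐ[volume.restrict (Ioo (H.a α) (H.b α))] 0 := by
      refine (v.isH1 α).weakDeriv_ae_eq hab ?_
      rw [ae_restrict_iff' measurableSet_Ioo]
      refine Eventually.of_forall fun x hx => ?_
      refine (hasDerivAt_const x (0 : ℂ)).congr_of_eventuallyEq ?_
      filter_upwards [Icc_mem_nhds hx.1 hx.2] with y hy using h2 α hy
    rw [normSq_congr hab.le h4]
    simp [normSq]
  have h5 : H.valueSq (FormSpace.toFun H U v) = 0 := by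
    refine Finset.sum_eq_zero fun α _ => ?_
    have hab := H.a_lt_b α
    refine le_antisymm ?_ (normSq_nonneg hab.le _)
    refine (normSq_le_of_norm_le hab.le (v.isH1 α).1 (C := 0) fun x hx => ?_).trans_eq (mul_zero _)
    rw [h2 α hx]; simp
  have h6 := (hn v).2
  rw [h3, h5, add_zero, mul_zero] at h6
  exact pow_eq_zero_iff (two_ne_zero) |>.1 (le_antisymm h6 (by positivity))

lemma embed_compact (v : ℕ → H.FormSpace U) (hv : ∃ C, ∀ k, ‖v k‖ ≤ C) :
    ∃ φ : ℕ → ℕ, StrictMono φ ∧ CauchySeq fun k => H.embed U (v (φ k)) := by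
  obtain ⟨κ, K, hκ, -, hn⟩ := H.exists_norm_equiv U
  obtain ⟨M, hM, -, hb⟩ := H.exists_form_bounds
  obtain ⟨C, hC⟩ := hv
  set f : ℕ → Fun n := fun k => FormSpace.toFun H U (v k) with hf
  set B := C ^ 2 / κ with hB
  have hB' : ∀ k, H.derivSq (f k) + H.valueSq (f k) ≤ B := fun k => by
    rw [hB, le_div_iff₀ hκ, mul_comm]
    exact (hn (v k)).1.trans (pow_le_pow_left₀ (norm_nonneg _) (hC k) 2)
  -- Components are treated one at a time: a uniformly Cauchy sequence stays so on further
  -- subsequences.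
  have hsub : ∀ s : Finset (Fin n), ∃ φ : ℕ → ℕ, StrictMono φ ∧ ∀ α ∈ s, ∀ ε > 0, ∃ N, ∀ k ≥ N,
      ∀ l ≥ N, ∀ x ∈ Icc (H.a α) (H.b α), ‖f (φ k) α x - f (φ l) α x‖ ≤ ε := by
    intro s
    induction s using Finset.induction_on with
    | empty => exact ⟨id, strictMono_id, by simp⟩
    | insert α s _ ih =>
      obtain ⟨φ, hφ, h⟩ := ih
      have hab := H.a_lt_b α
      have hd : ∀ k, normSq (H.a α) (H.b α) (weakDeriv (H.a α) (H.b α) (f k α)) ≤ B := fun k => by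
        have h1 : normSq (H.a α) (H.b α) (weakDeriv (H.a α) (H.b α) (f k α)) ≤ _ :=
          H.normSq_le_derivSq (f k) α
        linarith [hB' k, H.valueSq_nonneg (f k)]
      obtain ⟨ψ, hψ, h'⟩ := exists_subseq_uniformCauchy (a := H.a α) (b := H.b α)
        (f := fun k => f (φ k) α) (K := B)
        (B := Real.sqrt ((2 * B + 2 * (H.b α - H.a α) ^ 2 * B) / (H.b α - H.a α)))
        (fun k x hx => by
          refine Real.le_sqrt_of_sq_le ?_
          rw [le_div_iff₀ (sub_pos.2 hab), mul_comm]
          refine ((v (φ k)).isH1 α |>.norm_sq_le hab le_rfl le_rfl hab.le hx).trans ?_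
          have h1 := hd (φ k)
          have h2 : normSq (H.a α) (H.b α) (f (φ k) α) ≤ B := by
            linarith [hB' (φ k), H.derivSq_nonneg (f (φ k)), H.normSq_le_valueSq (f (φ k)) α]
          gcongr)
        (fun k x hx y hy => by
          refine ((v (φ k)).isH1 α |>.norm_sub_sq_le hab hx hy).trans ?_
          exact mul_le_mul_of_nonneg_left (hd _) (abs_nonneg _))
      refine ⟨φ ∘ ψ, hφ.comp hψ, fun β hβ => ?_⟩
      rcases Finset.mem_insert.1 hβ with rfl | hβ
      · exact h'
      · intro ε hε
        obtain ⟨N, hN⟩ := h β hβ ε hε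
        exact ⟨N, fun k hk l hl => hN _ (hk.trans (hψ.le_apply)) _ (hl.trans hψ.le_apply)⟩
  obtain ⟨φ, hφ, h⟩ := hsub Finset.univ
  refine ⟨φ, hφ, Metric.cauchySeq_iff.2 fun ε hε => ?_⟩
  set L := ∑ α, (H.b α - H.a α) with hL
  have hL0 : 0 ≤ L := Finset.sum_nonneg fun α _ => (sub_pos.2 (H.a_lt_b α)).le
  -- Chosen so that `(M * L + 1) * ε'² = (ε / 2)²`.
  set ε' := ε / (2 * Real.sqrt (M * L + 1)) with hε'
  have hs : 0 < Real.sqrt (M * L + 1) := Real.sqrt_pos.2 (by positivity)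
  have hε0 : 0 < ε' := by positivity
  choose N hN using fun α => h α (Finset.mem_univ α) ε' hε0
  obtain ⟨N', hN'⟩ := (Set.finite_range N).bddAbove
  refine ⟨N', fun k hk l hl => ?_⟩
  have hv1 : H.valueSq (FormSpace.toFun H U (v (φ k) - v (φ l))) ≤ L * ε' ^ 2 := by
    rw [hL, Finset.sum_mul]
    refine Finset.sum_le_sum fun α _ => ?_
    refine normSq_le_of_norm_le (H.a_lt_b α).le ((v (φ k) - v (φ l)).isH1 α).1 fun x hx => ?_
    refine pow_le_pow_left₀ (norm_nonneg _) ?_ 2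
    have := hN α k (le_trans (hN' ⟨α, rfl⟩) hk) l (le_trans (hN' ⟨α, rfl⟩) hl) x hx
    rw [map_sub]
    exact this
  rw [dist_eq_norm, ← map_sub]
  have h1 : ‖H.embed U (v (φ k) - v (φ l))‖ ^ 2 ≤ M * (L * ε' ^ 2) := by
    rw [norm_sq_embed]
    exact (hb _ (v (φ k) - v (φ l)).isH1.memLp).2.1.trans (mul_le_mul_of_nonneg_left hv1 hM.le)
  have h2 : M * (L * ε' ^ 2) ≤ (ε / 2) ^ 2 := by
    have h3 : (M * L + 1) * ε' ^ 2 = (ε / 2) ^ 2 := by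
      rw [hε', div_pow, mul_pow, Real.sq_sqrt (by positivity)]
      field_simp
    rw [← h3]
    nlinarith [sq_nonneg ε']
  have h3 : ‖H.embed U (v (φ k) - v (φ l))‖ ≤ ε / 2 :=
    le_of_sq_le_sq (h1.trans h2) (by positivity)
  linarith

lemma isCompactEmbedding_embed : IsCompactEmbedding (H.embed U) :=
  ⟨H.embed_bound U, H.embed_ker U, H.embed_compact U⟩

end Operator
end SchrodingerFEM

/-! ### Completeness and infinite dimension of the form domain -/

namespace SchrodingerFEM

namespace Operator

variable {n : ℕ} (H : Operator n) (U : Matrix.unitaryGroup (Bdry n) ℂ)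

variable {H U} in
/-- A function in the domain of the form, as a member of the type of the form domain. -/
def FormSpace.mk (Φ : Fun n) (h : Φ ∈ H.h1Space U) : H.FormSpace U :=
  (⟨Φ, h⟩ : H.h1Space U)

variable {H U} in
@[simp] lemma FormSpace.toFun_mk (Φ : Fun n) (h : Φ ∈ H.h1Space U) :
    FormSpace.toFun H U (FormSpace.mk Φ h) = Φ := rfl

variable {H} in
lemma derivSq_congr {Φ : Fun n} {g : Fun n}
    (h : ∀ α, H.D Φ α =ᵐ[volume.restrict (Ioo (H.a α) (H.b α))] g α) :
    H.derivSq Φ = ∑ α, normSq (H.a α) (H.b α) (g α) :=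
  Finset.sum_congr rfl fun α _ => normSq_congr (H.a_lt_b α).le (h α)

/-- In a Cauchy sequence the derivatives converge in L² and the traces in a finite dimensional
space. The limit is the primitive of the limiting derivative with the limiting left endpoint values;
the trace inequality identifies its whole trace, and the range of `1 + U` is closed. -/
instance : CompleteSpace (H.FormSpace U) := by
  refine Metric.complete_of_cauchySeq_tendsto fun v hv => ?_
  obtain ⟨κ, K, hκ, hK, hn⟩ := H.exists_norm_equiv U
  obtain ⟨δ, hδ, htr⟩ := H.exists_trace_bound
  set f : ℕ → Fun n := fun k => FormSpace.toFun H U (v k) with hf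
  have hfH : ∀ k, H.IsH1 (f k) := fun k => (v k).isH1
  have hdist : ∀ k l, H.derivSq (f k - f l) ≤ dist (v k) (v l) ^ 2 / κ ∧
      H.valueSq (f k - f l) ≤ dist (v k) (v l) ^ 2 / κ := by
    intro k l
    have h1 := (hn (v k - v l)).1
    rw [map_sub, ← dist_eq_norm, mul_comm, ← le_div_iff₀ hκ] at h1
    have h2 := H.derivSq_nonneg (f k - f l)
    have h3 := H.valueSq_nonneg (f k - f l)
    constructor <;> linarith
  -- convergence of the derivatives
  have hL : ∀ α, CauchySeq fun k => ((hfH k).memLp_D α).toLp (H.D (f k) α) := by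
    intro α
    rw [Metric.cauchySeq_iff] at hv ⊢
    intro ε hε
    obtain ⟨N, hN⟩ := hv (Real.sqrt κ * ε) (by positivity)
    refine ⟨N, fun k hk l hl => ?_⟩
    rw [dist_eq_norm, ← MemLp.toLp_sub]
    refine lt_of_pow_lt_pow_left₀ 2 hε.le ?_
    have h0 : normSq (H.a α) (H.b α) (H.D (f k) α - H.D (f l) α)
        = normSq (H.a α) (H.b α) (weakDeriv (H.a α) (H.b α) (f k α - f l α)) :=
      (normSq_congr (H.a_lt_b α).le ((hfH k α).weakDeriv_sub (hfH l α) (H.a_lt_b α))).symm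
    rw [norm_sq_eq_integral (H.a_lt_b α).le, h0]
    have h1 : normSq (H.a α) (H.b α) (weakDeriv (H.a α) (H.b α) (f k α - f l α)) ≤ _ :=
      H.normSq_le_derivSq (f k - f l) α
    refine (h1.trans (hdist k l).1).trans_lt ?_
    rw [div_lt_iff₀ hκ]
    calc dist (v k) (v l) ^ 2 < (Real.sqrt κ * ε) ^ 2 :=
          pow_lt_pow_left₀ (hN k hk l hl) dist_nonneg two_ne_zero
      _ = ε ^ 2 * κ := by rw [mul_pow, Real.sq_sqrt hκ.le, mul_comm]
  choose g hg using fun α => cauchySeq_tendsto_of_complete (hL α)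
  -- convergence of the boundary values
  have hT : CauchySeq fun k => H.trace (f k) := by
    rw [Metric.cauchySeq_iff] at hv ⊢
    intro ε hε
    set A := (2 / δ + 2 * δ) / κ with hA
    have hA0 : 0 < A := by positivity
    obtain ⟨N, hN⟩ := hv (ε / Real.sqrt A) (by positivity)
    refine ⟨N, fun k hk l hl => ?_⟩
    rw [dist_eq_norm, ← H.trace_sub]
    refine lt_of_pow_lt_pow_left₀ 2 hε.le ?_
    have h1 := htr δ hδ le_rfl (f k - f l) ((hfH k).sub (hfH l))
    obtain ⟨h2, h3⟩ := hdist k l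
    calc ‖H.trace (f k - f l)‖ ^ 2 ≤ 2 / δ * (dist (v k) (v l) ^ 2 / κ)
          + 2 * δ * (dist (v k) (v l) ^ 2 / κ) := h1.trans (by gcongr)
      _ = A * dist (v k) (v l) ^ 2 := by rw [hA]; ring
      _ < A * (ε / Real.sqrt A) ^ 2 := by
          have := pow_lt_pow_left₀ (hN k hk l hl) dist_nonneg two_ne_zero
          gcongr
      _ = ε ^ 2 := by rw [div_pow, Real.sq_sqrt hA0.le]; field_simp
  obtain ⟨τ, hτ⟩ := cauchySeq_tendsto_of_complete hT
  -- the limit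
  set u : Fun n := fun α x => τ (Sum.inl α) + ∫ t in (H.a α)..x, g α t with hu
  have hgm : ∀ α, MemLp (g α) 2 (volume.restrict (Ioo (H.a α) (H.b α))) := fun α => Lp.memLp _
  have huH : H.IsH1 u := fun α => memH1_of_integral (H.a_lt_b α).le (hgm α)
    fun x _ => by simp [hu]
  have hD : ∀ α, H.D u α =ᵐ[volume.restrict (Ioo (H.a α) (H.b α))] g α := by
    intro α
    have hab := H.a_lt_b α
    refine (huH α).weakDeriv_ae_eq hab ?_
    rw [ae_restrict_iff' measurableSet_Ioo]
    filter_upwards [(intervalIntegrable_of_memLp hab.le (hgm α)).ae_hasDerivAt_integral]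
      with x hx h
    exact (hx (by rw [uIcc_of_le hab.le]; exact Ioo_subset_Icc_self h) _
      left_mem_uIcc).const_add _
  have hder : Tendsto (fun k => H.derivSq (f k - u)) atTop (𝓝 0) := by
    have h1 : ∀ k, H.derivSq (f k - u)
        = ∑ α, ‖((hfH k).memLp_D α).toLp (H.D (f k) α) - g α‖ ^ 2 := by
      intro k
      rw [derivSq_congr (g := fun α => H.D (f k) α - g α)]
      · refine Finset.sum_congr rfl fun α _ => ?_
        rw [← norm_sq_eq_integral (H.a_lt_b α).le (((hfH k).memLp_D α).sub (hgm α)),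
          MemLp.toLp_sub ((hfH k).memLp_D α) (hgm α), Lp.toLp_coeFn (g α) (hgm α)]
      · intro α
        refine ((hfH k α).weakDeriv_sub (huH α) (H.a_lt_b α)).trans ?_
        filter_upwards [hD α] with x hx
        have hx' : weakDeriv (H.a α) (H.b α) (u α) x = g α x := hx
        simp only [Pi.sub_apply, hx']
        rfl
    simp only [h1]
    have h2 := tendsto_finsetSum Finset.univ fun α (_ : α ∈ Finset.univ) =>
      (tendsto_iff_norm_sub_tendsto_zero.1 (hg α)).pow 2
    simpa using h2
  have hval : Tendsto (fun k => H.valueSq (f k - u)) atTop (𝓝 0) := by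
    have h1 : Tendsto (fun k => ‖H.trace (f k) - τ‖) atTop (𝓝 0) :=
      tendsto_iff_norm_sub_tendsto_zero.1 hτ
    refine squeeze_zero (fun k => H.valueSq_nonneg _) (fun k => valueSq_le_of_isH1
      ((hfH k).sub huH) (t := ‖H.trace (f k) - τ‖ ^ 2) fun α => ?_)
      (by simpa using (((h1.pow 2).const_mul 2).const_mul _).add (hder.const_mul _))
    refine pow_le_pow_left₀ (norm_nonneg _) ?_ 2
    have h2 : (f k - u) α (H.a α) = (H.trace (f k) - τ) (Sum.inl α) := by
      simp [hu, trace]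
    rw [h2]
    exact norm_le_pi_norm _ _
  have htru : H.trace u = τ := by
    have h1 : Tendsto (fun k => ‖H.trace (f k) - H.trace u‖ ^ 2) atTop (𝓝 0) := by
      refine squeeze_zero (fun k => by positivity) (fun k => ?_)
        (by simpa using (hval.const_mul (2 / δ)).add (hder.const_mul (2 * δ)))
      rw [← H.trace_sub]
      exact htr δ hδ le_rfl _ ((hfH k).sub huH)
    have h2 : Tendsto (fun k => ‖H.trace (f k) - H.trace u‖) atTop (𝓝 0) := by
      simpa using h1.sqrt
    exact tendsto_nhds_unique (tendsto_iff_norm_sub_tendsto_zero.2 h2) hτ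
  have hmem : u ∈ H.h1Space U := by
    refine ⟨huH, ?_⟩
    rw [htru]
    exact (Submodule.closed_of_finiteDimensional (bdryRange U)).mem_of_tendsto hτ
      (Eventually.of_forall fun k => (v k).trace_mem)
  refine ⟨FormSpace.mk u hmem, tendsto_iff_norm_sub_tendsto_zero.2 ?_⟩
  have h1 : Tendsto (fun k => ‖v k - FormSpace.mk u hmem‖ ^ 2) atTop (𝓝 0) := by
    refine squeeze_zero (fun k => by positivity) (fun k => (hn _).2) ?_
    simp only [map_sub, FormSpace.toFun_mk]
    simpa using (hder.add hval).const_mul K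
  simpa using h1.sqrt

variable {H U} in
lemma FormSpace.eqOn_zero {u : H.FormSpace U} (h : ‖u‖ = 0) (α : Fin n) :
    EqOn (FormSpace.toFun H U u α) 0 (Icc (H.a α) (H.b α)) := by
  obtain ⟨C, -, hC⟩ := H.embed_bound U
  have h1 : ‖H.embed U u‖ = 0 := le_antisymm (by simpa [h] using hC u) (norm_nonneg _)
  have h2 := norm_sq_embed H U u
  rw [h1] at h2
  exact eqOn_zero_of_inner2_eq_zero (fun α => (u.isH1 α).1) (by rw [← h2]; norm_num) α

/-- Polynomials, multiplied by a function that vanishes at the endpoints, as functions on the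
interval number `α`. -/
def polyFun (α : Fin n) : Polynomial ℂ →ₗ[ℂ] Fun n where
  toFun p := Pi.single α fun x => ((x - H.a α) * (H.b α - x) : ℂ) * p.eval (x : ℂ)
  map_add' p q := by
    rw [← Pi.single_add]
    congr 1; ext x
    simp; ring
  map_smul' c p := by
    rw [RingHom.id_apply, ← Pi.single_smul]
    congr 1; ext x
    simp; ring

lemma polyFun_mem (α : Fin n) (p : Polynomial ℂ) : H.polyFun α p ∈ H.h1Space U := by
  refine ⟨fun β => ?_, ?_⟩
  · rcases eq_or_ne β α with rfl | h
    · have : H.polyFun β p β = fun x : ℝ => ((x - H.a β) * (H.b β - x) : ℂ) * p.eval (x : ℂ) := by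
        simp [polyFun]
      rw [this]
      refine memH1_of_contDiffOn (H.a_lt_b β) (ContDiff.contDiffOn ?_)
      have h1 : ContDiff ℝ 1 fun x : ℝ => (x : ℂ) := Complex.ofRealCLM.contDiff
      have h2 : ContDiff ℝ 1 fun x : ℝ => p.eval (x : ℂ) :=
        ((Polynomial.contDiff_aeval p 1 (𝕜 := ℂ) (R := ℂ)).restrict_scalars ℝ).comp h1 
      exact ((h1.sub contDiff_const).mul (contDiff_const.sub h1)).mul h2
    · have : H.polyFun α p β = 0 := by simp [polyFun, Pi.single_eq_of_ne h]
      rw [this]; exact MemH1.zero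
  · have : H.trace (H.polyFun α p) = 0 := by
      ext l
      rcases l with β | β
      · rcases eq_or_ne β α with rfl | h
        · simp [trace, polyFun]
        · simp [trace, polyFun, Pi.single_eq_of_ne h]
      · rcases eq_or_ne β α with rfl | h
        · simp [trace, polyFun]
        · simp [trace, polyFun, Pi.single_eq_of_ne h]
    rw [this]; exact Submodule.zero_mem _

/-- Polynomials multiplied by `(x - a)(b - x)` have trace zero, so they are admissible for every
`U`, and they form an infinite dimensional space on which the seminorm is definite. -/
lemma hasRoom (hn : 1 ≤ n) (k : ℕ) : HasRoom (H.FormSpace U) k := by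
  intro s
  let α : Fin n := ⟨0, hn⟩
  let T : Polynomial ℂ →ₗ[ℂ] H.FormSpace U :=
    LinearMap.codRestrict (H.h1Space U) (H.polyFun α) (H.polyFun_mem U α)
  let f : Polynomial ℂ →ₗ[ℂ] (Fin k → ℂ) :=
    LinearMap.pi fun i => (innerSL ℂ (s i)).toLinearMap ∘ₗ T
  have hker : LinearMap.ker f ≠ ⊥ := by
    intro h
    have h1 : Module.Finite ℂ (Polynomial ℂ) :=
      Module.Finite.of_injective f (LinearMap.ker_eq_bot.1 h)
    exact Polynomial.not_finite h1
  obtain ⟨p, hp, hp0⟩ := (Submodule.ne_bot_iff _).1 hker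
  refine ⟨T p, fun i => congrFun (LinearMap.mem_ker.1 hp) i, fun h => hp0 ?_⟩
  have h1 := FormSpace.eqOn_zero h α
  have hab := H.a_lt_b α
  have hinf : ((fun x : ℝ => (x : ℂ)) '' Ioo (H.a α) (H.b α)).Infinite :=
    (Ioo_infinite hab).image Complex.ofReal_injective.injOn
  refine Polynomial.eq_zero_of_infinite_isRoot p (hinf.mono ?_)
  rintro _ ⟨x, hx, rfl⟩
  have h2 : H.polyFun α p α x = 0 := h1 (Ioo_subset_Icc_self hx)
  simp only [polyFun, LinearMap.coe_mk, AddHom.coe_mk, Pi.single_eq_same] at h2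
  refine (mul_eq_zero.1 h2).resolve_left (mul_ne_zero ?_ ?_)
  · rw [← Complex.ofReal_sub]; exact_mod_cast (sub_pos.2 hx.1).ne'
  · rw [← Complex.ofReal_sub]; exact_mod_cast (sub_pos.2 hx.2).ne'

end Operator
end SchrodingerFEM

/-! ### Regularity of weak solutions and Green's formula -/

namespace SchrodingerFEM

section Regularity

variable {a b : ℝ} {w : ℝ → ℝ} {u v q p : ℝ → ℂ}

lemma hasDerivWithinAt_of_ae_weakDeriv {g : ℝ → ℂ} (hab : a < b) (hu : MemH1 a b u)
    (hg : ContinuousOn g (Icc a b)) (h : weakDeriv a b u =ᵐ[volume.restrict (Ioo a b)] g) :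
    ∀ x ∈ Icc a b, HasDerivWithinAt u (g x) (Icc a b) x := by
  intro x hx
  -- Extending `g` by constants makes the fundamental theorem of calculus applicable at the
  -- endpoints too.
  set G : ℝ → ℂ := IccExtend hab.le (domRestrict (Icc a b) g) with hG
  have hGc : Continuous G := (continuousOn_iff_continuous_domRestrict.1 hg).Icc_extend'
  have hGg : ∀ y ∈ Icc a b, G y = g y := fun y hy => by
    rw [hG, IccExtend_of_mem _ _ hy, domRestrict_apply]
  have h1 : ∀ y ∈ Icc a b, u y = u a + ∫ t in a..y, G t := by
    intro y hy
    rw [hu.eq_integral hab y hy]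
    congr 1
    rw [intervalIntegral.integral_of_le hy.1, intervalIntegral.integral_of_le hy.1,
      ← restrict_Ioo_eq_restrict_Ioc]
    refine integral_congr_ae ?_
    filter_upwards [ae_restrict_of_ae_restrict_of_subset (Ioo_subset_Ioo_right hy.2) h,
      ae_restrict_mem measurableSet_Ioo] with t ht htm
    rw [ht, hGg t ⟨htm.1.le, htm.2.le.trans hy.2⟩]
  have h2 : HasDerivAt (fun y => u a + ∫ t in a..y, G t) (G x) x :=
    (hGc.integral_hasStrictDerivAt a x).hasDerivAt.const_add _
  rw [hGg x hx] at h2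
  exact h2.hasDerivWithinAt.congr h1 (h1 x hx)

lemma weakDeriv_ae_eq_of_hasDerivWithinAt {g : ℝ → ℂ} (hab : a < b) (hu : MemH1 a b u)
    (h : ∀ x ∈ Icc a b, HasDerivWithinAt u (g x) (Icc a b) x) :
    weakDeriv a b u =ᵐ[volume.restrict (Ioo a b)] g := by
  refine hu.weakDeriv_ae_eq hab ?_
  filter_upwards [ae_restrict_mem measurableSet_Ioo] with x hx
  exact (h x (Ioo_subset_Icc_self hx)).hasDerivAt (Icc_mem_nhds hx.1 hx.2)

/-- The equation says that the flux `u' / w` has weak derivative `q`. By du Bois-Reymond it equals a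
continuous primitive `p` of `q` almost everywhere, so `u' = w p` has a continuous version. -/
lemma exists_primitive_of_weak_equation (hab : a < b) (hw : ContinuousOn w (Icc a b))
    (hw0 : ∀ x ∈ Icc a b, 0 < w x) (hu : MemH1 a b u) (hq : ContinuousOn q (Icc a b))
    (h : ∀ φ : ℝ → ℝ, ContDiff ℝ ∞ φ → HasCompactSupport φ → tsupport φ ⊆ Ioo a b →
      weightedInner a b (fun x => (w x)⁻¹) (fun x => ((deriv φ x : ℝ) : ℂ)) (weakDeriv a b u)
        = -∫ x in a..b, φ x • q x) :
    ∃ p : ℝ → ℂ, ContinuousOn p (Icc a b) ∧ (∀ x ∈ Icc a b, p x = p a + ∫ t in a..x, q t) ∧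
      ∀ x ∈ Icc a b, HasDerivWithinAt u (w x * p x) (Icc a b) x := by
  have hwi : ContinuousOn (fun x => (w x)⁻¹) (Icc a b) := hw.inv₀ fun x hx => (hw0 x hx).ne'
  have hqi : IntervalIntegrable q volume a b := hq.intervalIntegrable_of_Icc hab.le
  have hp0 : IntervalIntegrable (fun x => (w x)⁻¹ • weakDeriv a b u x) volume a b := by
    refine (hu.intervalIntegrable hab.le).continuousOn_smul ?_
    rwa [uIcc_of_le hab.le]
  have hwd : HasWeakDeriv a b (fun x => (w x)⁻¹ • weakDeriv a b u x) q := by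
    intro φ h1 h2 h3
    rw [← h φ h1 h2 h3, weightedInner]
    refine intervalIntegral.integral_congr fun x _ => ?_
    simp only [Complex.conj_ofReal, Complex.real_smul]
    ring
  obtain ⟨C, hC⟩ := hwd.ae_eq_integral hab hp0 hqi
  have hpc : ContinuousOn (fun x => C + ∫ t in a..x, q t) (Icc a b) := by
    have := (absolutelyContinuousOnInterval_integral hqi).continuousOn
    rw [uIcc_of_le hab.le] at this
    exact continuousOn_const.add this
  refine ⟨fun x => C + ∫ t in a..x, q t, hpc, fun x _ => by simp, ?_⟩
  refine hasDerivWithinAt_of_ae_weakDeriv (g := fun x => (w x : ℂ) * (C + ∫ t in a..x, q t))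
    hab hu ((Complex.continuous_ofReal.comp_continuousOn hw).mul hpc) ?_
  rw [Filter.EventuallyEq, ae_restrict_iff' measurableSet_Ioo]
  filter_upwards [hC] with x hx hxm
  have h0 : (w x : ℂ) ≠ 0 := by exact_mod_cast (hw0 x (Ioo_subset_Icc_self hxm)).ne'
  rw [← hx hxm, Complex.real_smul, Complex.ofReal_inv, mul_inv_cancel_left₀ h0]

/-- Integration by parts of `conj v` against the flux `p`. Working with the flux avoids
differentiating the weight, and `v` need only be in H¹. -/
lemma weightedInner_weakDeriv_eq (hab : a < b)
    (hw0 : ∀ x ∈ Icc a b, 0 < w x) (hu : MemH1 a b u) (hv : MemH1 a b v)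
    (hq : ContinuousOn q (Icc a b)) (hp : ∀ x ∈ Icc a b, p x = p a + ∫ t in a..x, q t)
    (h : ∀ x ∈ Icc a b, HasDerivWithinAt u (w x * p x) (Icc a b) x) :
    weightedInner a b (fun x => (w x)⁻¹) (weakDeriv a b v) (weakDeriv a b u)
      = (starRingEnd ℂ) (v b) * p b - (starRingEnd ℂ) (v a) * p a
        - ∫ x in a..b, (starRingEnd ℂ) (v x) * q x := by
  have hqi : IntervalIntegrable q volume a b := hq.intervalIntegrable_of_Icc hab.le
  have hpc : ContinuousOn p (Icc a b) := by
    have := (absolutelyContinuousOnInterval_integral hqi).continuousOn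
    rw [uIcc_of_le hab.le] at this
    exact (continuousOn_const.add this (f := fun _ => p a)).congr hp
  have hvi := hv.intervalIntegrable hab.le
  have hci : IntervalIntegrable (fun x => (starRingEnd ℂ) (weakDeriv a b v x)) volume a b :=
    intervalIntegrable_of_memLp hab.le hv.memLp.star
  have hF : ∀ x ∈ Icc a b, (starRingEnd ℂ) (v x)
      = (starRingEnd ℂ) (v a) + ∫ t in a..x, (starRingEnd ℂ) (weakDeriv a b v t) := by
    intro x hx
    rw [hv.eq_integral hab x hx, map_add, intervalIntegral.intervalIntegral_conj]
  have h1 := integral_deriv_mul_add hab.le hci hqi hF hp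
  have hi1 : IntervalIntegrable (fun x => (starRingEnd ℂ) (weakDeriv a b v x) * p x)
      volume a b := by
    refine hci.mul_continuousOn ?_
    rwa [uIcc_of_le hab.le]
  have hi2 : IntervalIntegrable (fun x => (starRingEnd ℂ) (v x) * q x) volume a b :=
    ((hv.1.star).mul hq).intervalIntegrable_of_Icc hab.le
  rw [intervalIntegral.integral_add hi1 hi2] at h1
  rw [← h1, add_sub_cancel_right, weightedInner, intervalIntegral.integral_of_le hab.le,
    intervalIntegral.integral_of_le hab.le, ← restrict_Ioo_eq_restrict_Ioc]
  refine integral_congr_ae ?_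
  filter_upwards [weakDeriv_ae_eq_of_hasDerivWithinAt hab hu h, ae_restrict_mem measurableSet_Ioo]
    with x hx hxm
  have h0 : (w x : ℂ) ≠ 0 := by exact_mod_cast (hw0 x (Ioo_subset_Icc_self hxm)).ne'
  rw [hx, Complex.ofReal_inv]
  field_simp

end Regularity

namespace Operator

variable {n : ℕ} {H : Operator n} {U : Matrix.unitaryGroup (Bdry n) ℂ} {Φ Ψ : Fun n}

lemma sum_weightedInner_single {α : Fin n} {f : ℝ → ℂ} (w : Fin n → ℝ → ℝ) (Φ : Fun n) :
    ∑ β, weightedInner (H.a β) (H.b β) (w β) ((Pi.single α f : Fun n) β) (Φ β)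
      = weightedInner (H.a α) (H.b α) (w α) f (Φ α) := by
  rw [Finset.sum_eq_single α]
  · simp
  · intro β _ h
    rw [Pi.single_eq_of_ne h]
    simp [weightedInner]
  · simp

lemma energy_single {α : Fin n} {f g : ℝ → ℂ} (hf : MemH1 (H.a α) (H.b α) f)
    (hg : weakDeriv (H.a α) (H.b α) f =ᵐ[volume.restrict (Ioo (H.a α) (H.b α))] g) (Φ : Fun n) :
    H.energy (Pi.single α f) Φ = weightedInner (H.a α) (H.b α)
      (fun x => (Real.sqrt (H.η α x))⁻¹) g (H.D Φ α) := by
  rw [energy_eq, ← sum_weightedInner_single (fun β x => (Real.sqrt (H.η β x))⁻¹)]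
  refine Finset.sum_congr rfl fun β _ => weightedInner_congr (H.a_lt_b β).le ?_ .rfl
  by_cases h : β = α
  · subst h
    simpa [D] using hg
  · simp only [D, Pi.single_eq_of_ne h]
    refine MemH1.zero.weakDeriv_ae_eq (H.a_lt_b β) (Eventually.of_forall fun x => ?_)
    exact hasDerivAt_const x 0

lemma inner2_single {α : Fin n} {f : ℝ → ℂ} (Φ : Fun n) :
    H.inner2 (Pi.single α f) Φ = weightedInner (H.a α) (H.b α)
      (fun x => Real.sqrt (H.η α x)) f (Φ α) := by
  rw [inner2_eq]
  exact sum_weightedInner_single (fun β x => Real.sqrt (H.η β x)) Φ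

/-- The function with support in one component given by a test function. -/
def testFun (α : Fin n) (φ : ℝ → ℝ) : Fun n := Pi.single α fun x => (φ x : ℂ)

variable (H) in
/-- A weak solution of `-ΔΦ + VΦ = zΦ` is continuously differentiable up to the boundary, and
Green's formula holds. -/
lemma exists_regularity (z : ℂ) (hΦ : H.IsH1 Φ)
    (h : ∀ α, ∀ φ : ℝ → ℝ, ContDiff ℝ ∞ φ → HasCompactSupport φ →
      tsupport φ ⊆ Ioo (H.a α) (H.b α) →
      H.energy (testFun α φ) Φ + H.inner2 (testFun α φ) (H.potMul Φ)
        = z * H.inner2 (testFun α φ) Φ) :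
    (∃ g : Fun n, (∀ α, ContinuousOn (g α) (Icc (H.a α) (H.b α))) ∧
      ∀ α, ∀ x ∈ Icc (H.a α) (H.b α),
        HasDerivWithinAt (Φ α) (g α x) (Icc (H.a α) (H.b α)) x) ∧
    ∀ Ψ, H.IsH1 Ψ → H.energy Ψ Φ + H.inner2 Ψ (H.potMul Φ)
      = z * H.inner2 Ψ Φ + bdryInner (H.trace Ψ) (H.normalDeriv Φ) := by
  set w : Fin n → ℝ → ℝ := fun α x => Real.sqrt (H.η α x) with hw
  -- The equation in divergence form is `(Φ' / √η)' = (V - z) √η Φ`.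
  set q : Fun n := fun α x => ((H.V α x : ℂ) - z) * (w α x : ℂ) * Φ α x with hq
  have hqc : ∀ α, ContinuousOn (q α) (Icc (H.a α) (H.b α)) := fun α =>
    (((Complex.continuous_ofReal.comp_continuousOn (H.V_continuous α)).sub
      continuousOn_const).mul (Complex.continuous_ofReal.comp_continuousOn
        (H.continuousOn_sqrt α))).mul (hΦ α).1
  have hqi : ∀ α, ∀ f : ℝ → ℂ, ContinuousOn f (Icc (H.a α) (H.b α)) →
      ∫ x in (H.a α)..(H.b α), (starRingEnd ℂ) (f x) * q α x
        = weightedInner (H.a α) (H.b α) (w α) f (H.potMul Φ α)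
          - z * weightedInner (H.a α) (H.b α) (w α) f (Φ α) := by
    intro α f hf
    have c1 : ContinuousOn (fun x => (w α x : ℂ)) (Icc (H.a α) (H.b α)) :=
      Complex.continuous_ofReal.comp_continuousOn (H.continuousOn_sqrt α)
    have c2 : ContinuousOn (H.potMul Φ α) (Icc (H.a α) (H.b α)) :=
      (Complex.continuous_ofReal.comp_continuousOn (H.V_continuous α)).mul (hΦ α).1
    rw [weightedInner, weightedInner, ← intervalIntegral.integral_const_mul,
      ← intervalIntegral.integral_sub]
    · refine intervalIntegral.integral_congr fun x _ => ?_
      simp only [hq, potMul]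
      ring
    · exact ((hf.star.mul c2).mul c1).intervalIntegrable_of_Icc (H.a_lt_b α).le
    · exact (continuousOn_const.mul ((hf.star.mul (hΦ α).1).mul c1)).intervalIntegrable_of_Icc
        (H.a_lt_b α).le
  have key : ∀ α, ∃ p : ℝ → ℂ, ContinuousOn p (Icc (H.a α) (H.b α)) ∧
      (∀ x ∈ Icc (H.a α) (H.b α), p x = p (H.a α) + ∫ t in (H.a α)..x, q α t) ∧
      ∀ x ∈ Icc (H.a α) (H.b α),
        HasDerivWithinAt (Φ α) (w α x * p x) (Icc (H.a α) (H.b α)) x := by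
    intro α
    refine exists_primitive_of_weak_equation (H.a_lt_b α) (H.continuousOn_sqrt α)
      (fun x hx => H.sqrt_pos α hx) (hΦ α) (hqc α) fun φ h1 h2 h3 => ?_
    have h4 := h α φ h1 h2 h3
    have hd : ∀ x, HasDerivAt (fun x => (φ x : ℂ)) ((deriv φ x : ℝ) : ℂ) x := fun x =>
      ((h1.differentiable (by simp)) x).hasDerivAt.ofReal_comp
    have hm : MemH1 (H.a α) (H.b α) fun x => (φ x : ℂ) :=
      memH1_of_hasDerivAt (H.a_lt_b α).le
        (Complex.continuous_ofReal.comp h1.continuous).continuousOn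
        (Complex.continuous_ofReal.comp (h1.continuous_deriv (by simp))).continuousOn
        fun x _ => hd x
    rw [testFun, energy_single hm (hm.weakDeriv_ae_eq (H.a_lt_b α) (Eventually.of_forall hd)),
      inner2_single, inner2_single] at h4
    have h5 := hqi α (fun x => (φ x : ℂ))
      (Complex.continuous_ofReal.comp h1.continuous).continuousOn
    simp only [Complex.conj_ofReal] at h5
    simp only [Complex.real_smul]
    rw [h5]
    simp only [D] at h4
    linear_combination h4
  choose p p1 p2 p3 using key
  refine ⟨⟨fun α x => w α x * p α x, fun α =>
    (Complex.continuous_ofReal.comp_continuousOn (H.continuousOn_sqrt α)).mul (p1 α), p3⟩, ?_⟩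
  intro Ψ hΨ
  -- The flux `Φ' / √η` at an endpoint is the exterior normal derivative, up to the sign at left
  -- endpoints.
  have hn : ∀ α, H.normalDeriv Φ (Sum.inl α) = -p α (H.a α) ∧
      H.normalDeriv Φ (Sum.inr α) = p α (H.b α) := by
    intro α
    have hab := H.a_lt_b α
    have u := uniqueDiffOn_Icc hab
    have ha : (w α (H.a α) : ℂ) ≠ 0 := by
      exact_mod_cast (H.sqrt_pos α (left_mem_Icc.2 hab.le)).ne'
    have hb : (w α (H.b α) : ℂ) ≠ 0 := by
      exact_mod_cast (H.sqrt_pos α (right_mem_Icc.2 hab.le)).ne'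
    constructor
    · rw [normalDeriv, (p3 α _ (left_mem_Icc.2 hab.le)).derivWithin (u _ (left_mem_Icc.2 hab.le)),
        bdryDensity, Complex.ofReal_inv, neg_mul, inv_mul_cancel_left₀ ha]
    · rw [normalDeriv, (p3 α _ (right_mem_Icc.2 hab.le)).derivWithin
        (u _ (right_mem_Icc.2 hab.le)), bdryDensity, Complex.ofReal_inv, inv_mul_cancel_left₀ hb]
  rw [energy_eq, inner2_eq, inner2_eq, bdryInner, Fintype.sum_sum_type, ← Finset.sum_add_distrib,
    Finset.mul_sum, ← Finset.sum_add_distrib, ← Finset.sum_add_distrib]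
  refine Finset.sum_congr rfl fun α _ => ?_
  have h1 := weightedInner_weakDeriv_eq (H.a_lt_b α)
    (fun x hx => H.sqrt_pos α hx) (hΦ α) (hΨ α) (hqc α) (p2 α) (p3 α)
  rw [hqi α (Ψ α) (hΨ α).1] at h1
  rw [(hn α).1, (hn α).2]
  simp only [D, trace]
  rw [h1]
  ring

end Operator

end SchrodingerFEM

/-! ### Weak eigenpairs as eigenvectors of the form -/

namespace SchrodingerFEM

namespace Operator

variable {n : ℕ} {H : Operator n} {U : Matrix.unitaryGroup (Bdry n) ℂ} {Φ Ψ : Fun n}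

lemma Q_eq (Ψ Φ : Fun n) : H.Q Ψ Φ = H.energy Ψ Φ - bdryInner (H.trace Ψ) (H.normalDeriv Φ)
    + H.inner2 Ψ (H.potMul Φ) := rfl

lemma IsSmooth.isH1 (h : H.IsSmooth Ψ) : H.IsH1 Ψ := fun α =>
  memH1_of_contDiffOn (H.a_lt_b α) ((h α).of_le (by simp))

lemma isSmooth_testFun {α : Fin n} {φ : ℝ → ℝ} (h : ContDiff ℝ ∞ φ) :
    H.IsSmooth (testFun α φ) := by
  intro β
  by_cases hb : β = α
  · subst hb
    simp only [testFun, Pi.single_eq_same]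
    exact (Complex.ofRealCLM.contDiff.comp h).contDiffOn
  · rw [testFun, Pi.single_eq_of_ne hb]
    exact contDiffOn_const

lemma trace_testFun {α : Fin n} {φ : ℝ → ℝ} (h : tsupport φ ⊆ Ioo (H.a α) (H.b α)) :
    H.trace (testFun α φ) = 0 := by
  funext l
  rcases l with β | β <;> by_cases hb : β = α
  · subst hb
    simpa [trace, testFun] using eq_zero_of_tsupport_subset h (by simp)
  · simp [trace, testFun, Pi.single_eq_of_ne hb]
  · subst hb
    simpa [trace, testFun] using eq_zero_of_tsupport_subset h (by simp)
  · simp [trace, testFun, Pi.single_eq_of_ne hb]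

lemma mem_h1Space_of_mem_weakDomain (h : Φ ∈ H.weakDomain U) : Φ ∈ H.h1Space U :=
  ⟨h.1, IsBoundaryPair.mem_range (d := H.normalDeriv Φ) h.2.2⟩

/-- On functions that satisfy the boundary condition, `Q` is given by the quadratic form. -/
lemma form_eq_Q (c : ℝ) (hΦ : Φ ∈ H.weakDomain U) (hΨ : H.trace Ψ ∈ bdryRange U) :
    H.form U c Ψ Φ = H.Q Ψ Φ + c * H.inner2 Ψ Φ := by
  have h : IsBoundaryPair U (H.trace Φ) (H.normalDeriv Φ) := hΦ.2.2
  rw [form, ← h.inner_eq_bdryMap hΨ]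
  rfl

/-- Test functions supported in the interior do not see the boundary term and already give
regularity; Green's formula then extends the equation from smooth to all H¹ test functions, in
particular to finite elements. -/
lemma IsWeakEigenpair.regularity {μ : ℂ} (h : H.IsWeakEigenpair U Φ μ) :
    (∃ g : Fun n, (∀ α, ContinuousOn (g α) (Icc (H.a α) (H.b α))) ∧
      ∀ α, ∀ x ∈ Icc (H.a α) (H.b α),
        HasDerivWithinAt (Φ α) (g α x) (Icc (H.a α) (H.b α)) x) ∧
    ∀ Ψ, H.IsH1 Ψ → H.Q Ψ Φ = μ * H.inner2 Ψ Φ := by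
  obtain ⟨h1, h2⟩ := H.exists_regularity μ h.1.1 fun α φ h1 h2 h3 => by
    have h4 := h.2.2 _ (isSmooth_testFun (α := α) h1)
    rw [Q, trace_testFun h3] at h4
    simp only [Pi.zero_apply, map_zero, zero_mul, Finset.sum_const_zero, sub_zero] at h4
    exact h4
  refine ⟨h1, fun Ψ hΨ => ?_⟩
  have h3 := h2 Ψ hΨ
  rw [Q_eq]
  linear_combination h3

lemma IsWeakEigenpair.form_eq {μ : ℂ} (h : H.IsWeakEigenpair U Φ μ) (c : ℝ)
    (hΨ : Ψ ∈ H.h1Space U) : H.form U c Ψ Φ = (μ + c) * H.inner2 Ψ Φ := by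
  rw [form_eq_Q c h.1 hΨ.2, h.regularity.2 Ψ hΨ.1]
  ring

variable (H) in
/-- The function with prescribed boundary values that is affine on every component. -/
noncomputable def affineFun (ψ : Bdry n → ℂ) : Fun n := fun α x =>
  ψ (Sum.inl α) + ((x - H.a α : ℝ) : ℂ) / ((H.b α - H.a α : ℝ) : ℂ)
    * (ψ (Sum.inr α) - ψ (Sum.inl α))

lemma isH1_affineFun (ψ : Bdry n → ℂ) : H.IsH1 (H.affineFun ψ) := by
  refine IsSmooth.isH1 fun α => ContDiff.contDiffOn ?_
  refine contDiff_const.add (ContDiff.mul ?_ contDiff_const)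
  exact (Complex.ofRealCLM.contDiff.comp (contDiff_id.sub contDiff_const)).div_const _

lemma trace_affineFun (ψ : Bdry n → ℂ) : H.trace (H.affineFun ψ) = ψ := by
  funext l
  rcases l with α | α
  · simp [trace, affineFun]
  · have : ((H.b α - H.a α : ℝ) : ℂ) ≠ 0 := by
      exact_mod_cast (sub_pos.2 (H.a_lt_b α)).ne'
    simp [trace, affineFun, div_self this, -Complex.ofReal_sub]

/-- The boundary condition is natural. Subtracting Green's formula from the form equation, for test
functions with arbitrary admissible trace, shows that the true normal derivatives pair like `bdryMap
U` of the trace, and `isBoundaryPair_of_inner_eq` applies. Green's formula then gives the `Q`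
equation also for test functions that violate the boundary condition. -/
lemma isWeakEigenpair_of_form_eq {μ : ℂ} {c : ℝ} (hΦ : Φ ∈ H.h1Space U)
    (h0 : ∃ α, ∃ x ∈ Icc (H.a α) (H.b α), Φ α x ≠ 0)
    (h : ∀ Ψ ∈ H.h1Space U, H.form U c Ψ Φ = (μ + c) * H.inner2 Ψ Φ) :
    H.IsWeakEigenpair U Φ μ := by
  obtain ⟨⟨g, _, hg⟩, h2⟩ := H.exists_regularity μ hΦ.1 fun α φ h1 h2 h3 => by
    have ht := trace_testFun (H := H) h3
    have h4 := h (testFun α φ)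
      ⟨(isSmooth_testFun h1).isH1, by rw [ht]; exact Submodule.zero_mem _⟩
    rw [form, ht] at h4
    simp only [bdryInner, Pi.zero_apply, map_zero, zero_mul, Finset.sum_const_zero,
      sub_zero] at h4
    linear_combination h4
  have hbc : H.BoundaryCondition U Φ := by
    refine isBoundaryPair_of_inner_eq hΦ.2 fun ψ hψ => ?_
    have h3 := h2 _ (isH1_affineFun ψ)
    have h4 := h (H.affineFun ψ) ⟨isH1_affineFun ψ, by rwa [trace_affineFun]⟩
    rw [form, trace_affineFun] at h4
    rw [trace_affineFun] at h3
    linear_combination h4 - h3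
  refine ⟨⟨hΦ.1, fun α => ⟨(hg α _ (left_mem_Icc.2 (H.a_lt_b α).le)).differentiableWithinAt,
    (hg α _ (right_mem_Icc.2 (H.a_lt_b α).le)).differentiableWithinAt⟩, hbc⟩, h0,
    fun Ψ hΨ => ?_⟩
  have h3 := h2 Ψ hΨ.isH1
  rw [Q_eq]
  linear_combination h3

end Operator

end SchrodingerFEM

/-! ### Piecewise linear functions and their boundary data -/

namespace SchrodingerFEM

section Tent

/-- On the cell `[j, j + 1]` only the tents at `j` and `j + 1` are nonzero. -/
lemma sum_mul_tent {m j : ℕ} (c : ℕ → ℂ) {y : ℝ} (hj : j + 1 < m) (h1 : (j : ℝ) ≤ y)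
    (h2 : y ≤ j + 1) : ∑ k ∈ Finset.range m, c k * ((max 0 (1 - |y - k|) : ℝ) : ℂ)
      = c j + ((y - j : ℝ) : ℂ) * (c (j + 1) - c j) := by
  rw [Finset.sum_eq_add j (j + 1) (by omega)]
  · rw [abs_of_nonneg (sub_nonneg.2 h1), abs_of_nonpos (by push_cast; linarith),
      max_eq_right (by linarith), max_eq_right (by push_cast; linarith)]
    push_cast
    ring
  · intro k _ hk
    rw [max_eq_left, Complex.ofReal_zero, mul_zero]
    rcases lt_or_gt_of_ne hk.1 with h | h
    · have : (k : ℝ) + 1 ≤ j := by exact_mod_cast h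
      rw [abs_of_nonneg (by linarith)]; linarith
    · have : (j : ℝ) + 1 + 1 ≤ k := by
        have : j + 1 + 1 ≤ k := by omega
        exact_mod_cast this
      rw [abs_of_nonpos (by linarith)]; linarith
  · intro h; exact absurd (Finset.mem_range.2 (by omega)) h
  · intro h; exact absurd (Finset.mem_range.2 (by omega)) h

lemma lipschitzOnWith_tent (s : Set ℝ) (c h : ℝ) :
    LipschitzOnWith (Real.toNNReal |h⁻¹|) (fun x => max 0 (1 - |x - c| / h)) s := by
  refine LipschitzOnWith.of_dist_le_mul fun x _ y _ => ?_
  rw [Real.coe_toNNReal _ (abs_nonneg _), Real.dist_eq, Real.dist_eq, max_comm 0, max_comm 0]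
  refine (abs_max_sub_max_le_abs _ _ _).trans ?_
  have h1 : 1 - |x - c| / h - (1 - |y - c| / h) = h⁻¹ * (|y - c| - |x - c|) := by ring
  rw [h1, abs_mul]
  refine mul_le_mul_of_nonneg_left ((abs_abs_sub_abs_le_abs_sub _ _).trans ?_) (abs_nonneg _)
  rw [abs_sub_comm x y]
  simp

end Tent

namespace Operator

variable {n : ℕ} {H : Operator n} {N : ℕ} {U : Matrix.unitaryGroup (Bdry n) ℂ} {Φ Ψ : Fun n}
  {α : Fin n}

lemma h_pos (α : Fin n) : 0 < H.h N α :=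
  div_pos (sub_pos.2 (H.a_lt_b α)) (by positivity)

lemma h_mul (α : Fin n) : H.h N α * (H.r N α + 1) = H.b α - H.a α :=
  div_mul_cancel₀ _ (by positivity)

lemma node_zero (α : Fin n) : H.node N α 0 = H.a α := by simp [node]

lemma node_last (α : Fin n) : H.node N α (H.r N α + 1) = H.b α := by
  rw [node, Nat.cast_add, Nat.cast_one, h_mul]; ring

lemma node_succ (α : Fin n) (k : ℕ) : H.node N α (k + 1) = H.node N α k + H.h N α := by
  simp only [node]; push_cast; ring

lemma node_mono (α : Fin n) : StrictMono (H.node N α) :=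
  strictMono_nat_of_lt_succ fun k => by rw [node_succ]; linarith [H.h_pos (N := N) α]

lemma node_mem {k : ℕ} (hk : k ≤ H.r N α + 1) : H.node N α k ∈ Icc (H.a α) (H.b α) := by
  rw [← node_zero (N := N), ← node_last (N := N)]
  exact ⟨(node_mono α).monotone (Nat.zero_le k), (node_mono α).monotone hk⟩

lemma sub_node_div (x : ℝ) (k : ℕ) :
    (x - H.node N α k) / H.h N α = (x - H.a α) / H.h N α - k := by
  have := (H.h_pos (N := N) α).ne'
  rw [node]; field_simp; ring

lemma bdryDensity_pos (l : Bdry n) : 0 < H.bdryDensity l := by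
  rcases l with α | α
  · exact H.sqrt_pos α (left_mem_Icc.2 (H.a_lt_b α).le)
  · exact H.sqrt_pos α (right_mem_Icc.2 (H.a_lt_b α).le)

lemma hBdry_pos (l : Bdry n) : 0 < H.hBdry N l := by
  rcases l with α | α <;> exact mul_pos (h_pos α) (bdryDensity_pos _)

variable (H N) in
/-- The piecewise linear function with the values `c α k` at the nodes. -/
noncomputable def nodal : (Fin n → ℕ → ℂ) →ₗ[ℂ] Fun n where
  toFun c α x := ∑ k ∈ Finset.range (H.r N α + 2),
    c α k * ((max 0 (1 - |x - H.node N α k| / H.h N α) : ℝ) : ℂ)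
  map_add' c d := by
    funext α x
    simp [add_mul, Finset.sum_add_distrib]
  map_smul' z c := by
    funext α x
    simp [mul_assoc, Finset.mul_sum]

lemma nodal_apply (c : Fin n → ℕ → ℂ) (α : Fin n) (x : ℝ) :
    H.nodal N c α x = ∑ k ∈ Finset.range (H.r N α + 2),
      c α k * ((max 0 (1 - |x - H.node N α k| / H.h N α) : ℝ) : ℂ) := rfl

lemma nodal_congr {c d : Fin n → ℕ → ℂ} (h : ∀ α, ∀ k < H.r N α + 2, c α k = d α k) :
    H.nodal N c = H.nodal N d := by
  funext α x
  rw [nodal_apply, nodal_apply]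
  exact Finset.sum_congr rfl fun k hk => by rw [h α k (Finset.mem_range.1 hk)]

lemma nodal_eq_on_cell (c : Fin n → ℕ → ℂ) {j : ℕ} (hj : j ≤ H.r N α) {x : ℝ}
    (hx : x ∈ Icc (H.node N α j) (H.node N α (j + 1))) :
    H.nodal N c α x = c α j + (((x - H.node N α j) / H.h N α : ℝ) : ℂ)
      * (c α (j + 1) - c α j) := by
  have hh := H.h_pos (N := N) α
  have h1 : 0 ≤ (x - H.node N α j) / H.h N α := div_nonneg (sub_nonneg.2 hx.1) hh.le
  have h2 : (x - H.node N α j) / H.h N α ≤ 1 := by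
    rw [div_le_one hh]; have := hx.2; rw [node_succ] at this; linarith
  rw [sub_node_div] at h1 h2
  rw [sub_node_div, ← sum_mul_tent (c α) (m := H.r N α + 2) (by omega) (sub_nonneg.1 h1)
    (by linarith), nodal_apply]
  refine Finset.sum_congr rfl fun k _ => ?_
  rw [← sub_node_div, abs_div, abs_of_pos hh]

lemma nodal_node (c : Fin n → ℕ → ℂ) {k : ℕ} (hk : k ≤ H.r N α + 1) :
    H.nodal N c α (H.node N α k) = c α k := by
  rcases Nat.lt_or_ge k (H.r N α + 1) with h | h
  · rw [nodal_eq_on_cell c (Nat.lt_succ_iff.1 h) ⟨le_rfl, (node_mono α).monotone (by omega)⟩]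
    simp
  · obtain rfl : k = H.r N α + 1 := le_antisymm hk h
    rw [nodal_eq_on_cell c le_rfl ⟨(node_mono α).monotone (by omega), le_rfl⟩, node_succ]
    simp [div_self (H.h_pos (N := N) α).ne']

lemma hasDerivWithinAt_nodal (c : Fin n → ℕ → ℂ) {j : ℕ} (hj : j ≤ H.r N α) {x : ℝ}
    (hx : x ∈ Icc (H.node N α j) (H.node N α (j + 1))) :
    HasDerivWithinAt (H.nodal N c α) ((c α (j + 1) - c α j) / H.h N α)
      (Icc (H.node N α j) (H.node N α (j + 1))) x := by
  have h1 : HasDerivAt (fun x : ℝ => c α j + (((x - H.node N α j) / H.h N α : ℝ) : ℂ)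
      * (c α (j + 1) - c α j)) (((1 / H.h N α : ℝ) : ℂ) * (c α (j + 1) - c α j)) x :=
    ((((hasDerivAt_id x).sub_const _).div_const _).ofReal_comp.mul_const _).const_add _
  have h2 : ((1 / H.h N α : ℝ) : ℂ) * (c α (j + 1) - c α j)
      = (c α (j + 1) - c α j) / H.h N α := by push_cast; ring
  rw [h2] at h1
  exact h1.hasDerivWithinAt.congr (fun y hy => nodal_eq_on_cell c hj hy)
    (nodal_eq_on_cell c hj hx)

lemma hasDerivWithinAt_nodal_left (c : Fin n → ℕ → ℂ) (α : Fin n) :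
    HasDerivWithinAt (H.nodal N c α) ((c α 1 - c α 0) / H.h N α)
      (Icc (H.a α) (H.b α)) (H.a α) := by
  have h1 : H.node N α 0 < H.node N α 1 := node_mono α one_pos
  have h := hasDerivWithinAt_nodal c (Nat.zero_le _) (left_mem_Icc.2 h1.le)
  rw [zero_add, node_zero] at h
  rw [node_zero] at h1
  refine h.mono_of_mem_nhdsWithin ?_
  exact mem_of_superset (inter_mem_nhdsWithin _ (Iio_mem_nhds h1))
    fun x hx => ⟨hx.1.1, (mem_Iio.1 hx.2).le⟩

lemma hasDerivWithinAt_nodal_right (c : Fin n → ℕ → ℂ) (α : Fin n) :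
    HasDerivWithinAt (H.nodal N c α)
      ((c α (H.r N α + 1) - c α (H.r N α)) / H.h N α) (Icc (H.a α) (H.b α)) (H.b α) := by
  have h1 : H.node N α (H.r N α) < H.node N α (H.r N α + 1) := node_mono α (Nat.lt_succ_self _)
  have h := hasDerivWithinAt_nodal c le_rfl (right_mem_Icc.2 h1.le)
  rw [node_last] at h
  rw [node_last] at h1
  refine h.mono_of_mem_nhdsWithin ?_
  exact mem_of_superset (inter_mem_nhdsWithin _ (Ioi_mem_nhds h1))
    fun x hx => ⟨(mem_Ioi.1 hx.2).le, hx.1.2⟩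

lemma isH1_nodal (c : Fin n → ℕ → ℂ) : H.IsH1 (H.nodal N c) := by
  intro α
  have h : H.nodal N c α = ∑ k ∈ Finset.range (H.r N α + 2),
      c α k • fun x => ((max 0 (1 - |x - H.node N α k| / H.h N α) : ℝ) : ℂ) := by
    funext x
    simp [nodal_apply]
  rw [h]
  exact Finset.sum_induction _ (fun f => MemH1 (H.a α) (H.b α) f) (fun _ _ h1 h2 => h1.add h2)
    MemH1.zero fun k _ => (memH1_ofReal_of_lipschitzOnWith (H.a_lt_b α).le
      (lipschitzOnWith_tent _ _ _)).const_smul _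

variable (H N) in
/-- The nodal values at the boundary points. -/
noncomputable def outerVal (c : Fin n → ℕ → ℂ) : Bdry n → ℂ
  | Sum.inl α => c α 0
  | Sum.inr α => c α (H.r N α + 1)

variable (H N) in
/-- The nodal values at the nodes adjacent to the boundary points. -/
noncomputable def innerVal (c : Fin n → ℕ → ℂ) : Bdry n → ℂ
  | Sum.inl α => c α 1
  | Sum.inr α => c α (H.r N α)

variable (H N) in
/-- The normal derivatives of a piecewise linear function with the values `v` at the boundary
points and `w` at the adjacent nodes. -/
noncomputable def diffQuot (v w : Bdry n → ℂ) : Bdry n → ℂ :=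
  fun l => (v l - w l) / (H.hBdry N l : ℂ)

lemma trace_nodal (c : Fin n → ℕ → ℂ) : H.trace (H.nodal N c) = H.outerVal N c := by
  funext l
  rcases l with α | α
  · rw [trace, ← node_zero (N := N), nodal_node c (Nat.zero_le _), outerVal]
  · rw [trace, ← node_last (N := N), nodal_node c le_rfl, outerVal]

lemma normalDeriv_nodal (c : Fin n → ℕ → ℂ) :
    H.normalDeriv (H.nodal N c) = H.diffQuot N (H.outerVal N c) (H.innerVal N c) := by
  funext l
  have hd := (H.bdryDensity_pos l).ne'
  rcases l with α | α
  · have u := uniqueDiffOn_Icc (H.a_lt_b α) _ (left_mem_Icc.2 (H.a_lt_b α).le)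
    have h0 : (H.h N α : ℂ) ≠ 0 := by exact_mod_cast (h_pos α).ne'
    have h1 : (H.bdryDensity (Sum.inl α) : ℂ) ≠ 0 := by exact_mod_cast hd
    rw [normalDeriv, (hasDerivWithinAt_nodal_left c α).derivWithin u, diffQuot, outerVal, innerVal,
      hBdry]
    push_cast
    field_simp
    ring
  · have u := uniqueDiffOn_Icc (H.a_lt_b α) _ (right_mem_Icc.2 (H.a_lt_b α).le)
    have h0 : (H.h N α : ℂ) ≠ 0 := by exact_mod_cast (h_pos α).ne'
    have h1 : (H.bdryDensity (Sum.inr α) : ℂ) ≠ 0 := by exact_mod_cast hd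
    rw [normalDeriv, (hasDerivWithinAt_nodal_right c α).derivWithin u, diffQuot, outerVal, innerVal,
      hBdry]
    push_cast
    field_simp

/-- Putting the difference quotients `(v - w) / ĥ` into the boundary condition and separating `v`
from `w` produces exactly the matrices `F` and `C`. -/
lemma isBoundaryPair_diffQuot_iff (v w : Bdry n → ℂ) : IsBoundaryPair U v (H.diffQuot N v w) ↔
    (H.boundaryMatrix U N).mulVec v = (H.boundaryRhs U N).mulVec w := by
  have e1 : Matrix.mulVec (Matrix.diagonal fun l => 1 - Complex.I / (H.hBdry N l : ℂ)) v
      = fun l => (1 - Complex.I / (H.hBdry N l : ℂ)) * v l := by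
    funext l; rw [Matrix.mulVec_diagonal]
  have e2 : Matrix.mulVec (Matrix.diagonal fun l => 1 + Complex.I / (H.hBdry N l : ℂ)) v
      = fun l => (1 + Complex.I / (H.hBdry N l : ℂ)) * v l := by
    funext l; rw [Matrix.mulVec_diagonal]
  have e3 : Matrix.mulVec (Matrix.diagonal fun l => 1 / (H.hBdry N l : ℂ)) w
      = fun l => 1 / (H.hBdry N l : ℂ) * w l := by
    funext l; rw [Matrix.mulVec_diagonal]
  have e4 : v - Complex.I • H.diffQuot N v w
      = (fun l => (1 - Complex.I / (H.hBdry N l : ℂ)) * v l)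
        + Complex.I • fun l => 1 / (H.hBdry N l : ℂ) * w l := by
    funext l; simp only [Pi.sub_apply, Pi.smul_apply, Pi.add_apply, diffQuot, smul_eq_mul]; ring
  have e5 : v + Complex.I • H.diffQuot N v w
      = (fun l => (1 + Complex.I / (H.hBdry N l : ℂ)) * v l)
        - Complex.I • fun l => 1 / (H.hBdry N l : ℂ) * w l := by
    funext l; simp only [Pi.sub_apply, Pi.smul_apply, Pi.add_apply, diffQuot, smul_eq_mul]; ring
  rw [IsBoundaryPair, e4, e5, boundaryMatrix, boundaryRhs, Matrix.sub_mulVec, e1,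
    ← Matrix.mulVec_mulVec, e2, Matrix.smul_mulVec, ← Matrix.mulVec_mulVec, e3, Matrix.add_mulVec,
    Matrix.one_mulVec, Matrix.mulVec_sub, Matrix.mulVec_smul]
  constructor <;> intro h
  · rw [eq_sub_iff_add_eq] at h
    rw [sub_eq_iff_eq_add, neg_smul, smul_add, ← h]
    abel
  · rw [sub_eq_iff_eq_add, neg_smul, smul_add] at h
    rw [h]
    abel

lemma nodal_mem_weakDomain_iff (c : Fin n → ℕ → ℂ) : H.nodal N c ∈ H.weakDomain U ↔
    (H.boundaryMatrix U N).mulVec (H.outerVal N c)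
      = (H.boundaryRhs U N).mulVec (H.innerVal N c) := by
  rw [← isBoundaryPair_diffQuot_iff, ← normalDeriv_nodal, ← trace_nodal]
  exact ⟨fun h => h.2.2, fun h => ⟨isH1_nodal c, fun α =>
    ⟨(hasDerivWithinAt_nodal_left c α).differentiableWithinAt,
      (hasDerivWithinAt_nodal_right c α).differentiableWithinAt⟩, h⟩⟩

end Operator

end SchrodingerFEM

/-! ### The finite element space: description and dimension -/

namespace SchrodingerFEM

namespace Operator

variable {n : ℕ} {H : Operator n} {N : ℕ} {U : Matrix.unitaryGroup (Bdry n) ℂ} {f : Fun n}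
  {α : Fin n}

variable (N) in
lemma nodal_single {k : ℕ} (hk : k < H.r N α + 2) (z : ℂ) :
    H.nodal N (Pi.single α (Pi.single k z)) = z • H.hat N α k := by
  funext β x
  rw [nodal_apply]
  by_cases hb : β = α
  · subst hb
    rw [Finset.sum_eq_single k]
    · simp [hat]
    · intro j _ hj; simp [Pi.single_eq_of_ne hj]
    · intro h; exact absurd (Finset.mem_range.2 hk) h
  · simp [hat, Pi.single_eq_of_ne hb]

variable (H N) in
/-- The nodal values of a combination of the boundary functions. -/
noncomputable def bdryCoeff (v w : Bdry n → ℂ) : Fin n → ℕ → ℂ := ∑ α,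
  (Pi.single α (Pi.single 0 (v (Sum.inl α))) + Pi.single α (Pi.single 1 (w (Sum.inl α)))
    + Pi.single α (Pi.single (H.r N α) (w (Sum.inr α)))
    + Pi.single α (Pi.single (H.r N α + 1) (v (Sum.inr α))))

lemma nodal_bdryCoeff (v w : Bdry n → ℂ) :
    H.nodal N (H.bdryCoeff N v w) = H.betaFun N v w := by
  rw [bdryCoeff, betaFun, map_sum]
  refine Finset.sum_congr rfl fun α _ => ?_
  rw [map_add, map_add, map_add, nodal_single N (by omega), nodal_single N (by omega),
    nodal_single N (by omega), nodal_single N (by omega)]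

lemma bdryCoeff_apply (v w : Bdry n → ℂ) (α : Fin n) (k : ℕ) : H.bdryCoeff N v w α k =
    (if k = 0 then v (Sum.inl α) else 0) + (if k = 1 then w (Sum.inl α) else 0)
    + (if k = H.r N α then w (Sum.inr α) else 0)
    + (if k = H.r N α + 1 then v (Sum.inr α) else 0) := by
  rw [bdryCoeff, Finset.sum_apply, Finset.sum_eq_single α]
  · simp [Pi.single_apply]
  · intro β _ hb
    simp [Pi.single_eq_of_ne hb.symm]
  · simp

lemma outerVal_bdryCoeff (hr : ∀ α, 2 ≤ H.r N α) (v w : Bdry n → ℂ) :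
    H.outerVal N (H.bdryCoeff N v w) = v := by
  funext l
  rcases l with α | α <;> have := hr α <;> rw [outerVal, bdryCoeff_apply]
  · simp [show 0 ≠ H.r N α by omega]
  · simp [show H.r N α ≠ 0 by omega]

lemma innerVal_bdryCoeff (hr : ∀ α, 2 ≤ H.r N α) (v w : Bdry n → ℂ) :
    H.innerVal N (H.bdryCoeff N v w) = w := by
  funext l
  rcases l with α | α <;> have := hr α <;> rw [innerVal, bdryCoeff_apply]
  · simp [show 1 ≠ H.r N α by omega, show H.r N α ≠ 0 by omega]
  · simp [show H.r N α ≠ 0 by omega, show H.r N α ≠ 1 by omega]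

lemma betaFun_add (v w v' w' : Bdry n → ℂ) :
    H.betaFun N (v + v') (w + w') = H.betaFun N v w + H.betaFun N v' w' := by
  simp only [betaFun, ← Finset.sum_add_distrib, Pi.add_apply, add_smul]
  exact Finset.sum_congr rfl fun α _ => by abel

lemma betaFun_smul (z : ℂ) (v w : Bdry n → ℂ) :
    H.betaFun N (z • v) (z • w) = z • H.betaFun N v w := by
  simp only [betaFun, Finset.smul_sum, Pi.smul_apply, smul_eq_mul, smul_add, smul_smul]

lemma sum_smul_beta (w : Bdry n → ℂ) : ∑ i, w i • H.beta U N i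
    = H.betaFun N ((H.boundaryValues U N).mulVec w) w := by
  have h : ∀ s : Finset (Bdry n), ∑ i ∈ s, w i • H.beta U N i
      = H.betaFun N (∑ i ∈ s, w i • fun l => H.boundaryValues U N l i)
        (∑ i ∈ s, w i • Pi.single i 1) := by
    intro s
    induction s using Finset.induction_on with
    | empty => simp [betaFun]
    | insert i s hi ih =>
      rw [Finset.sum_insert hi, Finset.sum_insert hi, Finset.sum_insert hi, betaFun_add,
        betaFun_smul, ih]
      rfl
  rw [h]
  congr 1
  · funext l
    simp [Matrix.mulVec, dotProduct, mul_comm]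
  · funext l
    simp [Pi.single_apply]

lemma boundaryMatrix_mulVec (h : H.Admissible U N) (w : Bdry n → ℂ) :
    (H.boundaryMatrix U N).mulVec ((H.boundaryValues U N).mulVec w)
      = (H.boundaryRhs U N).mulVec w := by
  rw [Matrix.mulVec_mulVec, boundaryValues, Matrix.mul_nonsing_inv_cancel_left _ _ h.2]

lemma eq_boundaryValues_mulVec (h : H.Admissible U N) {v w : Bdry n → ℂ}
    (hv : (H.boundaryMatrix U N).mulVec v = (H.boundaryRhs U N).mulVec w) :
    v = (H.boundaryValues U N).mulVec w := by
  rw [boundaryValues, ← Matrix.mulVec_mulVec, ← hv, Matrix.mulVec_mulVec,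
    Matrix.nonsing_inv_mul _ h.2, Matrix.one_mulVec]

lemma outerVal_single {k : ℕ} (h1 : k ≠ 0) (h2 : k ≠ H.r N α + 1) (z : ℂ) :
    H.outerVal N (Pi.single α (Pi.single k z)) = 0 := by
  funext l
  rcases l with β | β <;> by_cases hb : β = α
  · subst hb; simp [outerVal, Pi.single_eq_of_ne h1.symm]
  · simp [outerVal, Pi.single_eq_of_ne hb]
  · subst hb; simp [outerVal, Pi.single_eq_of_ne h2.symm]
  · simp [outerVal, Pi.single_eq_of_ne hb]

lemma innerVal_single {k : ℕ} (h1 : k ≠ 1) (h2 : k ≠ H.r N α) (z : ℂ) :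
    H.innerVal N (Pi.single α (Pi.single k z)) = 0 := by
  funext l
  rcases l with β | β <;> by_cases hb : β = α
  · subst hb; simp [innerVal, Pi.single_eq_of_ne h1.symm]
  · simp [innerVal, Pi.single_eq_of_ne hb]
  · subst hb; simp [innerVal, Pi.single_eq_of_ne h2.symm]
  · simp [innerVal, Pi.single_eq_of_ne hb]

variable (H U N) in
/-- The nodal values of the piecewise linear functions that satisfy the boundary condition. -/
noncomputable def coeffSpace : Submodule ℂ (Fin n → ℕ → ℂ) where
  carrier := {c | (H.boundaryMatrix U N).mulVec (H.outerVal N c)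
    = (H.boundaryRhs U N).mulVec (H.innerVal N c)}
  zero_mem' := by
    have h1 : H.outerVal N 0 = 0 := by funext l; rcases l with β | β <;> rfl
    have h2 : H.innerVal N 0 = 0 := by funext l; rcases l with β | β <;> rfl
    simp [h1, h2]
  add_mem' {c d} hc hd := by
    have h1 : H.outerVal N (c + d) = H.outerVal N c + H.outerVal N d := by
      funext l; rcases l with β | β <;> rfl
    have h2 : H.innerVal N (c + d) = H.innerVal N c + H.innerVal N d := by
      funext l; rcases l with β | β <;> rfl
    rw [mem_ofPred_eq] at hc hd ⊢
    rw [h1, h2, Matrix.mulVec_add, Matrix.mulVec_add, hc, hd]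
  smul_mem' z c hc := by
    have h1 : H.outerVal N (z • c) = z • H.outerVal N c := by
      funext l; rcases l with β | β <;> rfl
    have h2 : H.innerVal N (z • c) = z • H.innerVal N c := by
      funext l; rcases l with β | β <;> rfl
    rw [mem_ofPred_eq] at hc ⊢
    rw [h1, h2, Matrix.mulVec_smul, Matrix.mulVec_smul, hc]

lemma mem_coeffSpace {c : Fin n → ℕ → ℂ} : c ∈ H.coeffSpace N U ↔
    (H.boundaryMatrix U N).mulVec (H.outerVal N c)
      = (H.boundaryRhs U N).mulVec (H.innerVal N c) := Iff.rfl

/-- The nodal values split into those of the boundary functions and those of the bulk functions. -/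
lemma nodal_eq_betaFun_add (hr : ∀ α, 2 ≤ H.r N α) (c : Fin n → ℕ → ℂ) :
    H.nodal N c = H.betaFun N (H.outerVal N c) (H.innerVal N c)
      + ∑ α, ∑ k ∈ Finset.Ico 2 (H.r N α), c α k • H.hat N α k := by
  rw [← nodal_bdryCoeff]
  have h : ∑ α, ∑ k ∈ Finset.Ico 2 (H.r N α), c α k • H.hat N α k
      = H.nodal N (∑ α, ∑ k ∈ Finset.Ico 2 (H.r N α), Pi.single α (Pi.single k (c α k))) := by
    rw [map_sum]
    refine Finset.sum_congr rfl fun α _ => ?_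
    rw [map_sum]
    refine Finset.sum_congr rfl fun k hk => ?_
    have := (Finset.mem_Ico.1 hk).2
    rw [nodal_single N (by omega)]
  rw [h, ← map_add]
  refine nodal_congr fun α k hk => ?_
  have h2 : (∑ β, ∑ j ∈ Finset.Ico 2 (H.r N β),
      (Pi.single β (Pi.single j (c β j)) : Fin n → ℕ → ℂ)) α k
      = if k ∈ Finset.Ico 2 (H.r N α) then c α k else 0 := by
    rw [Finset.sum_apply, Finset.sum_eq_single α, Finset.sum_apply]
    · simp only [Pi.single_eq_same, Finset.sum_apply, Pi.single_apply, Finset.sum_ite_eq]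
    · intro β _ hb
      simp [Finset.sum_apply, Pi.single_eq_of_ne hb.symm]
    · simp
  rw [Pi.add_apply, Pi.add_apply, h2, bdryCoeff_apply]
  have h3 := hr α
  simp only [outerVal, innerVal, Finset.mem_Ico]
  -- Because `2 ≤ r`, the indices `0, 1, r, r + 1` are distinct, and the bulk indices fill the gap
  -- between them.
  rcases Nat.lt_or_ge k 2 with h4 | h4
  · interval_cases k
    · simp [show 0 ≠ H.r N α by omega]
    · simp [show 1 ≠ H.r N α by omega, show H.r N α ≠ 0 by omega]
  · rcases Nat.lt_or_ge k (H.r N α) with h5 | h5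
    · simp [h4, h5, show k ≠ 0 by omega, show k ≠ 1 by omega, show k ≠ H.r N α by omega,
        show k ≠ H.r N α + 1 by omega]
    · rcases (by omega : k = H.r N α ∨ k = H.r N α + 1) with rfl | rfl
      · simp [show H.r N α ≠ 0 by omega, show H.r N α ≠ 1 by omega]
      · simp [show H.r N α ≠ 0 by omega]

/-- Bulk functions have zero boundary data, and invertibility of `F` forces the boundary values of
any `c` in `coeffSpace` to be `F⁻¹ C` applied to the adjacent values, as in a combination of
boundary functions. So every piecewise linear function that satisfies the boundary condition is
available for approximation. -/
lemma S_eq_map (h : H.Admissible U N) : H.S U N = (H.coeffSpace N U).map (H.nodal N) := by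
  refine le_antisymm (Submodule.span_le.2 ?_) ?_
  · rintro f (⟨α, k, h1, h2, rfl⟩ | ⟨i, rfl⟩)
    · refine ⟨Pi.single α (Pi.single k 1), ?_, by rw [nodal_single N (by omega), one_smul]⟩
      change _ = _
      rw [outerVal_single (by omega) (by omega), innerVal_single (by omega) (by omega),
        Matrix.mulVec_zero, Matrix.mulVec_zero]
    · refine ⟨H.bdryCoeff N (fun l => H.boundaryValues U N l i) (Pi.single i 1), ?_,
        nodal_bdryCoeff _ _⟩
      change _ = _
      rw [outerVal_bdryCoeff h.1, innerVal_bdryCoeff h.1, ← boundaryMatrix_mulVec h,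
        Matrix.mulVec_single_one]
      rfl
  · rintro _ ⟨c, hc, rfl⟩
    rw [nodal_eq_betaFun_add h.1, eq_boundaryValues_mulVec h hc, ← sum_smul_beta]
    refine Submodule.add_mem _ (Submodule.sum_mem _ fun i _ => Submodule.smul_mem _ _
      (Submodule.subset_span (Or.inr ⟨i, rfl⟩))) (Submodule.sum_mem _ fun α _ =>
      Submodule.sum_mem _ fun k hk => Submodule.smul_mem _ _ (Submodule.subset_span (Or.inl ?_)))
    rw [Finset.mem_Ico] at hk
    exact ⟨α, k, hk.1, hk.2, rfl⟩

lemma exists_nodal_of_mem_S (h : H.Admissible U N) (hf : f ∈ H.S U N) :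
    ∃ c ∈ H.coeffSpace N U, H.nodal N c = f := by
  rwa [S_eq_map h] at hf

lemma mem_weakDomain_of_mem_S (h : H.Admissible U N) (hf : f ∈ H.S U N) :
    f ∈ H.weakDomain U := by
  obtain ⟨c, hc, rfl⟩ := exists_nodal_of_mem_S h hf
  exact (nodal_mem_weakDomain_iff c).2 hc

/-- The boundary values are `F⁻¹ C` applied to the adjacent ones, so the interior nodal values
determine everything; this is what makes the dimension `|r|`. -/
lemma eq_zero_of_mem_S (h : H.Admissible U N) (hf : f ∈ H.S U N)
    (h0 : ∀ α, ∀ k, 1 ≤ k → k ≤ H.r N α → f α (H.node N α k) = 0) : f = 0 := by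
  obtain ⟨c, hc, rfl⟩ := exists_nodal_of_mem_S h hf
  have h1 : ∀ α, ∀ k, 1 ≤ k → k ≤ H.r N α → c α k = 0 := fun α k hk1 hk2 => by
    rw [← nodal_node c (hk2.trans (Nat.le_succ _))]; exact h0 α k hk1 hk2
  have h2 : H.innerVal N c = 0 := by
    funext l
    rcases l with α | α <;> have := h.1 α
    · exact h1 α 1 le_rfl (by omega)
    · exact h1 α _ (by omega) le_rfl
  have h3 := eq_boundaryValues_mulVec h hc
  rw [h2, Matrix.mulVec_zero] at h3
  rw [← map_zero (H.nodal N)]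
  refine nodal_congr fun α k hk => ?_
  rcases Nat.eq_zero_or_pos k with rfl | hk0
  · exact congrFun h3 (Sum.inl α)
  · rcases Nat.lt_or_ge k (H.r N α + 1) with h4 | h4
    · exact h1 α k hk0 (by omega)
    · obtain rfl : k = H.r N α + 1 := by omega
      exact congrFun h3 (Sum.inr α)

/-- Tents near the endpoints reach beyond the intervals, but vanishing on the manifold still kills
all nodal values. Hence the seminorm of the form domain is definite on the finite element space. -/
lemma eq_zero_of_eqOn_zero (h : H.Admissible U N) (hf : f ∈ H.S U N)
    (h0 : ∀ α, EqOn (f α) 0 (Icc (H.a α) (H.b α))) : f = 0 :=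
  eq_zero_of_mem_S h hf fun α _ _ hk => h0 α (node_mem (hk.trans (Nat.le_succ _)))

/-- An element of the finite element space with prescribed values at the interior nodes. -/
lemma exists_mem_S (h : H.Admissible U N) (w : Fin n → ℕ → ℂ) : ∃ c ∈ H.coeffSpace N U,
    H.nodal N c ∈ H.S U N ∧ (∀ α, ∀ k, 1 ≤ k → k ≤ H.r N α → c α k = w α k) := by
  set v := (H.boundaryValues U N).mulVec (H.innerVal N w) with hv
  set c : Fin n → ℕ → ℂ := fun α k => if k = 0 then v (Sum.inl α) else
    if k = H.r N α + 1 then v (Sum.inr α) else w α k with hc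
  have h1 : ∀ α, ∀ k, 1 ≤ k → k ≤ H.r N α → c α k = w α k := fun α k h1 h2 => by
    simp [hc, show k ≠ 0 by omega, show k ≠ H.r N α + 1 by omega]
  have h2 : H.innerVal N c = H.innerVal N w := by
    funext l
    rcases l with α | α <;> have := h.1 α
    · exact h1 α 1 le_rfl (by omega)
    · exact h1 α _ (by omega) le_rfl
  have h3 : H.outerVal N c = v := by
    funext l
    rcases l with α | α <;> simp [outerVal, hc]
  have h4 : c ∈ H.coeffSpace N U := by
    rw [mem_coeffSpace, h2, h3, hv, boundaryMatrix_mulVec h]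
  exact ⟨c, h4, by rw [S_eq_map h]; exact ⟨c, h4, rfl⟩, h1⟩

variable (H U N) in
/-- Evaluation at the interior nodes. -/
noncomputable def evalNodes : H.S U N →ₗ[ℂ] ((Σ α, Fin (H.r N α)) → ℂ) where
  toFun f i := (f : Fun n) i.1 (H.node N i.1 (i.2 + 1))
  map_add' _ _ := rfl
  map_smul' _ _ := rfl

lemma bijective_evalNodes (h : H.Admissible U N) : Function.Bijective (H.evalNodes N U) := by
  constructor
  · rw [← LinearMap.ker_eq_bot, LinearMap.ker_eq_bot']
    rintro ⟨f, hf⟩ h0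
    refine Subtype.ext (eq_zero_of_mem_S h hf fun α k h1 h2 => ?_)
    have h3 := congrFun h0 ⟨α, ⟨k - 1, by omega⟩⟩
    simp only [evalNodes, LinearMap.coe_mk, AddHom.coe_mk, Nat.sub_add_cancel h1] at h3
    exact h3
  · intro w
    obtain ⟨c, -, hc, h1⟩ := exists_mem_S h fun α k =>
      if hk : k - 1 < H.r N α then w ⟨α, ⟨k - 1, hk⟩⟩ else 0
    refine ⟨⟨_, hc⟩, funext fun ⟨α, k⟩ => ?_⟩
    have hk := k.2
    simp only [evalNodes, LinearMap.coe_mk, AddHom.coe_mk]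
    rw [nodal_node c (by omega), h1 α _ (by omega) (by omega)]
    simp

lemma finrank_S (h : H.Admissible U N) : Module.finrank ℂ (H.S U N) = H.dimS N := by
  rw [(LinearEquiv.ofBijective _ (bijective_evalNodes h)).finrank_eq]
  simp [dimS]

lemma finiteDimensional_S (h : H.Admissible U N) : FiniteDimensional ℂ (H.S U N) :=
  (LinearEquiv.ofBijective _ (bijective_evalNodes h)).symm.finiteDimensional

end Operator

end SchrodingerFEM

/-! ### Mesh asymptotics, admissibility and interpolation error -/

namespace SchrodingerFEM

lemma normSq_le_of_ae_norm_le {a b : ℝ} (hab : a ≤ b) {g : ℝ → ℂ} {ε : ℝ}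
    (hg : MemLp g 2 (volume.restrict (Ioo a b)))
    (h : ∀ᵐ x ∂volume.restrict (Ioo a b), ‖g x‖ ≤ ε) : normSq a b g ≤ (b - a) * ε ^ 2 := by
  have h1 : ∫ _ in a..b, ε ^ 2 = (b - a) * ε ^ 2 := by simp
  rw [normSq, ← h1]
  refine intervalIntegral.integral_mono_ae_restrict hab (intervalIntegrable_norm_sq hab hg)
    intervalIntegrable_const ?_
  rw [← restrict_Ioo_eq_restrict_Icc]
  filter_upwards [h] with x hx
  exact pow_le_pow_left₀ (norm_nonneg _) hx 2

namespace Operator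

variable {n : ℕ} {H : Operator n} {N : ℕ} {U : Matrix.unitaryGroup (Bdry n) ℂ} {Φ Ψ : Fun n}
  {α : Fin n}

section Mesh

variable (H)

lemma tendsto_r (α : Fin n) : Tendsto (fun N => H.r N α) atTop atTop := by
  refine tendsto_atTop_mono (fun N => Nat.le_succ _) (tendsto_nat_floor_atTop.comp ?_)
  have hL : 0 < ∑ γ, (H.b γ - H.a γ) :=
    Finset.sum_pos (fun γ _ => sub_pos.2 (H.a_lt_b γ)) ⟨α, Finset.mem_univ α⟩
  exact (tendsto_natCast_atTop_atTop.const_mul_atTop (sub_pos.2 (H.a_lt_b α))).atTop_div_const hL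

lemma tendsto_h (α : Fin n) : Tendsto (fun N => H.h N α) atTop (𝓝 0) :=
  Tendsto.div_atTop tendsto_const_nhds (tendsto_atTop_add_const_right _ _
    (tendsto_natCast_atTop_atTop.comp (H.tendsto_r α)))

lemma tendsto_hBdry (l : Bdry n) : Tendsto (fun N => H.hBdry N l) atTop (𝓝 0) := by
  rcases l with α | α
  · simpa [hBdry] using (H.tendsto_h α).mul_const (H.bdryDensity (Sum.inl α))
  · simpa [hBdry] using (H.tendsto_h α).mul_const (H.bdryDensity (Sum.inr α))

lemma tendsto_dimS (hn : 1 ≤ n) : Tendsto H.dimS atTop atTop :=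
  tendsto_atTop_mono (fun N => Finset.single_le_sum (f := fun α => H.r N α)
    (fun _ _ => Nat.zero_le _) (Finset.mem_univ (⟨0, hn⟩ : Fin n))) (H.tendsto_r ⟨0, hn⟩)

lemma eventually_hBdry_mul_le (K : ℝ) : ∀ᶠ N in atTop, ∀ l, K * H.hBdry N l ≤ 1 := by
  rw [eventually_all]
  intro l
  have h := (H.tendsto_hBdry l).const_mul K
  rw [mul_zero] at h
  exact (h.eventually_lt_const one_pos).mono fun _ h => h.le

end Mesh

/-- A change `e` of the boundary values changes the quotients by `e / ĥ`. Paired with `e` itself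
this is a positive quantity with the large weights `1 / ĥ`, which drives all estimates of the
boundary values. -/
lemma bdryInner_diffQuot (v w e : Bdry n → ℂ) : bdryInner e (H.diffQuot N (v + e) w)
    = bdryInner e (H.diffQuot N v w) + ((∑ l, ‖e l‖ ^ 2 / H.hBdry N l : ℝ) : ℂ) := by
  rw [bdryInner, bdryInner, Complex.ofReal_sum, ← Finset.sum_add_distrib]
  refine Finset.sum_congr rfl fun l _ => ?_
  have h0 : (H.hBdry N l : ℂ) ≠ 0 := by exact_mod_cast (hBdry_pos l).ne'
  have h1 : ((‖e l‖ ^ 2 : ℝ) : ℂ) = (starRingEnd ℂ) (e l) * e l := by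
    rw [mul_comm, Complex.mul_conj, Complex.normSq_eq_norm_sq]
  rw [Complex.ofReal_div, h1, diffQuot, diffQuot, Pi.add_apply]
  field_simp
  ring

lemma mul_norm_sq_le_sum {K : ℝ} (hK : 0 < K) (h : ∀ l, K * H.hBdry N l ≤ 1) (e : Bdry n → ℂ) :
    K * ‖e‖ ^ 2 ≤ ∑ l, ‖e l‖ ^ 2 / H.hBdry N l := by
  set T := ∑ l, ‖e l‖ ^ 2 / H.hBdry N l with hT
  have hp : ∀ l, 0 ≤ ‖e l‖ ^ 2 / H.hBdry N l := fun l => div_nonneg (sq_nonneg _) (hBdry_pos l).le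
  have hT0 : 0 ≤ T := Finset.sum_nonneg fun l _ => hp l
  have h1 : ‖e‖ ≤ Real.sqrt (T / K) := by
    refine (pi_norm_le_iff_of_nonneg (Real.sqrt_nonneg _)).2 fun l => ?_
    refine Real.le_sqrt_of_sq_le ?_
    rw [le_div_iff₀ hK]
    refine le_trans ?_ (Finset.single_le_sum (fun l _ => hp l) (Finset.mem_univ l))
    rw [le_div_iff₀ (hBdry_pos l), mul_assoc]
    exact mul_le_of_le_one_right (sq_nonneg _) (h l)
  have h2 := pow_le_pow_left₀ (norm_nonneg _) h1 2
  rw [Real.sq_sqrt (by positivity), le_div_iff₀ hK] at h2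
  linarith

/-- The boundary values of the piecewise linear functions that satisfy the boundary condition. -/
lemma IsBoundaryPair.sum_le {v w e : Bdry n → ℂ} (h : IsBoundaryPair U (v + e)
    (H.diffQuot N (v + e) w)) (hv : v ∈ bdryRange U) {C B : ℝ}
    (hC : ∀ ψ φ : Bdry n → ℂ, ‖bdryInner ψ (bdryMap U φ)‖ ≤ C * (‖ψ‖ * ‖φ‖))
    (hB : ‖H.diffQuot N v w‖ ≤ B) : ∑ l, ‖e l‖ ^ 2 / H.hBdry N l
      ≤ C * ‖e‖ ^ 2 + (C * ‖v‖ + Fintype.card (Bdry n) * B) * ‖e‖ := by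
  have he : e ∈ bdryRange U := by
    have := Submodule.sub_mem _ h.mem_range hv
    rwa [add_sub_cancel_left] at this
  -- Pairing the boundary condition with `e` isolates the weighted sum; the remaining terms carry no
  -- factor `1 / ĥ` apart from the quotient bounded by `B`.
  have h1 := h.inner_eq_bdryMap he
  rw [bdryInner_diffQuot, map_add, bdryInner_add_right] at h1
  have h2 : ((∑ l, ‖e l‖ ^ 2 / H.hBdry N l : ℝ) : ℂ) = bdryInner e (bdryMap U v)
      + bdryInner e (bdryMap U e) - bdryInner e (H.diffQuot N v w) := by
    linear_combination h1
  have h3 : ∑ l, ‖e l‖ ^ 2 / H.hBdry N l ≤ ‖((∑ l, ‖e l‖ ^ 2 / H.hBdry N l : ℝ) : ℂ)‖ := by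
    rw [Complex.norm_real]; exact le_abs_self _
  refine h3.trans ?_
  rw [h2]
  have h4 := norm_bdryInner_le e (H.diffQuot N v w)
  have h5 : (Fintype.card (Bdry n) : ℝ) * (‖e‖ * ‖H.diffQuot N v w‖)
      ≤ Fintype.card (Bdry n) * (‖e‖ * B) := by gcongr
  calc _ ≤ C * (‖e‖ * ‖v‖) + C * (‖e‖ * ‖e‖) + Fintype.card (Bdry n) * (‖e‖ * B) := by
        refine (norm_sub_le _ _).trans (add_le_add ((norm_add_le _ _).trans
          (add_le_add (hC _ _) (hC _ _))) (h4.trans h5))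
    _ = _ := by ring

variable (H U) in
-- A vector `e` in the kernel of `F` is boundary data for zero adjacent values. Then
-- `IsBoundaryPair.sum_le` bounds `∑ ‖e l‖² / ĥ l` by `C ‖e‖²`, whereas for a fine mesh the sum is
-- at least `(C + 1) ‖e‖²`.
lemma eventually_admissible : ∀ᶠ N in atTop, H.Admissible U N := by
  obtain ⟨C, hC0, hC⟩ := exists_bdryMap_bound U
  filter_upwards [H.eventually_hBdry_mul_le (C + 1), eventually_all.2 fun α =>
    (H.tendsto_r α).eventually_ge_atTop 2] with N h1 h2
  refine ⟨h2, ?_⟩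
  rw [← Matrix.isUnit_iff_isUnit_det, ← Matrix.mulVec_injective_iff_isUnit]
  rw [← Matrix.coe_mulVecLin, ← LinearMap.ker_eq_bot, LinearMap.ker_eq_bot']
  intro e he
  rw [Matrix.mulVecLin_apply] at he
  have h3 : IsBoundaryPair U (0 + e) (H.diffQuot N (0 + e) 0) := by
    rw [isBoundaryPair_diffQuot_iff, zero_add, he, Matrix.mulVec_zero]
  have h4 : H.diffQuot N (0 : Bdry n → ℂ) 0 = 0 := by funext l; simp [diffQuot]
  have h5 := IsBoundaryPair.sum_le h3 (Submodule.zero_mem _) hC (B := 0) (by rw [h4, norm_zero])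
  have h6 := mul_norm_sq_le_sum (by positivity) h1 e
  rw [norm_zero] at h5
  have h7 : ‖e‖ ^ 2 ≤ 0 := by linarith
  exact norm_eq_zero.1 (pow_eq_zero_iff two_ne_zero |>.1 (le_antisymm h7 (sq_nonneg _)))

lemma exists_mem_cell {x : ℝ} (hx : x ∈ Ico (H.a α) (H.b α)) :
    ∃ j ≤ H.r N α, x ∈ Ico (H.node N α j) (H.node N α (j + 1)) := by
  have hh := H.h_pos (N := N) α
  have h0 : 0 ≤ (x - H.a α) / H.h N α := div_nonneg (sub_nonneg.2 hx.1) hh.le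
  have h1 := Nat.floor_le h0
  have h2 := Nat.lt_floor_add_one ((x - H.a α) / H.h N α)
  have h3 : (x - H.a α) / H.h N α < H.r N α + 1 := by
    rw [div_lt_iff₀ hh, mul_comm, h_mul]; linarith [hx.2]
  refine ⟨⌊(x - H.a α) / H.h N α⌋₊, Nat.lt_succ_iff.1 ((Nat.floor_lt h0).2 (by exact_mod_cast h3)),
    ?_, ?_⟩
  · rw [le_div_iff₀ hh] at h1; rw [node]; linarith
  · rw [div_lt_iff₀ hh] at h2; rw [node]; push_cast; linarith

lemma ae_exists_mem_cell (α : Fin n) : ∀ᵐ x ∂volume.restrict (Ioo (H.a α) (H.b α)),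
    ∃ j ≤ H.r N α, x ∈ Ioo (H.node N α j) (H.node N α (j + 1)) := by
  have h := (countable_range (H.node N α)).ae_notMem (volume.restrict (Ioo (H.a α) (H.b α)))
  filter_upwards [h, ae_restrict_mem measurableSet_Ioo] with x hx hxm
  obtain ⟨j, hj, h1⟩ := exists_mem_cell (N := N) ⟨hxm.1.le, hxm.2⟩
  exact ⟨j, hj, lt_of_le_of_ne h1.1 fun h => hx ⟨j, h⟩, h1.2⟩

lemma cell_subset {j : ℕ} (hj : j ≤ H.r N α) :
    Icc (H.node N α j) (H.node N α (j + 1)) ⊆ Icc (H.a α) (H.b α) :=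
  Icc_subset_Icc (node_mem (by omega)).1 (node_mem (by omega)).2

lemma weakDeriv_nodal_ae_eq (c : Fin n → ℕ → ℂ) {j : ℕ} (hj : j ≤ H.r N α) :
    weakDeriv (H.a α) (H.b α) (H.nodal N c α)
      =ᵐ[volume.restrict (Ioo (H.node N α j) (H.node N α (j + 1)))]
      fun _ => (c α (j + 1) - c α j) / H.h N α := by
  have hs : Ioo (H.node N α j) (H.node N α (j + 1)) ⊆ Ioo (H.a α) (H.b α) :=
    Ioo_subset_Ioo (node_mem (by omega)).1 (node_mem (by omega)).2
  filter_upwards [ae_restrict_of_ae_restrict_of_subset hs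
    ((isH1_nodal (H := H) (N := N) c α).ae_hasDerivAt (H.a_lt_b α)),
    ae_restrict_mem measurableSet_Ioo] with x h1 hx
  exact h1.unique ((hasDerivWithinAt_nodal c hj (Ioo_subset_Icc_self hx)).hasDerivAt
    (Icc_mem_nhds hx.1 hx.2))

lemma normSq_weakDeriv_nodal (c : Fin n → ℕ → ℂ) (α : Fin n) :
    normSq (H.a α) (H.b α) (weakDeriv (H.a α) (H.b α) (H.nodal N c α))
      = ∑ j ∈ Finset.range (H.r N α + 1), ‖c α (j + 1) - c α j‖ ^ 2 / H.h N α := by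
  have hab := H.a_lt_b α
  have hi := intervalIntegrable_norm_sq hab.le (isH1_nodal (H := H) (N := N) c α).memLp
  have h1 := intervalIntegral.sum_integral_adjacent_intervals (n := H.r N α + 1)
    (a := H.node N α) (f := fun x => ‖weakDeriv (H.a α) (H.b α) (H.nodal N c α) x‖ ^ 2)
    (μ := volume) fun k hk => hi.mono_set (by
      rw [uIcc_of_le hab.le, uIcc_of_le ((node_mono α).monotone (Nat.le_succ k))]
      exact cell_subset (Nat.lt_succ_iff.1 hk))
  rw [node_zero, node_last] at h1
  rw [normSq, ← h1]
  refine Finset.sum_congr rfl fun j hj => ?_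
  have hj' := Nat.lt_succ_iff.1 (Finset.mem_range.1 hj)
  have hh := H.h_pos (N := N) α
  have h2 : ∫ x in (H.node N α j)..(H.node N α (j + 1)),
      ‖weakDeriv (H.a α) (H.b α) (H.nodal N c α) x‖ ^ 2
      = ∫ _ in (H.node N α j)..(H.node N α (j + 1)),
        ‖(c α (j + 1) - c α j) / (H.h N α : ℂ)‖ ^ 2 :=
    normSq_congr ((node_mono α).monotone (Nat.le_succ j)) (weakDeriv_nodal_ae_eq c hj')
  rw [h2, intervalIntegral.integral_const, node_succ, add_sub_cancel_left, norm_div,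
    Complex.norm_real, Real.norm_of_nonneg hh.le, div_pow, smul_eq_mul]
  field_simp

/-- The derivative of a function that vanishes at the interior nodes. -/
lemma normSq_weakDeriv_nodal_of_eq_zero (c : Fin n → ℕ → ℂ) (hr : 1 ≤ H.r N α)
    (h : ∀ k, 1 ≤ k → k ≤ H.r N α → c α k = 0) :
    normSq (H.a α) (H.b α) (weakDeriv (H.a α) (H.b α) (H.nodal N c α))
      = (‖c α 0‖ ^ 2 + ‖c α (H.r N α + 1)‖ ^ 2) / H.h N α := by
  rw [normSq_weakDeriv_nodal, Finset.sum_eq_add 0 (H.r N α) (by omega)]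
  · rw [h 1 le_rfl hr, h _ hr le_rfl]
    simp [add_div]
  · intro k hk hk'
    have := Finset.mem_range.1 hk
    rw [h k (by omega) (by omega), h (k + 1) (by omega) (by omega)]
    simp
  · intro h; exact absurd (Finset.mem_range.2 (by omega)) h
  · intro h; exact absurd (Finset.mem_range.2 (by omega)) h

/-- The error of linear interpolation. -/
lemma norm_slope_sub_le {g : ℝ → ℂ} {u : ℝ → ℂ} {x y t ε : ℝ} (hxy : x < y)
    (hg : ∀ s ∈ Icc x y, HasDerivWithinAt u (g s) (Icc x y) s)
    (h : ∀ s ∈ Icc x y, ‖g s - g t‖ ≤ ε) : ‖(u y - u x) / ((y - x : ℝ) : ℂ) - g t‖ ≤ ε := by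
  -- The mean value inequality for `u s - s * g t`, whose derivative is at most `ε` in norm.
  have h1 := (convex_Icc x y).norm_image_sub_le_of_norm_hasDerivWithin_le
    (f := fun s => u s - (s : ℂ) * g t) (f' := fun s => g s - 1 * g t)
    (fun s hs => (hg s hs).sub ((hasDerivAt_id s).ofReal_comp.mul_const (g t)).hasDerivWithinAt)
    (C := ε) (fun s hs => by rw [one_mul]; exact h s hs) (left_mem_Icc.2 hxy.le)
    (right_mem_Icc.2 hxy.le)
  have h0 : 0 < y - x := sub_pos.2 hxy
  have h2 : ((y - x : ℝ) : ℂ) ≠ 0 := by exact_mod_cast h0.ne'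
  have h3 : (u y - u x) / ((y - x : ℝ) : ℂ) - g t
      = (u y - (y : ℂ) * g t - (u x - (x : ℂ) * g t)) / ((y - x : ℝ) : ℂ) := by
    field_simp
    push_cast
    ring
  rw [h3, norm_div, Complex.norm_real, Real.norm_of_nonneg h0.le, div_le_iff₀ h0]
  rwa [Real.norm_of_nonneg h0.le] at h1

variable (H N) in
/-- The nodal values of a function. -/
noncomputable def nodeValues (Φ : Fun n) : Fin n → ℕ → ℂ := fun α k => Φ α (H.node N α k)

/-- Off the nodes, a null set, the interpolant has the mean slope of `Φ` on the cell as derivative,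
which is within `ε` of `g` when `g` oscillates by at most `ε` over distances up to the mesh size. -/
lemma normSq_weakDeriv_interpolation_sub {g : ℝ → ℂ} {ε : ℝ} (hΦ : H.IsH1 Φ)
    (hg : ∀ x ∈ Icc (H.a α) (H.b α), HasDerivWithinAt (Φ α) (g x) (Icc (H.a α) (H.b α)) x)
    (h : ∀ x ∈ Icc (H.a α) (H.b α), ∀ y ∈ Icc (H.a α) (H.b α), |x - y| ≤ H.h N α →
      ‖g x - g y‖ ≤ ε) :
    normSq (H.a α) (H.b α) (weakDeriv (H.a α) (H.b α)
      (H.nodal N (H.nodeValues N Φ) α - Φ α)) ≤ (H.b α - H.a α) * ε ^ 2 := by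
  have hab := H.a_lt_b α
  have hI := isH1_nodal (H := H) (N := N) (H.nodeValues N Φ) α
  refine normSq_le_of_ae_norm_le hab.le (hI.sub (hΦ α)).memLp ?_
  filter_upwards [(hI.sub (hΦ α)).ae_hasDerivAt hab, ae_exists_mem_cell (N := N) α,
    ae_restrict_mem measurableSet_Ioo] with x h1 ⟨j, hj, hx⟩ hxm
  have h2 := (hasDerivWithinAt_nodal (H.nodeValues N Φ) hj (Ioo_subset_Icc_self hx)).hasDerivAt
    (Icc_mem_nhds hx.1 hx.2)
  have h3 := (hg x (Ioo_subset_Icc_self hxm)).hasDerivAt (Icc_mem_nhds hxm.1 hxm.2)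
  rw [h1.unique (h2.sub h3)]
  have h4 : (H.h N α : ℂ) = ((H.node N α (j + 1) - H.node N α j : ℝ) : ℂ) := by
    rw [node_succ, add_sub_cancel_left]
  rw [h4]
  refine norm_slope_sub_le (node_mono α (Nat.lt_succ_self j))
    (fun s hs => (hg s (cell_subset hj hs)).mono (cell_subset hj)) fun s hs => ?_
  refine h s (cell_subset hj hs) x (Ioo_subset_Icc_self hxm) ?_
  have h5 := node_succ (H := H) (N := N) α j
  have := hx.1; have := hx.2; have := hs.1; have := hs.2
  rw [abs_le]; constructor <;> linarith

end Operator

end SchrodingerFEM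

/-! ### Approximation of C¹ functions by finite elements -/

namespace SchrodingerFEM

/-- A nearly best choice for each `N` works for all `ε` at once; the slack `1 / (N + 1)` is there
because the infimum of the distances may not be attained. -/
lemma exists_tendsto_of_forall_exists_le {X : Type*} [PseudoMetricSpace X] {P : ℕ → X → Prop}
    {y : X} (h : ∀ ε > 0, ∀ᶠ N in atTop, ∃ x, P N x ∧ dist x y ≤ ε) :
    ∃ x : ℕ → X, (∀ᶠ N in atTop, P N (x N)) ∧ Tendsto x atTop (𝓝 y) := by
  have h1 : ∀ N, ∃ x, (∃ x', P N x') →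
      P N x ∧ ∀ x', P N x' → dist x y ≤ dist x' y + 1 / ((N : ℝ) + 1) := by
    intro N
    by_cases hN : ∃ x', P N x'
    · have hne : ((fun x => dist x y) '' {x | P N x}).Nonempty := Set.Nonempty.image _ hN
      have hbd : BddBelow ((fun x => dist x y) '' {x | P N x}) :=
        ⟨0, by rintro _ ⟨x, _, rfl⟩; exact dist_nonneg⟩
      obtain ⟨_, ⟨x, hx, rfl⟩, hlt⟩ := exists_lt_of_csInf_lt hne
        (lt_add_of_pos_right _ (Nat.one_div_pos_of_nat (α := ℝ) (n := N)))
      refine ⟨x, fun _ => ⟨hx, fun x' hx' => hlt.le.trans ?_⟩⟩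
      gcongr
      exact csInf_le hbd ⟨x', hx', rfl⟩
    · exact ⟨y, fun h => absurd h hN⟩
  choose x hx using h1
  refine ⟨x, (h 1 one_pos).mono fun N ⟨x', hx', _⟩ => (hx N ⟨x', hx'⟩).1, ?_⟩
  rw [Metric.tendsto_nhds]
  intro ε hε
  filter_upwards [h (ε / 2) (half_pos hε),
    tendsto_one_div_add_atTop_nhds_zero_nat.eventually_lt_const
    (half_pos hε)] with N ⟨x', hx', hd⟩ hN
  have := (hx N ⟨x', hx'⟩).2 x' hx'
  linarith

namespace Operator

variable {n : ℕ} {H : Operator n} {N : ℕ} {U : Matrix.unitaryGroup (Bdry n) ℂ} {Φ : Fun n}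
  {α : Fin n}

lemma trace_interpolation (Φ : Fun n) : H.trace (H.nodal N (H.nodeValues N Φ)) = H.trace Φ := by
  rw [trace_nodal]
  funext l
  rcases l with α | α
  · rw [outerVal, nodeValues, node_zero, trace]
  · rw [outerVal, nodeValues, node_last, trace]

/-- By the mean value inequality the difference quotients of a fixed C¹ function are bounded
independently of `N`. -/
lemma norm_diffQuot_nodeValues_le {g : Fun n} {G M : ℝ} (hG0 : 0 ≤ G)
    (hMn : 0 ≤ M)
    (hg : ∀ α, ∀ x ∈ Icc (H.a α) (H.b α),
      HasDerivWithinAt (Φ α) (g α x) (Icc (H.a α) (H.b α)) x)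
    (hG : ∀ α, ∀ x ∈ Icc (H.a α) (H.b α), ‖g α x‖ ≤ G)
    (hM : ∀ l, (H.bdryDensity l)⁻¹ ≤ M) :
    ‖H.diffQuot N (H.trace Φ) (H.innerVal N (H.nodeValues N Φ))‖ ≤ G * M := by
  have key : ∀ α, ∀ j k : ℕ, j ≤ H.r N α + 1 → k ≤ H.r N α + 1 →
      ‖Φ α (H.node N α j) - Φ α (H.node N α k)‖ ≤ G * |H.node N α j - H.node N α k| :=
    fun α j k hj hk => (convex_Icc _ _).norm_image_sub_le_of_norm_hasDerivWithin_le (hg α) (hG α)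
      (node_mem hk) (node_mem hj)
  have hM0 : ∀ l, 0 < H.bdryDensity l := fun l => H.bdryDensity_pos l
  have fin : ∀ (α : Fin n) (l : Bdry n) (z : ℂ), H.hBdry N l = H.h N α * H.bdryDensity l →
      ‖z‖ ≤ G * H.h N α → ‖z / (H.hBdry N l : ℂ)‖ ≤ G * M := by
    intro α l z hl hz
    rw [norm_div, Complex.norm_real, Real.norm_of_nonneg (hBdry_pos l).le,
      div_le_iff₀ (hBdry_pos l), hl]
    refine hz.trans ?_
    have h1 : 1 ≤ M * H.bdryDensity l := by
      have := mul_le_mul_of_nonneg_right (hM l) (hM0 l).le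
      rwa [inv_mul_cancel₀ (hM0 l).ne'] at this
    have h2 : 0 ≤ G * H.h N α := mul_nonneg hG0 (h_pos α).le
    nlinarith
  refine (pi_norm_le_iff_of_nonneg (mul_nonneg hG0 hMn)).2 fun l => ?_
  rcases l with α | α
  · refine fin α _ _ rfl ?_
    have h1 := key α 0 1 (by omega) (by omega)
    have h2 : |H.node N α 0 - H.node N α 1| = H.h N α := by
      rw [node_succ, sub_add_cancel_left, abs_neg, abs_of_pos (h_pos α)]
    rwa [h2, node_zero] at h1
  · refine fin α _ _ rfl ?_
    have h1 := key α (H.r N α + 1) (H.r N α) (by omega) (by omega)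
    have h2 : |H.node N α (H.r N α + 1) - H.node N α (H.r N α)| = H.h N α := by
      rw [node_succ, add_sub_cancel_left, abs_of_pos (h_pos α)]
    rwa [h2, node_last] at h1

lemma eventually_derivSq_interpolation_sub_le {g : Fun n} (hΦ : H.IsH1 Φ)
    (hgc : ∀ α, ContinuousOn (g α) (Icc (H.a α) (H.b α)))
    (hg : ∀ α, ∀ x ∈ Icc (H.a α) (H.b α),
      HasDerivWithinAt (Φ α) (g α x) (Icc (H.a α) (H.b α)) x) {δ : ℝ} (hδ : 0 < δ) :
    ∀ᶠ N in atTop, H.derivSq (H.nodal N (H.nodeValues N Φ) - Φ) ≤ δ := by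
  set L : ℝ := ∑ α, (H.b α - H.a α) with hL
  have hL0 : 0 ≤ L := Finset.sum_nonneg fun α _ => (sub_pos.2 (H.a_lt_b α)).le
  set ε : ℝ := Real.sqrt (δ / (L + 1)) with hε
  have hε0 : 0 < ε := Real.sqrt_pos.2 (by positivity)
  have h1 : ∀ α, ∀ᶠ N in atTop, ∀ x ∈ Icc (H.a α) (H.b α), ∀ y ∈ Icc (H.a α) (H.b α),
      |x - y| ≤ H.h N α → ‖g α x - g α y‖ ≤ ε := by
    intro α
    have hu := isCompact_Icc.uniformContinuousOn_of_continuous (hgc α)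
    rw [Metric.uniformContinuousOn_iff] at hu
    obtain ⟨d, hd, h2⟩ := hu ε hε0
    filter_upwards [(H.tendsto_h α).eventually_lt_const hd] with N hN x hx y hy hxy
    rw [← dist_eq_norm]
    exact (h2 x hx y hy (by rw [Real.dist_eq]; exact hxy.trans_lt hN)).le
  filter_upwards [eventually_all.2 h1] with N hN
  calc H.derivSq (H.nodal N (H.nodeValues N Φ) - Φ)
      ≤ ∑ α, (H.b α - H.a α) * ε ^ 2 := Finset.sum_le_sum fun α _ =>
        normSq_weakDeriv_interpolation_sub hΦ (hg α) (hN α)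
    _ = L * (δ / (L + 1)) := by
        rw [← Finset.sum_mul, hε, Real.sq_sqrt (by positivity)]
    _ ≤ δ := by
        rw [mul_div_assoc', div_le_iff₀ (by positivity)]
        nlinarith

/-- For large `N` there is an element of the finite element space with the values of `Φ` at the
interior nodes whose boundary values differ little from those of `Φ`. -/
lemma eventually_exists_correction {g : Fun n} (hΦ : H.trace Φ ∈ bdryRange U)
    (hgc : ∀ α, ContinuousOn (g α) (Icc (H.a α) (H.b α)))
    (hg : ∀ α, ∀ x ∈ Icc (H.a α) (H.b α),
      HasDerivWithinAt (Φ α) (g α x) (Icc (H.a α) (H.b α)) x) {δ : ℝ} (hδ : 0 < δ) :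
    ∀ᶠ N in atTop, ∃ c : Fin n → ℕ → ℂ, H.nodal N (H.nodeValues N Φ + c) ∈ H.S U N ∧
      H.outerVal N c ∈ bdryRange U ∧
      ‖H.outerVal N c‖ ^ 2 ≤ δ ∧ H.derivSq (H.nodal N c) ≤ δ := by
  obtain ⟨C, hC0, hC⟩ := exists_bdryMap_bound U
  obtain ⟨M, hM0, hM⟩ := H.exists_bound
  have hdens : ∀ l, (H.bdryDensity l)⁻¹ ≤ M ∧ H.bdryDensity l ≤ M := by
    rintro (α | α)
    · have := hM α _ (left_mem_Icc.2 (H.a_lt_b α).le); exact ⟨this.2.1, this.1⟩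
    · have := hM α _ (right_mem_Icc.2 (H.a_lt_b α).le); exact ⟨this.2.1, this.1⟩
  choose G' hG' using fun α => isCompact_Icc.exists_bound_of_continuousOn (hgc α)
  obtain ⟨G, hG0, hG⟩ := exists_forall_le G'
  set A : ℝ := C * ‖H.trace Φ‖ + Fintype.card (Bdry n) * (G * M) with hA
  have hA0 : 0 ≤ A := by positivity
  -- Small enough that also `M * δ' ≤ δ`, where `M` converts the weights `1 / ĥ` into `1 / h` at the
  -- end.
  set δ' : ℝ := δ / (M + 1) with hδ'
  have hδ'0 : 0 < δ' := by positivity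
  have hlim : Tendsto (fun T : ℝ => C * (A / T) ^ 2 + A * (A / T)) atTop (𝓝 0) := by
    have h1 : Tendsto (fun T : ℝ => A / T) atTop (𝓝 0) :=
      tendsto_const_nhds.div_atTop tendsto_id
    simpa using ((h1.pow 2).const_mul C).add (h1.const_mul A)
  -- Below, a mesh with `(C + T) ĥ ≤ 1` forces `‖e‖ ≤ A / T`. The number `T` is chosen so that the
  -- bound of `IsBoundaryPair.sum_le` for such `e` is less than `δ'`.
  obtain ⟨T, hT, hT0⟩ := ((hlim.eventually_lt_const hδ'0).and (eventually_gt_atTop 0)).exists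
  filter_upwards [eventually_admissible H U, H.eventually_hBdry_mul_le (C + T),
    H.eventually_hBdry_mul_le 1] with N hN h1 h2
  obtain ⟨c, hc, hcS, hcw⟩ := exists_mem_S hN (H.nodeValues N Φ)
  set e : Bdry n → ℂ := H.outerVal N c - H.trace Φ with he
  have hinner : H.innerVal N c = H.innerVal N (H.nodeValues N Φ) := by
    funext l
    rcases l with α | α <;> have := hN.1 α
    · exact hcw α 1 le_rfl (by omega)
    · exact hcw α _ (by omega) le_rfl
  have hbp : IsBoundaryPair U (H.trace Φ + e)
      (H.diffQuot N (H.trace Φ + e) (H.innerVal N (H.nodeValues N Φ))) := by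
    rw [he, add_sub_cancel, ← hinner, isBoundaryPair_diffQuot_iff]
    exact hc
  have hsum := IsBoundaryPair.sum_le hbp hΦ hC (norm_diffQuot_nodeValues_le (N := N) hG0.le hM0.le
    hg (fun α x hx => (hG' α x hx).trans (hG α)) fun l => (hdens l).1)
  rw [← hA] at hsum
  have h3 := mul_norm_sq_le_sum (by positivity) h1 e
  have h4 := mul_norm_sq_le_sum one_pos h2 e
  -- From `(C + T) ‖e‖² ≤ ∑ ‖e l‖² / ĥ l ≤ C ‖e‖² + A ‖e‖` the terms with `C` cancel.
  have h5 : ‖e‖ ≤ A / T := by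
    rw [le_div_iff₀ hT0]
    rcases (norm_nonneg e).eq_or_lt with h | h
    · rw [← h, zero_mul]; exact hA0
    · have : ‖e‖ * (‖e‖ * T) ≤ ‖e‖ * A := by nlinarith
      exact le_of_mul_le_mul_left this h
  have h6 : ∑ l, ‖e l‖ ^ 2 / H.hBdry N l ≤ δ' := by
    refine (hsum.trans ?_).trans hT.le
    gcongr
  have hout : H.outerVal N (c - H.nodeValues N Φ) = e := by
    rw [he, ← trace_interpolation (N := N) Φ, trace_nodal]
    funext l
    rcases l with α | α <;> rfl
  have h7 : δ' ≤ δ := div_le_self hδ.le (by linarith)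
  refine ⟨c - H.nodeValues N Φ, by rwa [add_sub_cancel], ?_, ?_, ?_⟩
  · rw [hout]
    have := Submodule.sub_mem _ hbp.mem_range hΦ
    rwa [add_sub_cancel_left] at this
  · rw [hout]; linarith
  -- The correction vanishes at the interior nodes, so its energy sits in the two end cells of each
  -- component.
  · calc H.derivSq (H.nodal N (c - H.nodeValues N Φ))
        = ∑ α, (‖e (Sum.inl α)‖ ^ 2 + ‖e (Sum.inr α)‖ ^ 2) / H.h N α := by
          refine Finset.sum_congr rfl fun α _ => ?_
          rw [← hout]
          exact normSq_weakDeriv_nodal_of_eq_zero _ (by have := hN.1 α; omega)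
            fun k hk1 hk2 => sub_eq_zero.2 (hcw α k hk1 hk2)
      _ ≤ ∑ α, (M * (‖e (Sum.inl α)‖ ^ 2 / H.hBdry N (Sum.inl α))
            + M * (‖e (Sum.inr α)‖ ^ 2 / H.hBdry N (Sum.inr α))) := by
          refine Finset.sum_le_sum fun α _ => ?_
          have hq : ∀ (l : Bdry n) (s : ℝ), 0 ≤ s → H.hBdry N l = H.h N α * H.bdryDensity l →
              s / H.h N α ≤ M * (s / H.hBdry N l) := by
            intro l s hs hl
            have hd := H.bdryDensity_pos l
            have hh := H.h_pos (N := N) α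
            rw [hl, div_le_iff₀ hh]
            have : M * (s / (H.h N α * H.bdryDensity l)) * H.h N α = s * (M / H.bdryDensity l) := by
              field_simp
            rw [this]
            exact le_mul_of_one_le_right hs ((one_le_div hd).2 (hdens l).2)
          rw [add_div]
          exact add_le_add (hq _ _ (sq_nonneg _) rfl) (hq _ _ (sq_nonneg _) rfl)
      _ = M * ∑ l, ‖e l‖ ^ 2 / H.hBdry N l := by
          rw [Fintype.sum_sum_type, Finset.sum_add_distrib, mul_add, Finset.mul_sum,
            Finset.mul_sum]
      _ ≤ M * δ' := by gcongr
      _ ≤ δ := by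
          rw [hδ', mul_div_assoc', div_le_iff₀ (by positivity)]
          nlinarith

lemma FormSpace.exists_norm_le_of_trace : ∃ K, 0 < K ∧ ∀ (u : H.FormSpace U) (δ : ℝ),
    H.derivSq (FormSpace.toFun H U u) ≤ δ → ‖H.trace (FormSpace.toFun H U u)‖ ^ 2 ≤ δ →
    ‖u‖ ^ 2 ≤ K * δ := by
  obtain ⟨κ, K, -, hK, h⟩ := H.exists_norm_equiv U
  have hL : ∀ α, 0 < H.b α - H.a α := fun α => sub_pos.2 (H.a_lt_b α)
  set L₁ := ∑ α, (H.b α - H.a α) with hL1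
  set L₂ := ∑ α, (H.b α - H.a α) * (2 * (H.b α - H.a α)) with hL2
  have h1 : 0 ≤ L₁ := Finset.sum_nonneg fun α _ => (hL α).le
  have h2 : 0 ≤ L₂ := Finset.sum_nonneg fun α _ => by have := hL α; positivity
  refine ⟨K * (1 + 2 * L₁ + L₂) + 1, by positivity, fun u δ hd ht => ?_⟩
  have hδ : 0 ≤ δ := (H.derivSq_nonneg _).trans hd
  have h3 := H.valueSq_le_of_isH1 u.isH1 (t := δ) fun α => by
    refine le_trans ?_ ht
    exact pow_le_pow_left₀ (norm_nonneg _)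
      (norm_le_pi_norm (H.trace (FormSpace.toFun H U u)) (Sum.inl α)) 2
  rw [← hL1, ← hL2] at h3
  have h4 : L₂ * H.derivSq (FormSpace.toFun H U u) ≤ L₂ * δ := by gcongr
  calc ‖u‖ ^ 2 ≤ K * (δ + (L₁ * (2 * δ) + L₂ * δ)) := (h u).2.trans (by gcongr; linarith)
    _ ≤ (K * (1 + 2 * L₁ + L₂) + 1) * δ := by nlinarith

/-- Functions of class `C¹` in the domain of the form are approximated by finite elements. -/
lemma exists_approximation {ψ : H.FormSpace U} {g : Fun n}
    (hgc : ∀ α, ContinuousOn (g α) (Icc (H.a α) (H.b α)))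
    (hg : ∀ α, ∀ x ∈ Icc (H.a α) (H.b α),
      HasDerivWithinAt (FormSpace.toFun H U ψ α) (g α x) (Icc (H.a α) (H.b α)) x) :
    ∃ x : ℕ → H.FormSpace U, (∀ᶠ N in atTop, FormSpace.toFun H U (x N) ∈ H.S U N) ∧
      Tendsto x atTop (𝓝 ψ) := by
  refine exists_tendsto_of_forall_exists_le
    (P := fun N (x : H.FormSpace U) => FormSpace.toFun H U x ∈ H.S U N) fun ε hε => ?_
  obtain ⟨K, hK, hn⟩ := FormSpace.exists_norm_le_of_trace (H := H) (U := U)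
  set δ : ℝ := (ε / 2) ^ 2 / K with hδ
  have hδ0 : 0 < δ := by positivity
  have hsmall : ∀ u : H.FormSpace U, ‖u‖ ^ 2 ≤ K * δ → ‖u‖ ≤ ε / 2 := fun u hu => by
    rw [hδ, mul_div_cancel₀ _ hK.ne'] at hu
    exact le_of_sq_le_sq hu (by positivity)
  set Φ := FormSpace.toFun H U ψ with hΦ
  filter_upwards [eventually_derivSq_interpolation_sub_le ψ.isH1 hgc hg hδ0,
    eventually_exists_correction ψ.trace_mem hgc hg hδ0] with N h1 ⟨c, h2, h3, h4, h5⟩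
  have m1 : H.nodal N (H.nodeValues N Φ) - Φ ∈ H.h1Space U := by
    refine ⟨(isH1_nodal _).sub ψ.isH1, ?_⟩
    rw [trace_sub, trace_interpolation, sub_self]
    exact Submodule.zero_mem _
  have m2 : H.nodal N c ∈ H.h1Space U := ⟨isH1_nodal _, by rwa [trace_nodal]⟩
  have n1 := hsmall (FormSpace.mk _ m1) (hn _ δ h1 (by
    rw [FormSpace.toFun_mk, trace_sub, trace_interpolation, sub_self, norm_zero]
    simpa using hδ0.le))
  have n2 := hsmall (FormSpace.mk _ m2) (hn _ δ h5 (by rwa [FormSpace.toFun_mk, trace_nodal]))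
  -- The approximation is `ψ` plus the interpolation error plus the boundary correction, each in the
  -- form domain; the underlying function is a nodal function in S^N.
  refine ⟨ψ + FormSpace.mk _ m1 + FormSpace.mk _ m2, ?_, ?_⟩
  · rw [map_add, map_add, FormSpace.toFun_mk, FormSpace.toFun_mk, ← hΦ, add_sub_cancel, ← map_add]
    exact h2
  · rw [dist_eq_norm, add_assoc, add_sub_cancel_left]
    exact (norm_add_le _ _).trans (by linarith)

end Operator

end SchrodingerFEM

/-! ### Normalized limits, and Ritz–Galerkin systems as eigenfamilies -/

namespace SchrodingerFEM

section Galerkin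

open scoped InnerProductSpace

variable {V E : Type*} [SeminormedAddCommGroup V] [InnerProductSpace ℂ V]
  [SeminormedAddCommGroup E] [InnerProductSpace ℂ E] {J : V →ₗ[ℂ] E}

/-- The approximate eigenvectors converge to normalized eigenvectors. -/
lemma IsGalerkin.exists_normalized {Φ : ℕ → V} {ρ : ℕ → ℝ} {S : ℕ → Submodule ℂ V} {d : ℕ → ℕ}
    {u : ℕ → ℕ → V} {σ : ℕ → ℕ → ℝ} (h : IsGalerkin J Φ ρ S d u σ) (k : ℕ) :
    ∃ ψ : ℕ → V, (∀ N, ‖J (ψ N)‖ = 1 ∧ ∀ v, ⟪v, ψ N⟫_ℂ = (ρ k : ℂ) * ⟪J v, J (ψ N)⟫_ℂ) ∧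
      Tendsto (fun N => ‖u N k - ψ N‖) atTop (𝓝 0) := by
  obtain ⟨m, hm⟩ := h.tendsto_ritz_sub k
  set p : ℕ → V := fun N => ∑ j ∈ (Finset.range m).filter (fun j => ρ j = ρ k),
    ⟪J (Φ j), J (u N k)⟫_ℂ • Φ j with hp
  have hΦ : ∀ j v, ⟪v, Φ j⟫_ℂ = (ρ j : ℂ) * ⟪J v, J (Φ j)⟫_ℂ := fun j v =>
    (h.eigen (j + 1)).eig j j.lt_succ_self v trivial
  have hpe : ∀ N v, ⟪v, p N⟫_ℂ = (ρ k : ℂ) * ⟪J v, J (p N)⟫_ℂ := by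
    intro N v
    simp only [hp, map_sum, map_smul, inner_sum, inner_smul_right, Finset.mul_sum]
    refine Finset.sum_congr rfl fun j hj => ?_
    rw [hΦ, (Finset.mem_filter.1 hj).2]
    ring
  have hpn : ∀ N, ‖p N‖ ^ 2 = ρ k * ‖J (p N)‖ ^ 2 := fun N => by
    have h1 := hpe N (p N)
    rw [inner_self_eq_ofReal, inner_self_eq_ofReal] at h1
    exact_mod_cast h1
  have hΦn : ‖J (Φ k)‖ = 1 := by
    have h1 := (h.eigen (k + 1)).orth k k.lt_succ_self k k.lt_succ_self
    rw [if_pos rfl, inner_self_eq_ofReal] at h1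
    have h2 : ‖J (Φ k)‖ ^ 2 = 1 := by exact_mod_cast h1
    exact (pow_eq_one_iff_of_nonneg (norm_nonneg _) two_ne_zero).1 h2
  have hρ : 0 ≤ ρ k := by
    have h1 := hΦ k (Φ k)
    rw [inner_self_eq_ofReal, inner_self_eq_ofReal, hΦn] at h1
    have h2 : ‖Φ k‖ ^ 2 = ρ k * 1 ^ 2 := by exact_mod_cast h1
    nlinarith [sq_nonneg ‖Φ k‖]
  have hJ : Tendsto (fun N => ‖J (u N k - p N)‖) atTop (𝓝 0) := h.emb.tendsto_norm_map hm
  have hun : ∀ᶠ N in atTop, ‖J (u N k)‖ = 1 := by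
    filter_upwards [h.ritz_lt k] with N ⟨hk, hN⟩
    have h1 := hN.orth k hk k hk
    rw [if_pos rfl, inner_self_eq_ofReal] at h1
    have h2 : ‖J (u N k)‖ ^ 2 = 1 := by exact_mod_cast h1
    exact (pow_eq_one_iff_of_nonneg (norm_nonneg _) two_ne_zero).1 h2
  classical
  -- The projection `p N` may vanish for small `N`; the value `Φ k` keeps the normalization valid
  -- for every `N`. Eventually `‖J (p N)‖` is close to `1`, and normalizing changes `p N` by little.
  refine ⟨fun N => if ‖J (p N)‖ = 0 then Φ k else ((‖J (p N)‖⁻¹ : ℝ) : ℂ) • p N, fun N => ?_, ?_⟩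
  · by_cases h0 : ‖J (p N)‖ = 0
    · simp only [if_pos h0]
      exact ⟨hΦn, hΦ k⟩
    · simp only [if_neg h0]
      refine ⟨?_, fun v => ?_⟩
      · rw [map_smul, norm_smul, Complex.norm_real, norm_inv, norm_norm, inv_mul_cancel₀ h0]
      · rw [map_smul, inner_smul_right, inner_smul_right, hpe]
        ring
  · have hlim : Tendsto (fun N => ‖u N k - p N‖ + Real.sqrt (ρ k) * ‖J (u N k - p N)‖) atTop
        (𝓝 0) := by simpa using hm.add (hJ.const_mul (Real.sqrt (ρ k)))
    refine squeeze_zero' (Eventually.of_forall fun _ => norm_nonneg _) ?_ hlim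
    filter_upwards [hun, hJ.eventually_lt_const one_pos] with N h1 h2
    have h3 : |1 - ‖J (p N)‖| ≤ ‖J (u N k - p N)‖ := by
      rw [← h1, map_sub]; exact abs_norm_sub_norm_le _ _
    have h0 : 0 < ‖J (p N)‖ := by
      have := (le_abs_self (1 - ‖J (p N)‖)).trans h3
      linarith
    rw [if_neg h0.ne']
    have h4 : ‖p N‖ = Real.sqrt (ρ k) * ‖J (p N)‖ := by
      rw [← Real.sqrt_sq (norm_nonneg (p N)), hpn, Real.sqrt_mul hρ, Real.sqrt_sq (norm_nonneg _)]
    have h5 : ‖p N - ((‖J (p N)‖⁻¹ : ℝ) : ℂ) • p N‖ = Real.sqrt (ρ k) * |1 - ‖J (p N)‖| := by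
      have : p N - ((‖J (p N)‖⁻¹ : ℝ) : ℂ) • p N = ((1 - ‖J (p N)‖⁻¹ : ℝ) : ℂ) • p N := by
        push_cast; rw [sub_smul, one_smul]
      rw [this, norm_smul, Complex.norm_real, Real.norm_eq_abs, h4, mul_left_comm]
      congr 1
      rw [← abs_of_pos h0, ← abs_mul, sub_mul, abs_of_pos h0, inv_mul_cancel₀ h0.ne', one_mul,
        abs_sub_comm]
    calc ‖u N k - ((‖J (p N)‖⁻¹ : ℝ) : ℂ) • p N‖
        ≤ ‖u N k - p N‖ + ‖p N - ((‖J (p N)‖⁻¹ : ℝ) : ℂ) • p N‖ :=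
          norm_sub_le_norm_sub_add_norm_sub _ _ _
      _ ≤ _ := by rw [h5]; gcongr

end Galerkin

namespace Operator

variable {n : ℕ} {H : Operator n} {N : ℕ} {U : Matrix.unitaryGroup (Bdry n) ℂ} {Φ Ψ : Fun n}

lemma FormSpace.toFun_injective : Function.Injective (FormSpace.toFun H U) :=
  Subtype.val_injective

variable (H U N) in
/-- The finite element space as a subspace of the form domain. -/
def femSpace : Submodule ℂ (H.FormSpace U) := (H.S U N).comap (FormSpace.toFun H U)

variable (H U N) in
/-- The finite element functions, as functions and as members of the form domain. -/
def femSpaceToFun : H.femSpace N U →ₗ[ℂ] H.S U N :=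
  (FormSpace.toFun H U).restrict fun _ h => h

lemma bijective_femSpaceToFun (h : H.Admissible U N) :
    Function.Bijective (H.femSpaceToFun N U) := by
  constructor
  · intro v w hvw
    exact Subtype.ext (FormSpace.toFun_injective 
      (congrArg (fun f : H.S U N => (f : Fun n)) hvw))
  · rintro ⟨f, hf⟩
    exact ⟨⟨FormSpace.mk f (mem_h1Space_of_mem_weakDomain (mem_weakDomain_of_mem_S h hf)), hf⟩, rfl⟩

lemma finrank_femSpace (h : H.Admissible U N) :
    Module.finrank ℂ (H.femSpace N U) = H.dimS N := by
  rw [(LinearEquiv.ofBijective _ (bijective_femSpaceToFun h)).finrank_eq, finrank_S h]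

lemma finiteDimensional_femSpace (h : H.Admissible U N) :
    FiniteDimensional ℂ (H.femSpace N U) :=
  have := finiteDimensional_S h
  (LinearEquiv.ofBijective _ (bijective_femSpaceToFun h)).symm.finiteDimensional

/-- All elements of S^N satisfy the boundary condition, so there `Q` is the hermitian form up to the
shift, and the finite dimensional spectral theorem applies because the seminorm is definite on S^N.
-/
lemma exists_isRitzGalerkinSystem (h : H.Admissible U N) :
    ∃ (u : ℕ → Fun n) (μ : ℕ → ℝ), H.IsRitzGalerkinSystem U N u μ := by
  have := finiteDimensional_femSpace h
  obtain ⟨e, ρ, he⟩ := (H.isCompactEmbedding_embed U).exists_isEigenfamily_of_finrank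
    (H.femSpace N U) fun v hv h0 => FormSpace.toFun_injective (by
      rw [map_zero]
      exact eq_zero_of_eqOn_zero h hv (FormSpace.eqOn_zero h0))
  rw [finrank_femSpace h] at he
  refine ⟨fun k => FormSpace.toFun H U (e k), fun k => ρ k - H.shift U,
    fun k hk => ⟨he.mem k hk, fun Ψ hΨ => ?_⟩, he.orth,
    fun j k hjk hk => sub_le_sub_right (he.mono j k hjk hk) _⟩
  have hΨ' := mem_h1Space_of_mem_weakDomain (mem_weakDomain_of_mem_S h hΨ)
  have h1 := he.eig k hk (FormSpace.mk Ψ hΨ') hΨ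
  rw [FormSpace.inner_def, inner_embed, FormSpace.toFun_mk,
    form_eq_Q _ (mem_weakDomain_of_mem_S h (he.mem k hk)) hΨ'.2] at h1
  push_cast
  linear_combination h1

/-- A solution of the Ritz-Galerkin problem is a complete system of eigenvectors of the form on
the finite element space. -/
lemma IsRitzGalerkinSystem.exists_isEigenfamily {u : ℕ → Fun n} {μ : ℕ → ℝ}
    (h : H.Admissible U N) (hu : H.IsRitzGalerkinSystem U N u μ) :
    ∃ v : ℕ → H.FormSpace U, (∀ k < H.dimS N, FormSpace.toFun H U (v k) = u k) ∧
      IsEigenfamily (H.embed U) (H.femSpace N U) (H.dimS N) v fun k => μ k + H.shift U := by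
  classical
  have hm : ∀ k < H.dimS N, u k ∈ H.h1Space U := fun k hk =>
    mem_h1Space_of_mem_weakDomain (mem_weakDomain_of_mem_S h (hu.1 k hk).1)
  set v : ℕ → H.FormSpace U := fun k => if hk : k < H.dimS N then FormSpace.mk (u k) (hm k hk)
    else 0 with hv
  have hvu : ∀ k < H.dimS N, FormSpace.toFun H U (v k) = u k := fun k hk => by
    simp only [hv, dif_pos hk, FormSpace.toFun_mk]
  have := finiteDimensional_femSpace h
  refine ⟨v, hvu, isEigenfamily_of_finrank (finrank_femSpace h) (fun k hk => ?_)
    (fun k hk w hw => ?_) (fun j hj k hk => ?_) fun j k hjk hk => ?_⟩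
  · change FormSpace.toFun H U (v k) ∈ H.S U N
    rw [hvu k hk]
    exact (hu.1 k hk).1
  · rw [FormSpace.inner_def, inner_embed, hvu k hk,
      form_eq_Q _ (mem_weakDomain_of_mem_S h (hu.1 k hk).1) w.trace_mem, (hu.1 k hk).2 _ hw]
    push_cast
    ring
  · rw [inner_embed, hvu j hj, hvu k hk]
    exact hu.2.1 j hj k hk
  · have := hu.2.2 j k hjk hk
    gcongr

lemma exists_ne_zero_of_inner2_ne_zero (h : H.inner2 Φ Φ ≠ 0) :
    ∃ α, ∃ x ∈ Icc (H.a α) (H.b α), Φ α x ≠ 0 := by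
  by_contra! h0
  refine h (Finset.sum_eq_zero fun α _ => ?_)
  refine intervalIntegral.integral_zero_ae (Eventually.of_forall fun x hx => ?_)
  rw [uIoc_of_le (H.a_lt_b α).le] at hx
  rw [h0 α x (Ioc_subset_Icc_self hx), mul_zero, zero_mul]

lemma isWeakEigenpair_toFun {ψ : H.FormSpace U} {r : ℝ} (h1 : ‖H.embed U ψ‖ = 1)
    (h : ∀ v, inner ℂ v ψ = (r : ℂ) * inner ℂ (H.embed U v) (H.embed U ψ)) :
    H.IsWeakEigenpair U (FormSpace.toFun H U ψ) ((r - H.shift U : ℝ) : ℂ) ∧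
      H.inner2 (FormSpace.toFun H U ψ) (FormSpace.toFun H U ψ) = 1 := by
  have h2 : H.inner2 (FormSpace.toFun H U ψ) (FormSpace.toFun H U ψ) = 1 := by
    rw [← inner_embed, inner_self_eq_ofReal, h1]
    norm_num
  refine ⟨isWeakEigenpair_of_form_eq (c := H.shift U) ⟨ψ.isH1, ψ.trace_mem⟩
    (exists_ne_zero_of_inner2_ne_zero (by rw [h2]; exact one_ne_zero)) fun Ψ hΨ => ?_, h2⟩
  have h3 := h (FormSpace.mk Ψ hΨ)
  rw [FormSpace.inner_def, inner_embed, FormSpace.toFun_mk] at h3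
  rw [h3]
  push_cast
  ring

lemma IsWeakEigenpair.exists_formSpace {μ : ℂ} (h : H.IsWeakEigenpair U Ψ μ) :
    ∃ ψ : H.FormSpace U, FormSpace.toFun H U ψ = Ψ ∧
      ∀ v, inner ℂ v ψ = (μ + H.shift U) * inner ℂ (H.embed U v) (H.embed U ψ) := by
  refine ⟨FormSpace.mk Ψ (mem_h1Space_of_mem_weakDomain h.1), rfl, fun v => ?_⟩
  rw [FormSpace.inner_def, inner_embed, FormSpace.toFun_mk]
  exact h.form_eq _ ⟨v.isH1, v.trace_mem⟩

variable (H U) in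
lemma exists_normH1_le : ∃ K, ∀ u : H.FormSpace U,
    H.normH1 (FormSpace.toFun H U u) ≤ K * ‖u‖ := by
  obtain ⟨M, hM, h1, h2⟩ := H.exists_form_bounds
  obtain ⟨κ, K, hκ, -, h3⟩ := H.exists_norm_equiv U
  refine ⟨Real.sqrt (M / κ), fun u => ?_⟩
  have h4 := (h1 _ u.isH1).2
  have h5 := (h2 (FormSpace.toFun H U u) fun α => u.isH1.memLp α).2.1
  have h6 := (h3 u).1
  rw [← Real.sqrt_sq (norm_nonneg u), ← Real.sqrt_mul (by positivity), normH1]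
  refine Real.sqrt_le_sqrt ?_
  rw [Complex.add_re, div_mul_eq_mul_div, le_div_iff₀ hκ]
  nlinarith

end Operator

end SchrodingerFEM

/-! ### Transfer of the abstract results to the operator -/

namespace SchrodingerFEM

namespace Operator

variable {n : ℕ} {H : Operator n} {U : Matrix.unitaryGroup (Bdry n) ℂ} {e : ℕ → H.FormSpace U}
  {ρ : ℕ → ℝ}

lemma isWeakSpectrum_toFun (he : ∀ m, IsEigenfamily (H.embed U) ⊤ m e ρ)
    (hρ : Tendsto ρ atTop atTop) :
    H.IsWeakSpectrum U (fun k => FormSpace.toFun H U (e k)) fun k => ρ k - H.shift U := by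
  have horth : ∀ j k, inner ℂ (H.embed U (e j)) (H.embed U (e k)) = if j = k then (1 : ℂ) else 0 :=
    fun j k => (he (max j k + 1)).orth j (by omega) k (by omega)
  refine ⟨fun k => (isWeakEigenpair_toFun ?_ fun v =>
      (he (k + 1)).eig k k.lt_succ_self v trivial).1,
    horth, fun j k hjk => sub_le_sub_right ((he (k + 1)).mono j k hjk k.lt_succ_self) _,
    tendsto_atTop_add_const_right _ _ hρ, fun Ψ μ hΨ => ?_⟩
  · have h1 := horth k k
    rw [if_pos rfl, inner_self_eq_ofReal] at h1
    have h2 : ‖H.embed U (e k)‖ ^ 2 = 1 := by exact_mod_cast h1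
    exact (pow_eq_one_iff_of_nonneg (norm_nonneg _) two_ne_zero).1 h2
  · obtain ⟨ψ, rfl, hψ⟩ := hΨ.exists_formSpace
    obtain ⟨w, hw, h0⟩ := (H.isCompactEmbedding_embed U).exists_mem_span he hρ hψ
    refine ⟨FormSpace.toFun H U w, ?_, fun α x hx => ?_⟩
    · have h1 := Submodule.mem_map_of_mem (f := FormSpace.toFun H U) hw
      rw [Submodule.map_span] at h1
      refine Submodule.span_mono ?_ h1
      rintro _ ⟨_, ⟨k, hk, rfl⟩, rfl⟩
      refine ⟨k, ?_, rfl⟩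
      push_cast
      rw [hk]
      ring
    · have h1 := FormSpace.eqOn_zero h0 α hx
      rw [map_sub] at h1
      exact sub_eq_zero.1 h1

variable {u : ℕ → ℕ → Fun n} {μ : ℕ → ℕ → ℝ}

lemma exists_isGalerkin (hn : 1 ≤ n) (he : ∀ m, IsEigenfamily (H.embed U) ⊤ m e ρ)
    (hρ : Tendsto ρ atTop atTop)
    (hu : ∀ N, H.Admissible U N → H.IsRitzGalerkinSystem U N (u N) (μ N)) :
    ∃ v : ℕ → ℕ → H.FormSpace U,
      (∀ N, H.Admissible U N → ∀ k < H.dimS N, FormSpace.toFun H U (v N k) = u N k) ∧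
      IsGalerkin (H.embed U) e ρ (fun N => H.femSpace N U) H.dimS v
        fun N k => μ N k + H.shift U := by
  have h1 : ∀ N, ∃ v : ℕ → H.FormSpace U, H.Admissible U N →
      (∀ k < H.dimS N, FormSpace.toFun H U (v k) = u N k) ∧
      IsEigenfamily (H.embed U) (H.femSpace N U) (H.dimS N) v fun k => μ N k + H.shift U := by
    intro N
    by_cases h : H.Admissible U N
    · obtain ⟨v, hv⟩ := (hu N h).exists_isEigenfamily h
      exact ⟨v, fun _ => hv⟩
    · exact ⟨0, fun h' => absurd h' h⟩
  choose v hv using h1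
  refine ⟨v, fun N hN => (hv N hN).1, H.isCompactEmbedding_embed U, he, hρ,
    (eventually_admissible H U).mono fun N hN => (hv N hN).2, H.tendsto_dimS hn, fun Ψ r hΨ => ?_⟩
  -- An abstract eigenvector is either zero on the manifold, hence trivially C¹ there, or a weak
  -- eigenfunction, to which regularity applies. Being C¹ is all that the approximation needs.
  have h0 : ∃ g : Fun n, (∀ α, ContinuousOn (g α) (Icc (H.a α) (H.b α))) ∧
      ∀ α, ∀ x ∈ Icc (H.a α) (H.b α),
        HasDerivWithinAt (FormSpace.toFun H U Ψ α) (g α x) (Icc (H.a α) (H.b α)) x := by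
    by_cases hz : ∃ α, ∃ x ∈ Icc (H.a α) (H.b α), FormSpace.toFun H U Ψ α x ≠ 0
    · refine (isWeakEigenpair_of_form_eq (μ := ((r - H.shift U : ℝ) : ℂ)) (c := H.shift U)
        ⟨Ψ.isH1, Ψ.trace_mem⟩ hz fun w hw => ?_).regularity.1
      have h3 := hΨ (FormSpace.mk w hw)
      rw [FormSpace.inner_def, inner_embed, FormSpace.toFun_mk] at h3
      rw [h3]
      push_cast
      ring
    · push Not at hz
      exact ⟨0, fun α => continuousOn_const, fun α x hx =>
        (hasDerivWithinAt_const x _ (0 : ℂ)).congr (hz α) (hz α x hx)⟩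
  obtain ⟨g, hgc, hg⟩ := h0
  obtain ⟨x, hx, hlim⟩ := exists_approximation hgc hg
  exact ⟨x, hx, tendsto_iff_norm_sub_tendsto_zero.1 hlim⟩

lemma exists_tendsto_normH1_ritz {v : ℕ → ℕ → H.FormSpace U} {d : ℕ → ℕ}
    {S : ℕ → Submodule ℂ (H.FormSpace U)} {σ : ℕ → ℕ → ℝ}
    (hv : ∀ N, H.Admissible U N → ∀ k < d N, FormSpace.toFun H U (v N k) = u N k)
    (h : IsGalerkin (H.embed U) e ρ S d v σ) (k : ℕ) : ∃ Ψ : ℕ → Fun n,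
      (∀ N, H.IsWeakEigenpair U (Ψ N) ((ρ k - H.shift U : ℝ) : ℂ) ∧
        H.inner2 (Ψ N) (Ψ N) = 1) ∧
      Tendsto (fun N => H.normH1 (u N k - Ψ N)) atTop (𝓝 0) := by
  obtain ⟨K, hK⟩ := exists_normH1_le H U
  obtain ⟨ψ, h1, h2⟩ := h.exists_normalized k
  refine ⟨fun N => FormSpace.toFun H U (ψ N), fun N => isWeakEigenpair_toFun (h1 N).1 (h1 N).2, ?_⟩
  refine squeeze_zero' (Eventually.of_forall fun _ => Real.sqrt_nonneg _) ?_
    (by simpa using h2.const_mul K)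
  filter_upwards [eventually_admissible H U, h.dim.eventually_gt_atTop k] with N hN hk
  rw [← hv N hN k hk, ← map_sub]
  exact hK _

lemma exists_tendsto_normH1_eigenvector {v : ℕ → ℕ → H.FormSpace U} {d : ℕ → ℕ}
    {S : ℕ → Submodule ℂ (H.FormSpace U)} {σ : ℕ → ℕ → ℝ}
    (hv : ∀ N, H.Admissible U N → ∀ k < d N, FormSpace.toFun H U (v N k) = u N k)
    (h : IsGalerkin (H.embed U) e ρ S d v σ) {Ψ : Fun n} {ν : ℝ}
    (hΨ : H.IsWeakEigenpair U Ψ (ν : ℂ)) : ∃ w : ℕ → Fun n,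
      (∀ N, w N ∈ Submodule.span ℂ
        {f | ∃ j < d N, ρ j - H.shift U = ν ∧ f = u N j}) ∧
      Tendsto (fun N => H.normH1 (w N - Ψ)) atTop (𝓝 0) := by
  obtain ⟨K, hK⟩ := exists_normH1_le H U
  obtain ⟨ψ, rfl, hψ⟩ := hΨ.exists_formSpace
  obtain ⟨m, c, hlim⟩ := h.tendsto_sub_eigenvector (Ψ := ψ) (r := ν + H.shift U) (by
    push_cast; exact hψ)
  set I := (Finset.range m).filter fun j => ρ j = ν + H.shift U with hI
  classical
  -- Membership in the span is claimed for every `N`, so the combination is replaced by `0` for the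
  -- finitely many `N` at which some index could reach `d N`.
  refine ⟨fun N => if m ≤ d N then ∑ j ∈ I, c N j • u N j else 0, fun N => ?_, ?_⟩
  · beta_reduce
    split_ifs with hN
    · refine Submodule.sum_mem _ fun j hj => Submodule.smul_mem _ _ (Submodule.subset_span ?_)
      obtain ⟨h1, h2⟩ := Finset.mem_filter.1 hj
      exact ⟨j, (Finset.mem_range.1 h1).trans_le hN, by rw [h2, add_sub_cancel_right], rfl⟩
    · exact Submodule.zero_mem _
  · refine squeeze_zero' (Eventually.of_forall fun _ => Real.sqrt_nonneg _) ?_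
      (by simpa using hlim.const_mul K)
    filter_upwards [eventually_admissible H U, h.dim.eventually_ge_atTop m] with N hN hm
    have h1 : ∑ j ∈ I, c N j • u N j = FormSpace.toFun H U (∑ j ∈ I, c N j • v N j) := by
      rw [map_sum]
      refine Finset.sum_congr rfl fun j hj => ?_
      rw [map_smul, hv N hN j ((Finset.mem_range.1 (Finset.mem_filter.1 hj).1).trans_le hm)]
    rw [if_pos hm, h1, ← map_sub]
    exact hK _

end Operator

end SchrodingerFEM

theorem mainTheorem1 {n : ℕ} (hn : 1 ≤ n) (H : SchrodingerFEM.Operator n)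
    (U : Matrix.unitaryGroup (SchrodingerFEM.Bdry n) ℂ) :
    -- the scheme is well posed
    (∀ᶠ N in atTop, H.Admissible U N) ∧
    (∀ N, H.Admissible U N →
      (∀ f ∈ H.S U N, f ∈ H.weakDomain U) ∧
      Module.finrank ℂ (H.S U N) = H.dimS N ∧
      ∃ (u : ℕ → SchrodingerFEM.Fun n) (μ : ℕ → ℝ), H.IsRitzGalerkinSystem U N u μ) ∧
    -- the weak spectral problem has a complete enumeration of eigenpairs
    ∃ (Φ : ℕ → SchrodingerFEM.Fun n) (lam : ℕ → ℝ), H.IsWeakSpectrum U Φ lam ∧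
      -- convergence, for every choice of the approximate eigenpairs
      ∀ (u : ℕ → ℕ → SchrodingerFEM.Fun n) (μ : ℕ → ℕ → ℝ),
        (∀ N, H.Admissible U N → H.IsRitzGalerkinSystem U N (u N) (μ N)) →
        -- convergence of the eigenvalues
        (∀ k, Tendsto (fun N => μ N k) atTop (𝓝 (lam k))) ∧
        -- approximate eigenfunctions converge to eigenfunctions
        (∀ k, ∃ Ψ : ℕ → SchrodingerFEM.Fun n,
          (∀ N, H.IsWeakEigenpair U (Ψ N) (lam k : ℂ) ∧ H.inner2 (Ψ N) (Ψ N) = 1) ∧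
          Tendsto (fun N => H.normH1 (u N k - Ψ N)) atTop (𝓝 0)) ∧
        -- every eigenfunction is approximated within the corresponding eigenspaces
        (∀ (Ψ : SchrodingerFEM.Fun n) (ν : ℝ), H.IsWeakEigenpair U Ψ (ν : ℂ) →
          ∃ w : ℕ → SchrodingerFEM.Fun n,
            (∀ N, w N ∈ Submodule.span ℂ {f | ∃ j < H.dimS N, lam j = ν ∧ f = u N j}) ∧
            Tendsto (fun N => H.normH1 (w N - Ψ)) atTop (𝓝 0)) := by
  obtain ⟨e, ρ, he, hρ⟩ :=
    (H.isCompactEmbedding_embed U).exists_isEigenfamily (H.hasRoom U hn)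
  refine ⟨SchrodingerFEM.Operator.eventually_admissible H U, fun N hN =>
    ⟨fun f => SchrodingerFEM.Operator.mem_weakDomain_of_mem_S hN,
      SchrodingerFEM.Operator.finrank_S hN,
      SchrodingerFEM.Operator.exists_isRitzGalerkinSystem hN⟩,
    _, _, SchrodingerFEM.Operator.isWeakSpectrum_toFun he hρ, fun u μ hu => ?_⟩
  obtain ⟨v, hv, hG⟩ := SchrodingerFEM.Operator.exists_isGalerkin hn he hρ hu
  refine ⟨fun k => ?_, SchrodingerFEM.Operator.exists_tendsto_normH1_ritz hv hG,
    fun Ψ ν hΨ => SchrodingerFEM.Operator.exists_tendsto_normH1_eigenvector hv hG hΨ⟩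
  simpa using (hG.tendsto_eigenvalue k).sub_const (H.shift U)
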